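/- An instance of the Hamiltonian cycle problem is a finite loopless directed graph $\Gamma$ (an undirected edge counts as a pair of opposite directed edges); it is Hamiltonian if its $N$ vertices can be arranged cyclically as $v_0\to v_1\to\dots\to v_{N-1}\to v_0$. Let $e$ be its number of directed edges and $k=\sum_v\max(\deg^{\rm in}v,\deg^{\rm out}v)$. Below, "replacing a vertex $v$ by a subgraph" means that every edge incident with $v$ is kept, with its direction (if any) and its other end, and becomes an external edge at a specified vertex of the subgraph. * A *split* has vertices $1,2$ and the directed edge $(1,2)$; incoming external edges are at $1$, outgoing ones at $2$. An *in-split* has vertices $1,2,3$ and directed edges $(1,2),(1,3),(2,1),(2,3)$; incoming external edges are shared by $1$ and $2$ in numbers differing by at most one, outgoing ones are at $3$. An *out-split* has vertices $1,2,3$ and directed edges $(1,2),(1,3),(2,3),(3,2)$; incoming external edges are at $1$, outgoing ones are shared by $2$ and $3$ in numbers differing by at most one. * For $s\ge4$, the *$s$-gate* is the undirected graph with vertices $1,\dots,10$ and $b_1,\dots,b_{2s-7}$, with edges $\{1,3\},\{1,8\},\{2,3\},\{2,5\},\{3,4\},\{4,5\},\{4,6\},\{6,7\},\{7,8\},\{7,10\},\{8,9\},\{9,10\}$,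 $\{b_j,b_{j+1}\}$ for $1\le j<2s-7$, $\{5,b_1\}$, $\{10,b_{2s-7}\}$, and $\{1,b_j\}$ for even $j$. It has one external edge at each of $1,2,9$ and $b_j$, $j$ odd. When some of the external edges are directed ($s'$ incoming, $r'$ outgoing) it serves as an *$(s',r')$-gate*. * A *diamond* is $K_4$ minus one edge, with one external edge at each of its two vertices of degree $2$. The *conversion procedure* with parameter $d\ge4$ is as follows. 1. While some vertex $v$ has in-degree or out-degree greater than $d$, perform the Splitting Procedure on it: replace $v$ by a split; while a vertex of the subgraph replacing $v$ has in-degree $>d$, replace it by an in-split; then, while a vertex of that subgraph has out-degree $>d$, replace it by an out-split. 2. While some vertex is incident with $s\ge4$ edges (incoming, outgoing and undirected edges counted together), replace it by an $s$-gate whose external edges are, in any order, these $s$ edges. 3. Make the graph undirected (Karp): each vertex $i$ becomes a path $i_1-i_2-i_3$, and each directed edge $(i,j)$ becomes the undirected edge $\{i_3,j_1\}$, an undirected edge counting as two directed ones. 4. While some vertex has degree $4$, replace it by a $4$-gate. 5. If some vertex has degree at most $1$, replace the whole graph by the Petersen graph; otherwise, while some vertex has degree $2$, replace it by a diamond. **Theorem.**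 For every integer $d\ge4$, none of the loops in this procedure can run forever, and there is a constant $C$, depending only on $d$, such that for every instance $\Gamma$ with $N$ vertices the procedure has an outcome, and, whatever choices are made, every outcome $\Gamma'$ is an undirected cubic graph such that * $\Gamma'$ is Hamiltonian if and only if $\Gamma$ is; * if $k\ge1$, then $\Gamma'$ has at most $Ck$ vertices and at most $Ck$ edges; * the numbers of vertices and edges of $\Gamma'$ add up to at most $C(N+e)$, i.e. the conversion is linearly-growing. -/

import Mathlib

/-! ## Instances of the (general, directed) Hamiltonian cycle problem -/

/-- A directed graph on a finite vertex set has a Hamiltonian cycle: its vertices can be arranged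
cyclically as `v₀ → v₁ → ⋯ → v_{N-1} → v₀`. (A loopless digraph with fewer than two vertices has
none; on two vertices the pair `u → v → u` is one.) -/
def HasDirectedHamiltonianCycle {V : Type} (G : Digraph V) : Prop :=
  ∃ f : ZMod (Nat.card V) ≃ V, ∀ i, G.Adj (f i) (f (i + 1))

/-- The number `k`: the sum over all vertices of the larger of in-degree and out-degree. -/
noncomputable def sumMaxDegree {V : Type} (G : Digraph V) : ℕ :=
  ∑ᶠ v : V, max {u | G.Adj u v}.ncard {w | G.Adj v w}.ncard

/-- The number of (directed) edges. -/
noncomputable def numArcs {V : Type} (G : Digraph V) : ℕ :=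
  {x : V × V | G.Adj x.1 x.2}.ncard

/-! ## Mixed graphs and the replacement of a vertex by a subgraph -/

/-- A finite graph with directed edges (`Arc`) and undirected edges (`edge`), without loops. -/
structure MixedGraph where
  V : Type
  finite : Finite V
  Arc : V → V → Prop
  arc_irrefl : ∀ v, ¬ Arc v v
  edge : SimpleGraph V

/-- The ways in which an edge may be incident with a given vertex: incoming, outgoing, or
undirected. -/
inductive Kind
  | inc
  | out
  | und

namespace MixedGraph

instance (M : MixedGraph) : Finite M.V := M.finite

/-- A loopless directed graph, all of whose edges are directed. -/
def ofDigraph {V : Type} [Finite V] (G : Digraph V) (hG : ∀ v, ¬ G.Adj v v) : MixedGraph where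
  V := V
  finite := inferInstance
  Arc := G.Adj
  arc_irrefl := hG
  edge := ⊥

/-- An undirected graph. -/
def ofSimpleGraph {V : Type} [Finite V] (G : SimpleGraph V) : MixedGraph where
  V := V
  finite := inferInstance
  Arc _ _ := False
  arc_irrefl _ := id
  edge := G

noncomputable def inDegree (M : MixedGraph) (v : M.V) : ℕ := {u | M.Arc u v}.ncard

noncomputable def outDegree (M : MixedGraph) (v : M.V) : ℕ := {w | M.Arc v w}.ncard

/-- The edges incident with `v`, each given by its kind and its other end. -/
def incident (M : MixedGraph) (v : M.V) : Set (Kind × M.V) :=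
  {x | match x with
    | (Kind.inc, u) => M.Arc u v
    | (Kind.out, w) => M.Arc v w
    | (Kind.und, w) => M.edge.Adj v w}

/-- The number of edges incident with `v`: incoming, outgoing, and undirected ones. -/
noncomputable def degree (M : MixedGraph) (v : M.V) : ℕ := (M.incident v).ncard

/-- Replace the vertex `v` by the graph `H`. Every edge that was incident with `v` is kept, with
its kind and its other end; its end `v` becomes the vertex of `H` that `p` assigns to the edge. -/
def replace (M : MixedGraph) (v : M.V) (H : MixedGraph) (p : Kind × M.V → H.V) : MixedGraph where
  V := {w : M.V // w ≠ v} ⊕ H.V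
  finite := inferInstance
  Arc x y :=
    match x, y with
    | .inl a, .inl b => M.Arc a b
    | .inl a, .inr h => M.Arc a v ∧ p (Kind.inc, a) = h
    | .inr h, .inl b => M.Arc v b ∧ p (Kind.out, b) = h
    | .inr h, .inr h' => H.Arc h h'
  arc_irrefl x := by
    rcases x with a | h
    · exact M.arc_irrefl a
    · exact H.arc_irrefl h
  edge :=
    { Adj := fun x y =>
        match x, y with
        | .inl a, .inl b => M.edge.Adj a b
        | .inl a, .inr h => M.edge.Adj v a ∧ p (Kind.und, a) = h
        | .inr h, .inl b => M.edge.Adj v b ∧ p (Kind.und, b) = h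
        | .inr h, .inr h' => H.edge.Adj h h'
      symm := ⟨by
        rintro (a | h) (b | h') hxy
        · exact M.edge.adj_symm hxy
        · exact hxy
        · exact hxy
        · exact H.edge.adj_symm hxy⟩
      loopless := ⟨by
        rintro (a | h) hx
        · exact M.edge.loopless.irrefl _ hx
        · exact H.edge.loopless.irrefl _ hx⟩ }

end MixedGraph

/-- `RunLoop step a b`: starting from `a`, steps are performed, with arbitrary choices, as long as
possible, and the result is `b`. -/
def RunLoop {α : Type*} (step : α → α → Prop) (a b : α) : Prop :=
  Relation.ReflTransGen step a b ∧ ∀ c, ¬ step b c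

/-- There is no infinite sequence of steps. -/
def LoopTerminates {α : Type*} (step : α → α → Prop) : Prop :=
  WellFounded fun b a => step a b

namespace HCP

open MixedGraph

/-! ## The Splitting Procedure -/

/-- A split: vertices `1, 2` (here `0, 1`) and the directed edge `(1,2)`. -/
def split : MixedGraph where
  V := Fin 2
  finite := inferInstance
  Arc a b := (a, b) = (0, 1)
  arc_irrefl := by decide
  edge := ⊥

/-- An in-split: vertices `1, 2, 3` (here `0, 1, 2`) and the directed edges
`(1,2), (1,3), (2,1), (2,3)`. -/
def inSplit : MixedGraph where
  V := Fin 3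
  finite := inferInstance
  Arc a b := (a, b) ∈ ([(0, 1), (0, 2), (1, 0), (1, 2)] : List (Fin 3 × Fin 3))
  arc_irrefl := by decide
  edge := ⊥

/-- An out-split: vertices `1, 2, 3` (here `0, 1, 2`) and the directed edges
`(1,2), (1,3), (2,3), (3,2)`. -/
def outSplit : MixedGraph where
  V := Fin 3
  finite := inferInstance
  Arc a b := (a, b) ∈ ([(0, 1), (0, 2), (1, 2), (2, 1)] : List (Fin 3 × Fin 3))
  arc_irrefl := by decide
  edge := ⊥

/-- A graph in which a subgraph, given by its vertex set, is singled out: in the Splitting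
Procedure, the subgraph that has replaced the vertex under consideration. -/
structure Marked where
  graph : MixedGraph
  part : Set graph.V

/-- Replace a vertex by a subgraph, all of whose vertices belong to the marked part. -/
def Marked.replace (A : Marked) (v : A.graph.V) (H : MixedGraph)
    (p : Kind × A.graph.V → H.V) : Marked where
  graph := A.graph.replace v H p
  part := {x | match x with
    | .inl w => w.1 ∈ A.part
    | .inr _ => True}

/-- Replace `v` by a split: incoming edges go to vertex `1`, outgoing edges leave from `2`. -/
def InitialSplit (M : MixedGraph) (v : M.V) (B : Marked) : Prop :=
  ∃ p : Kind × M.V → Fin 2,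
    (∀ u, M.Arc u v → p (Kind.inc, u) = 0) ∧
    (∀ w, M.Arc v w → p (Kind.out, w) = 1) ∧
    B = Marked.replace ⟨M, ∅⟩ v split p

/-- Replace a vertex of the marked part with in-degree greater than `d` by an in-split: its incoming
edges are shared as equally as possible by vertices `1` and `2`, its outgoing edges leave from
`3`. -/
def InSplitStep (d : ℕ) (A B : Marked) : Prop :=
  ∃ v ∈ A.part, ∃ p : Kind × A.graph.V → Fin 3,
    d < A.graph.inDegree v ∧
    (∀ u, A.graph.Arc u v → p (Kind.inc, u) = 0 ∨ p (Kind.inc, u) = 1) ∧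
    {u | A.graph.Arc u v ∧ p (Kind.inc, u) = 0}.ncard ≤
      {u | A.graph.Arc u v ∧ p (Kind.inc, u) = 1}.ncard + 1 ∧
    {u | A.graph.Arc u v ∧ p (Kind.inc, u) = 1}.ncard ≤
      {u | A.graph.Arc u v ∧ p (Kind.inc, u) = 0}.ncard + 1 ∧
    (∀ w, A.graph.Arc v w → p (Kind.out, w) = 2) ∧
    B = A.replace v inSplit p

/-- Replace a vertex of the marked part with out-degree greater than `d` by an out-split: its
incoming edges go to vertex `1`, its outgoing edges are shared as equally as possible by vertices
`2` and `3`. -/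
def OutSplitStep (d : ℕ) (A B : Marked) : Prop :=
  ∃ v ∈ A.part, ∃ p : Kind × A.graph.V → Fin 3,
    d < A.graph.outDegree v ∧
    (∀ u, A.graph.Arc u v → p (Kind.inc, u) = 0) ∧
    (∀ w, A.graph.Arc v w → p (Kind.out, w) = 1 ∨ p (Kind.out, w) = 2) ∧
    {w | A.graph.Arc v w ∧ p (Kind.out, w) = 1}.ncard ≤
      {w | A.graph.Arc v w ∧ p (Kind.out, w) = 2}.ncard + 1 ∧
    {w | A.graph.Arc v w ∧ p (Kind.out, w) = 2}.ncard ≤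
      {w | A.graph.Arc v w ∧ p (Kind.out, w) = 1}.ncard + 1 ∧
    B = A.replace v outSplit p

/-- The Splitting Procedure at the vertex `v`: replace `v` by a split; while a vertex of the
subgraph has in-degree greater than `d`, replace it by an in-split; then, while a vertex of the
subgraph has out-degree greater than `d`, replace it by an out-split. -/
def SplittingProcedure (d : ℕ) (M : MixedGraph) (v : M.V) (M' : MixedGraph) : Prop :=
  ∃ A B C : Marked, InitialSplit M v A ∧
    RunLoop (InSplitStep d) A B ∧ RunLoop (OutSplitStep d) B C ∧ M' = C.graph

/-- Perform the Splitting Procedure on a vertex with in-degree or out-degree greater than `d`. -/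
def SplitStep (d : ℕ) (M M' : MixedGraph) : Prop :=
  ∃ v, (d < M.inDegree v ∨ d < M.outDegree v) ∧ SplittingProcedure d M v M'

/-! ## Gates -/

/-- One orientation of each edge of the `s`-gate (`s ≥ 4`). The vertices `.inl 0, …, .inl 9` carry
the labels `1, …, 10`; the vertices `.inr j` form the bottom row, a path of `2s - 7` vertices
which is joined to the vertices `5` and `10` at its two ends; every second vertex of the bottom row,
starting from its second one, is adjacent to the top vertex `1`. -/
def gateRel (s : ℕ) : Fin 10 ⊕ Fin (2 * s - 7) → Fin 10 ⊕ Fin (2 * s - 7) → Prop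
  | .inl a, .inl b => (a.val + 1, b.val + 1) ∈
      ([(1, 3), (1, 8), (2, 3), (2, 5), (3, 4), (4, 5), (4, 6), (6, 7), (7, 8), (7, 10), (8, 9),
        (9, 10)] : List (ℕ × ℕ))
  | .inl a, .inr j => (a.val + 1 = 5 ∧ j.val = 0) ∨ (a.val + 1 = 10 ∧ j.val + 1 = 2 * s - 7) ∨
      (a.val + 1 = 1 ∧ Odd j.val)
  | .inr j, .inr j' => j.val + 1 = j'.val
  | .inr _, .inl _ => False

/-- The `s`-gate, an undirected graph. -/
def gate (s : ℕ) : MixedGraph := ofSimpleGraph (SimpleGraph.fromRel (gateRel s))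

/-- The `s` vertices of the `s`-gate at which it has an external edge: the top vertex `1`, the left
vertex `2`, the right vertex `9`, and every second vertex of the bottom row, starting from its
first one. -/
def gateExternal (s : ℕ) : Set (gate s).V :=
  {x : Fin 10 ⊕ Fin (2 * s - 7) | match x with
    | .inl a => a.val + 1 = 1 ∨ a.val + 1 = 2 ∨ a.val + 1 = 9
    | .inr j => Even j.val}

/-- Replace a vertex with `s ≥ 4` incident edges by an `s`-gate, whose external edges are, in some
order, the edges that were incident with the vertex. If these are `s'` incoming and `r'` outgoing
edges, the subgraph is an `(s', r')`-gate. -/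
def GateStep (M M' : MixedGraph) : Prop :=
  ∃ (v : M.V) (p : Kind × M.V → (gate (M.degree v)).V),
    4 ≤ M.degree v ∧ Set.BijOn p (M.incident v) (gateExternal (M.degree v)) ∧
    M' = M.replace v (gate (M.degree v)) p

/-- Replace a vertex of degree `4` by a `4`-gate. -/
def FourGateStep (M M' : MixedGraph) : Prop :=
  ∃ (v : M.V) (p : Kind × M.V → (gate 4).V),
    M.degree v = 4 ∧ Set.BijOn p (M.incident v) (gateExternal 4) ∧
    M' = M.replace v (gate 4) p

/-! ## From directed to undirected graphs -/

/-- Karp's conversion. Each vertex `i` becomes a path `(i,0) - (i,1) - (i,2)`, and each directed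
edge from `i` to `j` becomes the undirected edge between `(i,2)` and `(j,0)`. An undirected edge of
the given graph counts as two directed edges. -/
def karp (M : MixedGraph) : MixedGraph :=
  ofSimpleGraph (V := M.V × Fin 3) <| SimpleGraph.fromRel fun x y =>
    (x.1 = y.1 ∧ x.2 = 1 ∧ (y.2 = 0 ∨ y.2 = 2)) ∨
    ((M.Arc x.1 y.1 ∨ M.edge.Adj x.1 y.1) ∧ x.2 = 2 ∧ y.2 = 0)

/-! ## From sub-cubic to cubic graphs -/

/-- The diamond: the complete graph on four vertices without the edge between `0` and `3`. -/
def diamond : MixedGraph :=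
  ofSimpleGraph (SimpleGraph.fromEdgeSet
    {s(0, 1), s(0, 2), s(1, 2), s(1, 3), s((2 : Fin 4), 3)})

/-- Replace a vertex of degree `2` by a diamond, whose external edges are attached to its two
vertices of degree `2`. -/
def DiamondStep (M M' : MixedGraph) : Prop :=
  ∃ (v : M.V) (p : Kind × M.V → Fin 4),
    M.degree v = 2 ∧ Set.BijOn p (M.incident v) {0, 3} ∧ M' = M.replace v diamond p

/-- The Petersen graph: an outer 5-cycle, five spokes, and an inner pentagram. -/
def petersen : MixedGraph :=
  ofSimpleGraph (V := Fin 5 × Bool) <| SimpleGraph.fromRel fun x y =>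
    (x.2 = false ∧ y.2 = false ∧ y.1 = x.1 + 1) ∨
    (x.2 = false ∧ y.2 = true ∧ y.1 = x.1) ∨
    (x.2 = true ∧ y.2 = true ∧ y.1 = x.1 + 2)

/-- A graph with a vertex of degree at most `1` is replaced by the Petersen graph; otherwise all
vertices of degree `2` are replaced by diamonds. -/
def SubcubicToCubic (M H : MixedGraph) : Prop :=
  ((∃ v, M.degree v ≤ 1) ∧ H = petersen) ∨
  ((¬ ∃ v, M.degree v ≤ 1) ∧ RunLoop DiamondStep M H)

/-! ## The conversion -/

/-- `Conversion d M H`: the graph `H` is a possible outcome of the procedure that converts `M` to a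
cubic instance, with the bound `d` for the Splitting Procedure: first the Splitting Procedure is
performed on vertices with in-degree or out-degree greater than `d`, as long as there are any; then
vertices with at least `4` incident edges are replaced by gates, as long as there are any; then the
graph is made undirected; then vertices of degree `4` are replaced by `4`-gates, as long as there
are any; finally the sub-cubic graph is made cubic. -/
def Conversion (d : ℕ) (M H : MixedGraph) : Prop :=
  ∃ A B D : MixedGraph, RunLoop (SplitStep d) M A ∧ RunLoop GateStep A B ∧
    RunLoop FourGateStep (karp B) D ∧ SubcubicToCubic D H

/-- The graph is undirected and cubic. -/
def IsUndirectedCubic (H : MixedGraph) : Prop :=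
  (∀ x y, ¬ H.Arc x y) ∧ ∀ v, (H.edge.neighborSet v).ncard = 3

/-- The undirected graph formed by the undirected edges is Hamiltonian. -/
def HasHamiltonianCycle (H : MixedGraph) : Prop :=
  @SimpleGraph.IsHamiltonian H.V (Classical.decEq H.V) (Fintype.ofFinite H.V) H.edge

end HCP

/-! ## Tours -/

/-! Hamiltonicity is treated uniformly as the existence of a tour, a nonempty cyclic list of all
vertices, for the relation `adj` of being able to pass from one vertex to the next. For directed
inputs this is the given notion. For cubic outputs it agrees with Mathlib's, because a cubic graph
does not have one or two vertices.

Apart from Karp's conversion and the Petersen graph, every step replaces a vertex `v` by a subgraph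
`H`. A tour survives if `H` has a Hamiltonian path between any two external edges that a tour can
use to enter and leave: splice that path in for `v` (`Ham.replace`). Conversely, a tour of the new
graph contracts to a tour of the old one as soon as it passes through `H` in a single stretch
(`Ham.of_replace`). There are two reasons for a single stretch. For splits and gates, `H` carries
integer weights with total 1 such that every passage collects weight at least 1
(`Ham.of_replace_of_weight`). For a split the weight sits on a vertex that every passage must use.
The gate is bipartite, all its external vertices lie in the colour class that is larger by one, and
the weights are plus and minus one according to the colour. A diamond has triangles and admits no
such weights, but it has only two external edges, so a tour cannot enter it twice
(`Ham.of_replace_of_two`).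

In Karp's graph the middle vertex of each path has degree two, so a tour runs through each path
without interruption; the direction in which it traverses one path forces the same direction on the
next, and reversing the tour if necessary makes all of them forward (`karp_ham_iff`). A vertex of
degree at most 1 rules out a tour on three or more vertices, and an exhaustive search shows that the
Petersen graph has none.

Termination and size come from sums over the vertices of functions of their degrees, which change
only by the terms of `v` and of `H` (`total_replace`). Splitting never increases `splitSize +
numBad`, which is initially at most `4 * (N + e)`. Afterwards all degrees are at most `2 * d`, so
each vertex gives rise to a number of gate vertices bounded in terms of `d`, and the remaining
stages multiply the size by constants. The number `k` bounds `N + e` up to a factor 2 unless there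
are isolated vertices; an isolated vertex survives until Karp's conversion, leaves a vertex of
degree at most 1, and so the outcome is the Petersen graph. -/

/-- A cyclic arrangement of all elements in which consecutive elements are related. -/
def IsTour {V : Type*} (R : V → V → Prop) (l : List V) : Prop :=
  l.Nodup ∧ (∀ v, v ∈ l) ∧ Cycle.Chain R (l : Cycle V)

/-- The empty list would be a tour of the empty graph, so it is excluded. A one-element tour needs
`R a a`, but two adjacent vertices of an undirected graph do form a tour; this is why assumptions of
at least three vertices recur below. -/
def HasTour {V : Type*} (R : V → V → Prop) : Prop :=
  ∃ l, l ≠ [] ∧ IsTour R l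

section Tours

variable {V : Type*} {R : V → V → Prop}

theorem IsTour.rotate {x y : List V} (h : IsTour R (x ++ y)) : IsTour R (y ++ x) := by
  obtain ⟨h1, h2, h3⟩ := h
  refine ⟨(List.perm_append_comm.nodup_iff).1 h1, fun v => by simpa [or_comm] using h2 v, ?_⟩
  have : ((y ++ x : List V) : Cycle V) = ((x ++ y : List V) : Cycle V) :=
    Cycle.coe_eq_coe.2 List.isRotated_append
  rwa [this]

theorem IsTour.isChain {l : List V} (h : IsTour R l) : List.IsChain R l := by
  obtain ⟨-, -, h⟩ := h
  rcases l with _ | ⟨a, l⟩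
  · exact List.isChain_nil
  · rw [Cycle.chain_coe_cons, ← List.cons_append] at h
    exact h.left_of_append

theorem cycleChain_iff {a b : V} {l : List V} :
    Cycle.Chain R ((a :: (l ++ [b]) : List V) : Cycle V) ↔
      List.IsChain R (a :: (l ++ [b])) ∧ R b a := by
  rw [Cycle.chain_coe_cons, List.append_assoc, List.singleton_append, List.isChain_cons_split]
  simp

/-- A tour can be started at any element. -/
theorem HasTour.exists_cons (h : HasTour R) (v : V) : ∃ t, IsTour R (v :: t) := by
  obtain ⟨l, -, hl⟩ := h
  obtain ⟨x, y, rfl⟩ := List.append_of_mem (hl.2.1 v)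
  exact ⟨y ++ x, hl.rotate⟩

theorem IsTour.hasTour_cons {v : V} {t : List V} (h : IsTour R (v :: t)) : HasTour R :=
  ⟨_, by simp, h⟩

theorem IsTour.mono {S : V → V → Prop} {l : List V} (h : IsTour R l) (hRS : ∀ a b, R a b → S a b) :
    IsTour S l :=
  ⟨h.1, h.2.1, h.2.2.imp hRS⟩

theorem HasTour.nonempty (h : HasTour R) : Nonempty V := by
  obtain ⟨l, h, -⟩ := h
  exact ⟨l.head h⟩

theorem IsTour.length_eq {l : List V} (h : IsTour R l) : l.length = Nat.card V := by
  classical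
  have : Fintype V := ⟨l.toFinset, by simp [h.2.1]⟩
  rw [Nat.card_eq_fintype_card, ← List.toFinset_card_of_nodup h.1, ← Finset.card_univ]
  congr 1
  ext v
  simp [h.2.1]

theorem IsTour.reverse {l : List V} (h : IsTour R l) : IsTour (fun a b => R b a) l.reverse := by
  refine ⟨List.nodup_reverse.2 h.1, by simpa using h.2.1, ?_⟩
  have h3 := h.2.2
  rcases l with _ | ⟨a, l⟩
  · simp
  rcases List.eq_nil_or_concat l with rfl | ⟨l, b, rfl⟩
  · simpa using h3
  · rw [List.concat_eq_append, cycleChain_iff] at h3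
    have : (a :: l.concat b).reverse = b :: (l.reverse ++ [a]) := by simp
    rw [this, cycleChain_iff]
    refine ⟨?_, h3.2⟩
    rw [← this, List.concat_eq_append, List.isChain_reverse]
    exact h3.1

theorem cycleChain_iff_of_head?_of_getLast? {l : List V} {a b : V} (ha : l.head? = some a)
    (hb : l.getLast? = some b) : Cycle.Chain R (l : Cycle V) ↔ l.IsChain R ∧ R b a := by
  have hne : l ≠ [] := by
    rintro rfl
    simp at ha
  have hl : l.getLast hne = b := by
    rwa [List.getLast?_eq_some_getLast hne, Option.some_inj] at hb
  rw [Cycle.chain_ne_nil _ hne, hl, List.isChain_cons, ha]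
  simp only [Option.mem_def, Option.some_inj, forall_eq']
  tauto

/-- With the cardinality written as a successor, `ZMod (n + 1)` is definitionally `Fin (n + 1)`, so
its elements can index the list directly. -/
theorem hasTour_iff_equiv {n : ℕ} (hn : Nat.card V = n + 1) :
    HasTour R ↔ ∃ f : ZMod (n + 1) ≃ V, ∀ i, R (f i) (f (i + 1)) := by
  have hcast : ((n : ℕ) : ZMod (n + 1)) + 1 = 0 := by
    have := ZMod.natCast_self (n + 1)
    push_cast at this
    exact this
  constructor
  · rintro ⟨l, hl0, hl⟩
    have hlen : l.length = n + 1 := hl.length_eq.trans hn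
    let g : ZMod (n + 1) → V := fun i => l.get (Fin.cast hlen.symm (i : Fin (n + 1)))
    have hg : Function.Bijective g := by
      constructor
      · intro i j hij
        have := (List.nodup_iff_injective_get.1 hl.1) hij
        exact Fin.cast_injective _ this
      · intro v
        obtain ⟨k, hk⟩ := List.get_of_mem (hl.2.1 v)
        exact ⟨Fin.cast hlen k, hk⟩
    refine ⟨Equiv.ofBijective g hg, ?_⟩
    have hmap : l = (List.range (n + 1)).map (fun i : ℕ => g (i : ZMod (n + 1))) := by
      apply List.ext_getElem
      · simp [hlen]
      · intro i h1 h2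
        have hi : i < n + 1 := hlen ▸ h1
        simp only [List.getElem_map, List.getElem_range, g, List.get_eq_getElem]
        congr 1
        exact (ZMod.val_natCast_of_lt (n := n + 1) hi).symm
    have hc := hl.2.2
    rw [hmap, ← Cycle.map_coe, Cycle.chain_map, Cycle.chain_range_succ] at hc
    intro i
    have hi : ((i.val : ℕ) : ZMod (n + 1)) = i := ZMod.natCast_zmod_val i
    have hlt : i.val < n + 1 := ZMod.val_lt i
    simp only [Equiv.ofBijective_apply]
    rcases Nat.lt_or_ge i.val n with h | h
    · have := hc.2 _ h
      rw [Nat.succ_eq_add_one, Nat.cast_add, Nat.cast_one, hi] at this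
      exact this
    · have h' : i.val = n := by omega
      have hin : i = ((n : ℕ) : ZMod (n + 1)) := by rw [← hi, h']
      have := hc.1
      rw [hin, hcast]
      simpa using this
  · rintro ⟨f, hf⟩
    refine ⟨(List.range (n + 1)).map (fun i : ℕ => f (i : ZMod (n + 1))), by simp, ?_, ?_, ?_⟩
    · refine List.Nodup.map_on ?_ List.nodup_range
      intro i hi j hj hij
      have := f.injective hij
      have := congrArg ZMod.val this
      rwa [ZMod.val_natCast_of_lt (List.mem_range.1 hi),
        ZMod.val_natCast_of_lt (List.mem_range.1 hj)] at this
    · intro v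
      refine List.mem_map.2 ⟨(f.symm v).val, List.mem_range.2 (ZMod.val_lt _), ?_⟩
      rw [ZMod.natCast_zmod_val, Equiv.apply_symm_apply]
    · rw [← Cycle.map_coe, Cycle.chain_map, Cycle.chain_range_succ]
      constructor
      · have := hf (n : ZMod (n + 1))
        rw [hcast] at this
        simpa using this
      · intro m _
        have := hf (m : ZMod (n + 1))
        simpa using this

/-- A tour is a tour for the graph of a permutation, the successor map. -/
theorem HasTour.exists_perm [Finite V] (h : HasTour R) :
    ∃ σ : Equiv.Perm V, (∀ x, R x (σ x)) ∧ HasTour fun x y => σ x = y := by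
  have := h.nonempty
  obtain ⟨n, hn⟩ := Nat.exists_eq_succ_of_ne_zero (Nat.card_pos (α := V)).ne'
  obtain ⟨f, hf⟩ := (hasTour_iff_equiv hn).1 h
  refine ⟨f.symm.trans ((Equiv.addRight 1).trans f), fun x => ?_,
    (hasTour_iff_equiv hn).2 ⟨f, fun i => by simp⟩⟩
  simpa using hf (f.symm x)

/-- In a tour through at least three elements, the successor of an element is not its
predecessor. -/
theorem perm_apply_apply_ne [Finite V] {σ : Equiv.Perm V} (h : HasTour fun x y => σ x = y)
    (h3 : 3 ≤ Nat.card V) (x : V) : σ (σ x) ≠ x := by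
  obtain ⟨t, ht⟩ := h.exists_cons x
  have hlen := ht.length_eq
  rcases t with _ | ⟨b, _ | ⟨c, t⟩⟩
  · simp at hlen; omega
  · simp at hlen; omega
  · have := ht.isChain
    simp only [List.isChain_cons_cons] at this
    have hn := ht.1
    rw [this.1, this.2.1]
    rintro rfl
    simp at hn

end Tours

/-! ### Tours compared with the two notions of Hamiltonian cycle in the statement -/

theorem hasDirectedHamiltonianCycle_iff {V : Type} [Finite V] (G : Digraph V) :
    HasDirectedHamiltonianCycle G ↔ HasTour G.Adj := by
  rcases isEmpty_or_nonempty V with hV | hV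
  -- On no vertices both sides fail: `ZMod 0` is `ℤ`, which is nonempty and so cannot be equivalent
  -- to `V`.
  · constructor
    · rintro ⟨f, -⟩
      have : Infinite (ZMod (Nat.card V)) := by
        rw [Nat.card_of_isEmpty]
        exact inferInstanceAs (Infinite ℤ)
      exact (hV.false (f 0)).elim
    · intro h
      exact (hV.false h.nonempty.some).elim
  · obtain ⟨n, hn⟩ := Nat.exists_eq_succ_of_ne_zero (Nat.card_pos (α := V)).ne'
    rw [hasTour_iff_equiv hn, HasDirectedHamiltonianCycle, hn]

/-- The two excluded cardinalities are exactly where the notions can differ: Mathlib counts the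
one-vertex graph as Hamiltonian, while a single edge is a tour but not a cycle. -/
theorem isHamiltonian_iff_hasTour {V : Type} [DecidableEq V] [Fintype V] (G : SimpleGraph V)
    (h1 : Fintype.card V ≠ 1) (h2 : Fintype.card V ≠ 2) :
    G.IsHamiltonian ↔ HasTour G.Adj := by
  constructor
  · intro h
    obtain ⟨a, p, hp⟩ := h h1
    rw [SimpleGraph.Walk.isHamiltonianCycle_iff_isCycle_and_support_count_tail_eq_one] at hp
    cases p with
    | nil => exact absurd rfl hp.1.ne_nil
    | cons hadj q =>
      have hsupp : (SimpleGraph.Walk.cons hadj q).support.tail = q.support := rfl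
      rw [hsupp] at hp
      refine ⟨q.support, by simp, ?_, ?_, ?_⟩
      · have := hp.1.support_nodup
        rwa [hsupp] at this
      · intro v
        exact List.count_pos_iff.1 (by rw [hp.2]; omega)
      · rw [Cycle.chain_ne_nil _ (by simp), SimpleGraph.Walk.getLast_support]
        exact (SimpleGraph.Walk.cons hadj q).isChain_adj_support
  · rintro ⟨l, hl0, hl⟩ -
    rcases l with _ | ⟨a, l⟩
    · simp at hl0
    rcases List.eq_nil_or_concat l with rfl | ⟨l, b, rfl⟩
    · have := hl.length_eq
      simp at this
      omega
    rw [List.concat_eq_append] at hl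
    have hc := (cycleChain_iff.1 hl.2.2)
    have hlen := hl.length_eq
    rw [Nat.card_eq_fintype_card] at hlen
    simp only [List.length_cons, List.length_append, List.length_nil] at hlen
    have key : ∀ {x y : V} (q : G.Walk x y), x = a → y = b → ∃ r : G.Walk a b,
        r.support = q.support := by
      rintro x y q rfl rfl
      exact ⟨q, rfl⟩
    obtain ⟨q, hq⟩ := key (SimpleGraph.Walk.ofSupport (G := G) (a :: (l ++ [b])) (by simp) hc.1)
      (by simp) (by simp)
    rw [SimpleGraph.Walk.support_ofSupport] at hq
    refine ⟨b, .cons hc.2 q, ?_⟩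
    rw [SimpleGraph.Walk.isHamiltonianCycle_iff_isCycle_and_support_count_tail_eq_one,
      SimpleGraph.Walk.cons_isCycle_iff]
    refine ⟨⟨?_, ?_⟩, ?_⟩
    · rw [SimpleGraph.Walk.isPath_def, hq]
      exact hl.1
    -- If the closing edge already belonged to the path, the path would be that edge alone, and the
    -- graph would have only two vertices.
    · intro he
      have hqp : q.IsPath := by
        rw [SimpleGraph.Walk.isPath_def, hq]
        exact hl.1
      have hql : q.length + 1 = (a :: (l ++ [b])).length := by
        rw [← hq, SimpleGraph.Walk.length_support]
      have : q.length = 1 := hqp.length_eq_one_of_mem_edges (Sym2.eq_swap ▸ he)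
      simp only [List.length_cons, List.length_append, List.length_nil] at hql
      omega
    · intro v
      have : (SimpleGraph.Walk.cons hc.2 q).support.tail = q.support := rfl
      rw [this, hq]
      exact List.count_eq_one_of_mem hl.1 (hl.2.1 v)

/-! ## Tours and the replacement of a vertex -/

/-- A path through all elements, from `a` to `b`. -/
def HasTraversal {V : Type*} (R : V → V → Prop) (a b : V) : Prop :=
  ∃ l : List V, l.Nodup ∧ (∀ v, v ∈ l) ∧ l.IsChain R ∧ l.head? = some a ∧ l.getLast? = some b

theorem HasTraversal.symm {V : Type*} {R : V → V → Prop} (hR : ∀ a b, R a b → R b a) {a b : V}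
    (h : HasTraversal R a b) : HasTraversal R b a := by
  obtain ⟨l, h1, h2, h3, h4, h5⟩ := h
  refine ⟨l.reverse, List.nodup_reverse.2 h1, by simpa using h2, ?_, by simpa using h5,
    by simpa using h4⟩
  rw [List.isChain_reverse]
  exact h3.imp fun a b h => hR _ _ h

theorem head?_map_of_eq {α β : Type*} {f : α → β} {l : List α} {a : α} (h : l.head? = some a) :
    (l.map f).head? = some (f a) := by
  rw [List.head?_map, h, Option.map_some]

theorem getLast?_map_of_eq {α β : Type*} {f : α → β} {l : List α} {a : α}
    (h : l.getLast? = some a) : (l.map f).getLast? = some (f a) := by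
  rw [List.getLast?_map, h, Option.map_some]

theorem cycleChain_append_iff {V : Type*} {R : V → V → Prop} {l₁ l₂ : List V} {a b c e : V}
    (h1 : l₁.head? = some a) (h2 : l₁.getLast? = some b) (h3 : l₂.head? = some c)
    (h4 : l₂.getLast? = some e) :
    Cycle.Chain R ((l₁ ++ l₂ : List V) : Cycle V) ↔
      l₁.IsChain R ∧ l₂.IsChain R ∧ R b c ∧ R e a := by
  have hne : l₁ ++ l₂ ≠ [] := by
    rintro h
    simp only [List.append_eq_nil_iff] at h
    simp [h.1] at h1
  have hl : (l₁ ++ l₂).getLast hne = e := by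
    have : (l₁ ++ l₂).getLast? = some e := by simp [h4]
    rwa [List.getLast?_eq_some_getLast hne, Option.some_inj] at this
  have hh : (l₁ ++ l₂).head? = some a := by simp [h1]
  rw [Cycle.chain_ne_nil _ hne, hl, List.isChain_cons, hh, List.isChain_append, h2, h3]
  simp only [Option.mem_def, Option.some_inj, forall_eq']
  tauto

/-- A list that does not return to `p` once it has left it. -/
theorem exists_append_of_isChain {α : Type*} {p : α → Prop} {l : List α}
    (h : l.IsChain fun x y => ¬ (¬ p x ∧ p y)) :
    ∃ l₁ l₂, l = l₁ ++ l₂ ∧ (∀ x ∈ l₁, p x) ∧ ∀ x ∈ l₂, ¬ p x := by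
  induction l with
  | nil => exact ⟨[], [], by simp⟩
  | cons a l ih =>
    obtain ⟨l₁, l₂, rfl, h1, h2⟩ := ih (List.isChain_of_isChain_cons h)
    by_cases ha : p a
    · exact ⟨a :: l₁, l₂, rfl, by simpa [ha] using h1, h2⟩
    · refine ⟨[], a :: (l₁ ++ l₂), rfl, by simp, ?_⟩
      rcases l₁ with _ | ⟨b, l₁⟩
      · simpa [ha] using h2
      · rw [List.cons_append, List.isChain_cons_cons] at h
        exact absurd ⟨ha, h1 b (by simp)⟩ h.1

namespace MixedGraph

/-- There is an edge along which one can pass from `x` to `y`. -/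
def adj (M : MixedGraph) (x y : M.V) : Prop := M.Arc x y ∨ M.edge.Adj x y

/-- The graph has a Hamiltonian cycle. -/
def Ham (M : MixedGraph) : Prop := HasTour M.adj

theorem adj_irrefl (M : MixedGraph) (x : M.V) : ¬ M.adj x x := by
  rintro (h | h)
  · exact M.arc_irrefl x h
  · exact M.edge.irrefl h

section Replace

variable {M : MixedGraph} {v : M.V} {H : MixedGraph} {p : Kind × M.V → H.V}

/-- The vertex of `M.replace v H p` which is given by a vertex other than `v`. -/
def rinl (w : {w : M.V // w ≠ v}) : (M.replace v H p).V := Sum.inl w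

/-- The vertex of `M.replace v H p` which is given by a vertex of `H`. -/
def rinr (h : H.V) : (M.replace v H p).V := Sum.inr h

theorem rinl_injective : Function.Injective (rinl (M := M) (v := v) (H := H) (p := p)) :=
  Sum.inl_injective

theorem rinr_injective : Function.Injective (rinr (M := M) (v := v) (H := H) (p := p)) :=
  Sum.inr_injective

theorem replace_cases (x : (M.replace v H p).V) : (∃ w, x = rinl w) ∨ ∃ h, x = rinr h := by
  rcases x with w | h
  · exact Or.inl ⟨w, rfl⟩
  · exact Or.inr ⟨h, rfl⟩

theorem rinl_ne_rinr (w : {w : M.V // w ≠ v}) (h : H.V) :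
    (rinl w : (M.replace v H p).V) ≠ rinr h := Sum.inl_ne_inr

theorem adj_rinr_rinr {a b : H.V} :
    (M.replace v H p).adj (rinr a) (rinr b) ↔ H.adj a b := Iff.rfl

/-- One can enter `H` along an edge along which one could enter `v`. -/
theorem adj_rinl_rinr {a : {w : M.V // w ≠ v}} {h : H.V} :
    (M.replace v H p).adj (rinl a) (rinr h) ↔
      ∃ x ∈ M.incident v, x.1 ≠ Kind.out ∧ x.2 = a ∧ p x = h := by
  constructor
  · rintro (⟨h1, h2⟩ | ⟨h1, h2⟩)
    · exact ⟨(Kind.inc, a), h1, by simp, rfl, h2⟩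
    · exact ⟨(Kind.und, a), h1, by simp, rfl, h2⟩
  · rintro ⟨⟨k, u⟩, h1, h2, rfl, h4⟩
    cases k
    · exact Or.inl ⟨h1, h4⟩
    · exact absurd rfl h2
    · exact Or.inr ⟨h1, h4⟩

theorem adj_rinr_rinl {a : {w : M.V // w ≠ v}} {h : H.V} :
    (M.replace v H p).adj (rinr h) (rinl a) ↔
      ∃ x ∈ M.incident v, x.1 ≠ Kind.inc ∧ x.2 = a ∧ p x = h := by
  constructor
  · rintro (⟨h1, h2⟩ | ⟨h1, h2⟩)
    · exact ⟨(Kind.out, a), h1, by simp, rfl, h2⟩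
    · exact ⟨(Kind.und, a), h1, by simp, rfl, h2⟩
  · rintro ⟨⟨k, u⟩, h1, h2, rfl, h4⟩
    cases k
    · exact absurd rfl h2
    · exact Or.inl ⟨h1, h4⟩
    · exact Or.inr ⟨h1, h4⟩

theorem adj_iff_incident_left {u w : M.V} :
    M.adj u w ↔ ∃ x ∈ M.incident w, x.1 ≠ Kind.out ∧ x.2 = u := by
  constructor
  · rintro (h | h)
    · exact ⟨(Kind.inc, u), h, by simp, rfl⟩
    · exact ⟨(Kind.und, u), h.symm, by simp, rfl⟩
  · rintro ⟨⟨k, u⟩, h1, h2, rfl⟩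
    cases k
    · exact Or.inl h1
    · exact absurd rfl h2
    · exact Or.inr (M.edge.adj_symm h1)

theorem adj_iff_incident_right {u w : M.V} :
    M.adj w u ↔ ∃ x ∈ M.incident w, x.1 ≠ Kind.inc ∧ x.2 = u := by
  constructor
  · rintro (h | h)
    · exact ⟨(Kind.out, u), h, by simp, rfl⟩
    · exact ⟨(Kind.und, u), h, by simp, rfl⟩
  · rintro ⟨⟨k, u⟩, h1, h2, rfl⟩
    cases k
    · exact absurd rfl h2
    · exact Or.inl h1
    · exact Or.inr h1

/-- If any two external edges are joined by a traversal of `H`, then replacing a vertex by `H` does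
not destroy Hamiltonicity. -/
theorem Ham.replace
    (hpath : ∀ x ∈ M.incident v, ∀ y ∈ M.incident v, x ≠ y → x.1 ≠ Kind.out → y.1 ≠ Kind.inc →
      HasTraversal H.adj (p x) (p y))
    (h3 : (∀ w, ¬ M.edge.Adj v w) ∨ 3 ≤ Nat.card M.V) (h : M.Ham) :
    (M.replace v H p).Ham := by
  obtain ⟨t, ht⟩ := HasTour.exists_cons h v
  have hcard := ht.length_eq
  rcases t with _ | ⟨w, t⟩
  · exact absurd ((Cycle.chain_singleton _ _).1 ht.2.2) (M.adj_irrefl v)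
  obtain ⟨u, hu⟩ : ∃ u, (w :: t).getLast? = some u := by
    rw [List.getLast?_eq_some_getLast (by simp)]
    exact ⟨_, rfl⟩
  have hv : ∀ x ∈ w :: t, x ≠ v := by
    rintro x hx rfl
    exact (List.nodup_cons.1 ht.1).1 hx
  obtain ⟨-, hch, hvw, huv⟩ := (cycleChain_append_iff (R := M.adj) (l₁ := [v]) (l₂ := w :: t)
    rfl rfl rfl hu).1 ht.2.2
  obtain ⟨x, hx1, hx2, hx3⟩ := adj_iff_incident_left.1 huv
  obtain ⟨y, hy1, hy2, hy3⟩ := adj_iff_incident_right.1 hvw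
  -- The entering and the leaving edge could coincide only if it were undirected, with the same
  -- vertex before and after `v`; the tour would then have length two, which `h3` excludes.
  have hxy : x ≠ y := by
    rintro rfl
    have huw : u = w := hx3.symm.trans hy3
    obtain ⟨k, x⟩ := x
    cases k
    · exact hy2 rfl
    · exact hx2 rfl
    · rcases h3 with h3 | h3
      · exact h3 _ hx1
      · rcases t with _ | ⟨z, t⟩
        · simp at hcard
          omega
        · rw [List.getLast?_cons_cons] at hu
          have := (List.nodup_cons.1 (List.nodup_cons.1 ht.1).2).1
          exact this (huw ▸ List.mem_of_getLast? hu)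
  obtain ⟨q, hq1, hq2, hq3, hq4, hq5⟩ := hpath x hx1 y hy1 hxy hx2 hy2
  obtain ⟨t', ht'⟩ : ∃ t' : List {w // w ≠ v}, w :: t = t'.map Subtype.val := by
    refine ⟨(w :: t).pmap Subtype.mk hv, ?_⟩
    rw [List.map_pmap]
    simp
  rw [ht'] at hu hch
  have hw' : (t'.map Subtype.val).head? = some w := by rw [← ht']; rfl
  obtain ⟨w', hw1, rfl⟩ : ∃ w', t'.head? = some w' ∧ w'.1 = w := by
    rwa [List.head?_map, Option.map_eq_some_iff] at hw'
  obtain ⟨u', hu1, rfl⟩ : ∃ u', t'.getLast? = some u' ∧ u'.1 = u := by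
    rwa [List.getLast?_map, Option.map_eq_some_iff] at hu
  refine ⟨q.map rinr ++ t'.map rinl, ?_, ?_, ?_, ?_⟩
  · intro h
    rw [List.append_eq_nil_iff, List.map_eq_nil_iff] at h
    simp [h.1] at hq4
  · rw [List.nodup_append]
    refine ⟨hq1.map rinr_injective, ?_, ?_⟩
    · refine List.Nodup.map rinl_injective ?_
      refine List.Nodup.of_map Subtype.val ?_
      rw [← ht']
      exact (List.nodup_cons.1 ht.1).2
    · intro a ha b hb
      obtain ⟨h, -, rfl⟩ := List.mem_map.1 ha
      obtain ⟨z, -, rfl⟩ := List.mem_map.1 hb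
      exact (rinl_ne_rinr _ _).symm
  · intro z
    rcases replace_cases z with ⟨z, rfl⟩ | ⟨z, rfl⟩
    · refine List.mem_append_right _ (List.mem_map_of_mem ?_)
      have hz := ht.2.1 z.1
      rw [List.mem_cons, ht'] at hz
      obtain ⟨z', hz', h⟩ := List.mem_map.1 (hz.resolve_left z.2)
      rwa [← Subtype.ext h]
    · exact List.mem_append_left _ (List.mem_map_of_mem (hq2 z))
  · refine (cycleChain_append_iff (head?_map_of_eq hq4) (getLast?_map_of_eq hq5)
      (head?_map_of_eq hw1) (getLast?_map_of_eq hu1)).2 ⟨?_, ?_, ?_, ?_⟩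
    · rw [List.isChain_map]
      exact hq3
    · rw [List.isChain_map] at hch ⊢
      exact hch
    · exact adj_rinr_rinl.2 ⟨y, hy1, hy2, hy3, rfl⟩
    · exact adj_rinl_rinr.2 ⟨x, hx1, hx2, hx3, rfl⟩

/-- If a Hamiltonian cycle visits `H` only once, then one gets a Hamiltonian cycle by contracting
`H` to a vertex. -/
theorem Ham.of_replace [Nonempty H.V] (hM : ∃ u, u ≠ v)
    (hentry : ∀ (h : H.V) (t : List (M.replace v H p).V) (u : {u : M.V // u ≠ v}),
      IsTour (M.replace v H p).adj (rinr h :: t) → (rinr h :: t).getLast? = some (rinl u) →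
      (M.replace v H p).adj (rinl u) (rinr h) →
      (rinr h :: t).IsChain fun x y => ¬ ((∃ a, x = rinl a) ∧ ∃ b, y = rinr b))
    (h : (M.replace v H p).Ham) : M.Ham := by
  obtain ⟨u, hu⟩ := hM
  obtain ⟨h0⟩ := ‹Nonempty H.V›
  obtain ⟨t, ht⟩ := HasTour.exists_cons h (rinl ⟨u, hu⟩)
  -- Cut the tour at its first vertex in `H`. What precedes lies outside, so rotating gives a tour
  -- that begins with an entry into `H` from outside, as `hentry` requires.
  obtain ⟨x, y, z, hxyz, hx⟩ : ∃ x h z, rinl ⟨u, hu⟩ :: t = x ++ rinr h :: z ∧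
      ∀ a ∈ x, ∃ b : {b : M.V // b ≠ v}, a = rinl b := by
    clear h
    have hmem := ht.2.1 (rinr h0)
    generalize rinl ⟨u, hu⟩ :: t = l at hmem
    clear ht
    induction l with
    | nil => simp at hmem
    | cons a l ih =>
      rcases replace_cases a with ⟨b, rfl⟩ | ⟨b, rfl⟩
      · obtain ⟨x, y, z, rfl, hx⟩ := ih ((List.mem_cons.1 hmem).resolve_left
          (rinl_ne_rinr _ _).symm)
        exact ⟨rinl b :: x, y, z, rfl, List.forall_mem_cons.2 ⟨⟨b, rfl⟩, hx⟩⟩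
      · exact ⟨[], b, l, rfl, by simp⟩
  rw [hxyz] at ht
  have hxne : x ≠ [] := by
    rintro rfl
    exact rinl_ne_rinr _ _ (List.cons.inj hxyz).1
  have hrot := ht.rotate
  rw [List.cons_append] at hrot
  obtain ⟨u', hu'⟩ := hx _ (List.getLast_mem hxne)
  have hlast : (rinr y :: (z ++ x)).getLast? = some (rinl u') := by
    rw [← List.cons_append, List.getLast?_append, List.getLast?_eq_some_getLast hxne, hu']
    rfl
  have hin : (M.replace v H p).adj (rinl u') (rinr y) := by
    have := (Cycle.chain_ne_nil _ (by simp)).1 hrot.2.2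
    rw [List.getLast?_eq_some_getLast (by simp), Option.some_inj] at hlast
    rw [hlast, List.isChain_cons_cons] at this
    exact this.1
  have hc := hentry _ _ _ hrot hlast hin
  have hc' : (rinr y :: (z ++ x)).IsChain
      fun x y => ¬ ((¬ ∃ b : H.V, x = rinr b) ∧ ∃ b, y = rinr b) := by
    refine hc.imp fun a b h h' => h ⟨?_, h'.2⟩
    exact (replace_cases a).resolve_right h'.1
  -- There is no second entry, so the tour is one stretch inside `H` followed by one stretch
  -- outside; the first is contracted to `v`.
  obtain ⟨l₁, l₂, hl, h1, h2⟩ := exists_append_of_isChain hc'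
  obtain ⟨q, rfl⟩ : ∃ q : List H.V, l₁ = q.map rinr := by
    refine ⟨l₁.pmap (fun x h => (h : ∃ b, x = rinr b).choose) h1, ?_⟩
    rw [List.map_pmap]
    conv_lhs => rw [← List.pmap_eq_self (l := l₁) (p := fun x => ∃ b, x = rinr b) (hp := h1)
      (f := fun a _ => a) |>.2 (fun _ _ => rfl)]
    refine List.pmap_congr_left _ fun a _ h _ => h.choose_spec
  have h2' : ∀ x ∈ l₂, ∃ a, x = rinl a := fun a ha => (replace_cases a).resolve_right (h2 a ha)
  obtain ⟨s, rfl⟩ : ∃ s : List {u : M.V // u ≠ v}, l₂ = s.map rinl := by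
    refine ⟨l₂.pmap (fun x h => (h : ∃ b, x = rinl b).choose) h2', ?_⟩
    rw [List.map_pmap]
    conv_lhs => rw [← List.pmap_eq_self (l := l₂) (p := fun x => ∃ b, x = rinl b) (hp := h2')
      (f := fun a _ => a) |>.2 (fun _ _ => rfl)]
    refine List.pmap_congr_left _ fun a _ h _ => h.choose_spec
  rw [hl] at hrot
  have hqne : q ≠ [] := by
    rintro rfl
    have : rinr y ∈ s.map (rinl (p := p)) := by
      have : rinr y ∈ rinr y :: (z ++ x) := by simp
      rw [hl] at this
      simpa using this
    obtain ⟨a, -, ha⟩ := List.mem_map.1 this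
    exact rinl_ne_rinr _ _ ha
  have hsne : s ≠ [] := by
    rintro rfl
    have := hrot.2.1 (rinl ⟨u, hu⟩)
    simp only [List.map_nil, List.append_nil, List.mem_map] at this
    obtain ⟨a, -, ha⟩ := this
    exact rinl_ne_rinr _ _ ha.symm
  obtain ⟨a, ha⟩ : ∃ a, q.head? = some a := ⟨_, List.head?_eq_some_head hqne⟩
  obtain ⟨b, hb⟩ : ∃ a, q.getLast? = some a := ⟨_, List.getLast?_eq_some_getLast hqne⟩
  obtain ⟨c, hc⟩ : ∃ a, s.head? = some a := ⟨_, List.head?_eq_some_head hsne⟩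
  obtain ⟨e, he⟩ : ∃ a, s.getLast? = some a := ⟨_, List.getLast?_eq_some_getLast hsne⟩
  obtain ⟨-, h5, h6, h7⟩ := (cycleChain_append_iff (head?_map_of_eq ha) (getLast?_map_of_eq hb)
    (head?_map_of_eq hc) (getLast?_map_of_eq he)).1 hrot.2.2
  refine IsTour.hasTour_cons (v := v) (t := s.map Subtype.val) ⟨?_, ?_, ?_⟩
  · rw [List.nodup_cons]
    refine ⟨fun h => ?_, List.Nodup.map Subtype.val_injective ?_⟩
    · obtain ⟨a, -, h⟩ := List.mem_map.1 h
      exact a.2 h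
    · exact (List.nodup_append.1 hrot.1).2.1.of_map
  · intro w
    by_cases hw : w = v
    · simp [hw]
    · refine List.mem_cons_of_mem _ (List.mem_map.2 ⟨⟨w, hw⟩, ?_, rfl⟩)
      have := hrot.2.1 (rinl ⟨w, hw⟩)
      rw [List.mem_append] at this
      rcases this with h | h
      · obtain ⟨a, -, ha⟩ := List.mem_map.1 h
        exact (rinl_ne_rinr _ _ ha.symm).elim
      · exact (List.mem_map_of_injective rinl_injective).1 h
  · refine (cycleChain_append_iff (l₁ := [v]) rfl rfl (head?_map_of_eq hc)
      (getLast?_map_of_eq he)).2 ⟨List.isChain_singleton _, ?_, ?_, ?_⟩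
    · rw [List.isChain_map] at h5 ⊢
      exact h5
    · obtain ⟨x, hx1, hx2, hx3, -⟩ := adj_rinr_rinl.1 h6
      exact adj_iff_incident_right.2 ⟨x, hx1, hx2, hx3⟩
    · obtain ⟨x, hx1, hx2, hx3, -⟩ := adj_rinl_rinr.1 h7
      exact adj_iff_incident_left.2 ⟨x, hx1, hx2, hx3⟩

end Replace

end MixedGraph
-- Weights that force a single passage
namespace MixedGraph

section Weight

variable {M : MixedGraph} {v : M.V} {H : MixedGraph} {p : Kind × M.V → H.V}

/-- The vertices of `M.replace v H p`. -/
def replaceEquiv (M : MixedGraph) (v : M.V) (H : MixedGraph) (p : Kind × M.V → H.V) :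
    {w : M.V // w ≠ v} ⊕ H.V ≃ (M.replace v H p).V := Equiv.refl _

theorem replaceEquiv_inl (w : {w : M.V // w ≠ v}) :
    replaceEquiv M v H p (Sum.inl w) = rinl w := rfl

theorem replaceEquiv_inr (h : H.V) : replaceEquiv M v H p (Sum.inr h) = rinr h := rfl

/-- Extend a function on `H` by zero. -/
def extendZero (f : H.V → ℤ) (x : (M.replace v H p).V) : ℤ :=
  Sum.elim (fun _ => 0) f ((replaceEquiv M v H p).symm x)

theorem extendZero_rinl (f : H.V → ℤ) (w : {w : M.V // w ≠ v}) :
    extendZero f (rinl w : (M.replace v H p).V) = 0 := rfl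

theorem extendZero_rinr (f : H.V → ℤ) (h : H.V) :
    extendZero f (rinr h : (M.replace v H p).V) = f h := rfl

/-- Here `c x` is the weight still to be collected from `x` up to the next exit from `H`: it
decreases by `W x` along each edge, equals 1 at every entry, and equals `W` at every exit. Working
back from the end of the list, the current passage contributes exactly `c a` and each later entry
raises the total by at least 1. Equality therefore excludes further entries. -/
theorem isChain_of_weight {W c : H.V → ℤ} (hH : ∀ x y, H.adj x y → c x = W x + c y)
    (hin : ∀ x ∈ M.incident v, x.1 ≠ Kind.out → c (p x) = 1)
    (hout : ∀ x ∈ M.incident v, x.1 ≠ Kind.inc → c (p x) = W (p x))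
    {l : List (M.replace v H p).V} (hl : l.IsChain (M.replace v H p).adj)
    {u : {u : M.V // u ≠ v}} (hu : l.getLast? = some (rinl u)) (a : (M.replace v H p).V)
    (ha : l.head? = some a) :
    extendZero c a ≤ (l.map (extendZero W)).sum ∧
      ((l.map (extendZero W)).sum = extendZero c a →
        l.IsChain fun x y => ¬ ((∃ a, x = rinl a) ∧ ∃ b, y = rinr b)) := by
  induction l generalizing a with
  | nil => simp at ha
  | cons b l ih =>
    obtain rfl : b = a := by simpa using ha
    rcases l with _ | ⟨d, l⟩
    · obtain rfl : b = rinl u := by simpa using hu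
      simp [extendZero_rinl]
    · rw [List.isChain_cons_cons] at hl
      rw [List.getLast?_cons_cons] at hu
      obtain ⟨ih1, ih2⟩ := ih hl.2 hu d rfl
      rw [List.map_cons, List.sum_cons, List.isChain_cons_cons]
      rcases replace_cases b with ⟨b, rfl⟩ | ⟨b, rfl⟩ <;>
        rcases replace_cases d with ⟨d, rfl⟩ | ⟨d, rfl⟩
      · simp only [extendZero_rinl, zero_add] at ih1 ih2 ⊢
        exact ⟨ih1, fun h => ⟨fun ⟨_, _, h'⟩ => rinl_ne_rinr _ _ h', ih2 h⟩⟩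
      · obtain ⟨x, hx1, hx2, -, rfl⟩ := adj_rinl_rinr.1 hl.1
        have := hin x hx1 hx2
        simp only [extendZero_rinl, extendZero_rinr, zero_add] at ih1 ih2 ⊢
        exact ⟨by omega, fun h => by omega⟩
      · obtain ⟨x, hx1, hx2, -, rfl⟩ := adj_rinr_rinl.1 hl.1
        have := hout x hx1 hx2
        simp only [extendZero_rinl, extendZero_rinr] at ih1 ih2 ⊢
        exact ⟨by omega, fun h => ⟨fun ⟨⟨_, h'⟩, _⟩ => rinl_ne_rinr _ _ h'.symm, ih2 (by omega)⟩⟩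
      · have := hH _ _ (adj_rinr_rinr.1 hl.1)
        simp only [extendZero_rinr] at ih1 ih2 ⊢
        exact ⟨by omega, fun h => ⟨fun ⟨⟨_, h'⟩, _⟩ => rinl_ne_rinr _ _ h'.symm, ih2 (by omega)⟩⟩

/-- If `H` carries weights of total `1` such that each passage of a path through `H` has weight at
least `1`, then every Hamiltonian cycle visits `H` only once. The weight of the remainder of the
passage is prescribed by `c`. -/
theorem Ham.of_replace_of_weight [Fintype H.V] (W c : H.V → ℤ) (hW : ∑ h, W h = 1)
    (hH : ∀ x y, H.adj x y → c x = W x + c y)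
    (hin : ∀ x ∈ M.incident v, x.1 ≠ Kind.out → c (p x) = 1)
    (hout : ∀ x ∈ M.incident v, x.1 ≠ Kind.inc → c (p x) = W (p x))
    (hM : ∃ u, u ≠ v) (h : (M.replace v H p).Ham) : M.Ham := by
  classical
  have : Nonempty H.V := by
    by_contra hne
    rw [not_nonempty_iff] at hne
    simp at hW
  refine Ham.of_replace hM ?_ h
  intro h t u ht hu huh
  obtain ⟨x, hx1, hx2, -, rfl⟩ := adj_rinl_rinr.1 huh
  -- The tour starts at an entry, where `c` is 1, and meets every vertex once, so its weight is the
  -- total weight 1: this is the case of equality.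
  refine (isChain_of_weight hH hin hout ht.isChain hu _ rfl).2 ?_
  have : Fintype {w : M.V // w ≠ v} := Fintype.ofFinite _
  have : Fintype (M.replace v H p).V := Fintype.ofEquiv _ (replaceEquiv M v H p)
  have htoF : (rinr (p x) :: t).toFinset = Finset.univ :=
    Finset.eq_univ_of_forall fun z => List.mem_toFinset.2 (ht.2.1 z)
  rw [← List.sum_toFinset _ ht.1, htoF, ← (replaceEquiv M v H p).sum_comp, Fintype.sum_sum_type]
  simp [replaceEquiv_inl, replaceEquiv_inr, extendZero_rinl, extendZero_rinr, hin x hx1 hx2, hW]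

end Weight

end MixedGraph

/-! ## Degrees and sums over the vertices -/

instance : Finite Kind :=
  Finite.of_surjective (fun i : Fin 3 => ![Kind.inc, Kind.out, Kind.und] i) fun k => by
    cases k
    · exact ⟨0, rfl⟩
    · exact ⟨1, rfl⟩
    · exact ⟨2, rfl⟩

namespace MixedGraph

/-- The number of edges of kind `k` incident with `v`. -/
noncomputable def kdeg (M : MixedGraph) (k : Kind) (v : M.V) : ℕ :=
  {u | (k, u) ∈ M.incident v}.ncard

theorem degree_eq (M : MixedGraph) (v : M.V) :
    M.degree v = M.kdeg .inc v + M.kdeg .out v + M.kdeg .und v := by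
  have h : M.incident v = Prod.mk Kind.inc '' {u | (Kind.inc, u) ∈ M.incident v} ∪
      Prod.mk Kind.out '' {u | (Kind.out, u) ∈ M.incident v} ∪
      Prod.mk Kind.und '' {u | (Kind.und, u) ∈ M.incident v} := by
    ext ⟨k, u⟩
    cases k <;> simp
  have hd : ∀ (k k' : Kind) (s t : Set M.V), k ≠ k' →
      Disjoint (Prod.mk k '' s) (Prod.mk k' '' t) := by
    intro k k' s t hk
    rw [Set.disjoint_left]
    rintro _ ⟨u, -, rfl⟩ ⟨w, -, h⟩
    exact hk (Prod.mk.inj h).1.symm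
  rw [degree, h, Set.ncard_union_eq (Set.disjoint_union_left.2 ⟨hd _ _ _ _ (by simp),
    hd _ _ _ _ (by simp)⟩) (Set.toFinite _) (Set.toFinite _),
    Set.ncard_union_eq (hd _ _ _ _ (by simp)) (Set.toFinite _) (Set.toFinite _)]
  simp only [Set.ncard_image_of_injective _ (Prod.mk_right_injective _)]
  rfl

/-- The sum of a function over all vertices. -/
noncomputable def total (M : MixedGraph) (f : M.V → ℕ) : ℕ := ∑ᶠ v, f v

theorem total_eq_sum (M : MixedGraph) [Fintype M.V] (f : M.V → ℕ) : M.total f = ∑ v, f v :=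
  finsum_eq_sum_of_fintype f

theorem total_mono {M : MixedGraph} {f g : M.V → ℕ} (h : ∀ v, f v ≤ g v) :
    M.total f ≤ M.total g := by
  have := Fintype.ofFinite M.V
  rw [total_eq_sum, total_eq_sum]
  exact Finset.sum_le_sum fun v _ => h v

theorem total_const (M : MixedGraph) (c : ℕ) : M.total (fun _ => c) = Nat.card M.V * c := by
  have := Fintype.ofFinite M.V
  rw [total_eq_sum]
  simp

theorem total_add (M : MixedGraph) (f g : M.V → ℕ) :
    M.total (fun v => f v + g v) = M.total f + M.total g := by
  have := Fintype.ofFinite M.V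
  simp only [total_eq_sum, Finset.sum_add_distrib]

theorem total_mul (M : MixedGraph) (c : ℕ) (f : M.V → ℕ) :
    M.total (fun v => c * f v) = c * M.total f := by
  have := Fintype.ofFinite M.V
  simp only [total_eq_sum, Finset.mul_sum]

section Replace

variable {M : MixedGraph} {v : M.V} {H : MixedGraph} {p : Kind × M.V → H.V}

/-- The term of `v` is exchanged for the terms of `H`; the additive form avoids truncated
subtraction. All later measures and size bounds rest on this identity. -/
theorem total_replace {f : (M.replace v H p).V → ℕ} {g : M.V → ℕ} (h : ∀ w, f (rinl w) = g w) :
    (M.replace v H p).total f + g v = M.total g + H.total fun h => f (rinr h) := by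
  classical
  have := Fintype.ofFinite M.V
  have := Fintype.ofFinite H.V
  have : Fintype (M.replace v H p).V := Fintype.ofEquiv _ (replaceEquiv M v H p)
  rw [total_eq_sum, total_eq_sum, total_eq_sum, ← (replaceEquiv M v H p).sum_comp,
    Fintype.sum_sum_type, Fintype.sum_eq_add_sum_subtype_ne g v]
  simp only [replaceEquiv_inl, replaceEquiv_inr, h]
  omega

/-- The kind of an edge, as seen from its other end. -/
def _root_.Kind.flip : Kind → Kind
  | .inc => .out
  | .out => .inc
  | .und => .und

theorem rinl_mem_incident_rinl {k : Kind} {a w : {w : M.V // w ≠ v}} :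
    (k, rinl a) ∈ (M.replace v H p).incident (rinl w) ↔ (k, a.1) ∈ M.incident w := by
  cases k <;> rfl

theorem rinr_mem_incident_rinl {k : Kind} {h : H.V} {w : {w : M.V // w ≠ v}} :
    (k, rinr h) ∈ (M.replace v H p).incident (rinl w) ↔
      (k, v) ∈ M.incident w ∧ p (k.flip, w) = h := by
  cases k
  · rfl
  · rfl
  · exact and_congr_left fun _ => M.edge.adj_comm _ _

theorem rinl_mem_incident_rinr {k : Kind} {h : H.V} {w : {w : M.V // w ≠ v}} :
    (k, rinl w) ∈ (M.replace v H p).incident (rinr h) ↔ (k, w.1) ∈ M.incident v ∧ p (k, w) = h := by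
  cases k <;> rfl

theorem rinr_mem_incident_rinr {k : Kind} {h h' : H.V} :
    (k, rinr h') ∈ (M.replace v H p).incident (rinr h) ↔ (k, h') ∈ H.incident h := by
  cases k <;> rfl

theorem not_mem_incident_self {k : Kind} : (k, v) ∉ M.incident v := by
  cases k
  · exact M.arc_irrefl v
  · exact M.arc_irrefl v
  · exact M.edge.irrefl

/-- Other vertices keep their degrees: at most one edge of kind `k` leads from `w` to `v`, and only
its far end is renamed. The map `π` is this renaming of neighbours. -/
theorem kdeg_rinl (k : Kind) (w : {w : M.V // w ≠ v}) :
    (M.replace v H p).kdeg k (rinl w) = M.kdeg k w := by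
  classical
  let π : M.V → (M.replace v H p).V :=
    fun u => if hu : u = v then rinr (p (k.flip, w)) else rinl ⟨u, hu⟩
  have hπ : Function.Injective π := by
    intro a b hab
    by_cases ha : a = v <;> by_cases hb : b = v <;> simp only [π, ha, hb, dif_pos, dif_neg,
      not_false_eq_true] at hab ⊢
    · exact (rinl_ne_rinr _ _ hab.symm).elim
    · exact (rinl_ne_rinr _ _ hab).elim
    · exact congrArg Subtype.val (rinl_injective hab)
  rw [kdeg, kdeg, ← Set.ncard_image_of_injective _ hπ]
  congr 1
  ext x
  simp only [Set.mem_ofPred_eq, Set.mem_image]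
  rcases replace_cases x with ⟨a, rfl⟩ | ⟨h, rfl⟩
  · rw [rinl_mem_incident_rinl]
    constructor
    · intro ha
      exact ⟨a, ha, by simp [π, a.2]⟩
    · rintro ⟨u, hu, h⟩
      by_cases huv : u = v
      · simp only [π, huv, dif_pos] at h
        exact (rinl_ne_rinr _ _ h.symm).elim
      · simp only [π, huv, dif_neg, not_false_eq_true] at h
        rwa [← rinl_injective h]
  · rw [rinr_mem_incident_rinl]
    constructor
    · rintro ⟨h1, rfl⟩
      exact ⟨v, h1, by simp [π]⟩
    · rintro ⟨u, hu, h⟩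
      by_cases huv : u = v
      · simp only [π, huv, dif_pos] at h
        exact ⟨huv ▸ hu, rinr_injective h⟩
      · simp only [π, huv, dif_neg, not_false_eq_true] at h
        exact (rinl_ne_rinr _ _ h).elim

variable (p) in
/-- The number of external edges of kind `k` at the vertex `h` of `H`. -/
noncomputable def attached (v : M.V) (k : Kind) (h : H.V) : ℕ :=
  {u | (k, u) ∈ M.incident v ∧ p (k, u) = h}.ncard

theorem kdeg_rinr (k : Kind) (h : H.V) :
    (M.replace v H p).kdeg k (rinr h) = H.kdeg k h + attached p v k h := by
  have hset : {u | (k, u) ∈ (M.replace v H p).incident (rinr h)} =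
      rinr '' {h' | (k, h') ∈ H.incident h} ∪
        rinl '' {w : {w : M.V // w ≠ v} | (k, w.1) ∈ M.incident v ∧ p (k, w) = h} := by
    ext x
    rcases replace_cases x with ⟨a, rfl⟩ | ⟨h', rfl⟩
    · rw [Set.mem_ofPred_eq, rinl_mem_incident_rinr, Set.mem_union,
        rinl_injective.mem_set_image]
      have : rinl a ∉ (rinr '' {h' | (k, h') ∈ H.incident h} : Set (M.replace v H p).V) := by
        rintro ⟨b, -, hb⟩
        exact rinl_ne_rinr _ _ hb.symm
      simp [this]
    · rw [Set.mem_ofPred_eq, rinr_mem_incident_rinr, Set.mem_union,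
        rinr_injective.mem_set_image]
      have : rinr h' ∉ (rinl '' {w : {w : M.V // w ≠ v} | (k, w.1) ∈ M.incident v ∧ p (k, w) = h} :
          Set (M.replace v H p).V) := by
        rintro ⟨b, -, hb⟩
        exact rinl_ne_rinr _ _ hb
      simp [this]
  rw [kdeg, hset, Set.ncard_union_eq _ (Set.toFinite _) (Set.toFinite _),
    Set.ncard_image_of_injective _ rinr_injective, Set.ncard_image_of_injective _ rinl_injective,
    ← Set.ncard_image_of_injective _ Subtype.val_injective]
  · rw [kdeg, attached]
    congr 2
    ext u
    simp only [Set.mem_image, Set.mem_ofPred_eq]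
    constructor
    · rintro ⟨w, hw, rfl⟩
      exact hw
    · rintro hu
      exact ⟨⟨u, fun h => not_mem_incident_self (h ▸ hu.1)⟩, hu, rfl⟩
  · rw [Set.disjoint_left]
    rintro _ ⟨a, -, rfl⟩ ⟨b, -, hb⟩
    exact rinl_ne_rinr _ _ hb

theorem attached_eq_zero {k : Kind} {h : H.V} (hp : ∀ u, (k, u) ∈ M.incident v → p (k, u) ≠ h) :
    attached p v k h = 0 := by
  rw [attached, Set.ncard_eq_zero]
  ext u
  simpa using hp u

theorem attached_eq_kdeg {k : Kind} {h : H.V} (hp : ∀ u, (k, u) ∈ M.incident v → p (k, u) = h) :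
    attached p v k h = M.kdeg k v := by
  rw [attached, kdeg]
  congr 1
  ext u
  simpa using hp u

theorem attached_add {k : Kind} {a b : H.V} (hab : a ≠ b)
    (hp : ∀ u, (k, u) ∈ M.incident v → p (k, u) = a ∨ p (k, u) = b) :
    attached p v k a + attached p v k b = M.kdeg k v := by
  rw [attached, attached, kdeg, ← Set.ncard_union_eq _ (Set.toFinite _) (Set.toFinite _)]
  · congr 1
    ext u
    have := hp u
    simp only [Set.mem_union, Set.mem_ofPred_eq]
    tauto
  · rw [Set.disjoint_left]
    rintro u ⟨-, h1⟩ ⟨-, h2⟩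
    exact hab (h1.symm.trans h2)

theorem degree_rinl (w : {w : M.V // w ≠ v}) :
    (M.replace v H p).degree (rinl w) = M.degree w := by
  simp only [degree_eq, kdeg_rinl]

theorem attached_add_attached_add_attached (h : H.V) :
    attached p v .inc h + attached p v .out h + attached p v .und h =
      {x ∈ M.incident v | p x = h}.ncard := by
  have hs : {x ∈ M.incident v | p x = h} =
      Prod.mk Kind.inc '' {u | (Kind.inc, u) ∈ M.incident v ∧ p (Kind.inc, u) = h} ∪
      Prod.mk Kind.out '' {u | (Kind.out, u) ∈ M.incident v ∧ p (Kind.out, u) = h} ∪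
      Prod.mk Kind.und '' {u | (Kind.und, u) ∈ M.incident v ∧ p (Kind.und, u) = h} := by
    ext ⟨k, u⟩
    cases k <;> simp
  have hd : ∀ (k k' : Kind) (s t : Set M.V), k ≠ k' →
      Disjoint (Prod.mk k '' s) (Prod.mk k' '' t) := by
    intro k k' s t hk
    rw [Set.disjoint_left]
    rintro _ ⟨u, -, rfl⟩ ⟨w, -, h⟩
    exact hk (Prod.mk.inj h).1.symm
  rw [hs, Set.ncard_union_eq (Set.disjoint_union_left.2 ⟨hd _ _ _ _ (by simp),
    hd _ _ _ _ (by simp)⟩) (Set.toFinite _) (Set.toFinite _),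
    Set.ncard_union_eq (hd _ _ _ _ (by simp)) (Set.toFinite _) (Set.toFinite _)]
  simp only [Set.ncard_image_of_injective _ (Prod.mk_right_injective _)]
  rfl

theorem degree_rinr (h : H.V) :
    (M.replace v H p).degree (rinr h) = H.degree h + {x ∈ M.incident v | p x = h}.ncard := by
  rw [← attached_add_attached_add_attached, degree_eq, degree_eq, kdeg_rinr, kdeg_rinr, kdeg_rinr]
  omega

open Classical in
theorem degree_rinr_of_bijOn {S : Set H.V} (hp : Set.BijOn p (M.incident v) S) (h : H.V) :
    (M.replace v H p).degree (rinr h) = H.degree h + if h ∈ S then 1 else 0 := by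
  rw [degree_rinr]
  split_ifs with hS
  · obtain ⟨x, hx, rfl⟩ := hp.surjOn hS
    congr 1
    rw [Set.ncard_eq_one]
    refine ⟨x, Set.eq_singleton_iff_unique_mem.2 ⟨⟨hx, rfl⟩, fun y hy => ?_⟩⟩
    exact hp.injOn hy.1 hx hy.2
  · congr 1
    rw [Set.ncard_eq_zero]
    ext x
    simp only [Set.mem_ofPred_eq, Set.mem_empty_iff_false, iff_false]
    rintro ⟨hx, rfl⟩
    exact hS (hp.mapsTo hx)

end Replace

end MixedGraph

/-! ## Loops -/

theorem LoopTerminates.exists_runLoop {α : Type*} {step : α → α → Prop} (h : LoopTerminates step)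
    (a : α) : ∃ b, RunLoop step a b := by
  induction a using h.induction with
  | _ a ih =>
    by_cases ha : ∃ c, step a c
    · obtain ⟨c, hc⟩ := ha
      obtain ⟨b, hb, hb'⟩ := ih c hc
      exact ⟨b, hb.head hc, hb'⟩
    · exact ⟨a, .refl, fun c hc => ha ⟨c, hc⟩⟩

theorem LoopTerminates.of_measure {α : Type*} {step : α → α → Prop} (f : α → ℕ)
    (h : ∀ a b, step a b → f b < f a) : LoopTerminates step :=
  Subrelation.wf (fun {_ _} hab => h _ _ hab) (measure f).wf

theorem reflTransGen_invariant {α : Type*} {step : α → α → Prop} {P : α → Prop}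
    (h : ∀ a b, step a b → P a → P b) {a b : α} (hab : Relation.ReflTransGen step a b) (ha : P a) :
    P b := by
  induction hab with
  | refl => exact ha
  | tail _ hbc ih => exact h _ _ hbc ih

/-! ## The Splitting Procedure -/

namespace MixedGraph

/-- All edges are directed. -/
def NoUnd (M : MixedGraph) : Prop := ∀ x y, ¬ M.edge.Adj x y

theorem NoUnd.replace {M : MixedGraph} {v : M.V} {H : MixedGraph} {p : Kind × M.V → H.V}
    (hM : M.NoUnd) (hH : H.NoUnd) : (M.replace v H p).NoUnd := by
  rintro (a | a) (b | b)
  · exact hM _ _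
  · exact fun h => hM _ _ h.1
  · exact fun h => hM _ _ h.1
  · exact hH _ _

theorem NoUnd.kdeg_und {M : MixedGraph} (hM : M.NoUnd) (v : M.V) : M.kdeg .und v = 0 := by
  rw [kdeg, Set.ncard_eq_zero]
  ext u
  exact iff_of_false (hM _ _) (Set.notMem_empty _)

/-- The loops before the last stage only replace vertices of larger degree, so a vertex of low
degree lives through them. This is how isolated vertices of the input are followed up to the test
for the Petersen graph. -/
theorem exists_degree_le_replace {M : MixedGraph} {v : M.V} {H : MixedGraph} {p : Kind × M.V → H.V}
    {c : ℕ} (h : ∃ w, M.degree w ≤ c) (hv : c < M.degree v) :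
    ∃ w, (M.replace v H p).degree w ≤ c := by
  obtain ⟨w, hw⟩ := h
  refine ⟨rinl ⟨w, ?_⟩, by rwa [degree_rinl]⟩
  rintro rfl
  omega

theorem kdeg_le_degree (M : MixedGraph) (k : Kind) (v : M.V) : M.kdeg k v ≤ M.degree v := by
  rw [degree_eq]
  cases k <;> omega

theorem exists_ne_of_degree_pos {M : MixedGraph} {v : M.V} (h : 0 < M.degree v) : ∃ u, u ≠ v := by
  obtain ⟨⟨k, u⟩, hu⟩ := (Set.ncard_pos (Set.toFinite _)).1 h
  exact ⟨u, fun h => not_mem_incident_self (h ▸ hu)⟩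

end MixedGraph

namespace HCP

open MixedGraph

theorem split_noUnd : split.NoUnd := fun _ _ h => h
theorem inSplit_noUnd : inSplit.NoUnd := fun _ _ h => h
theorem outSplit_noUnd : outSplit.NoUnd := fun _ _ h => h

instance : Fintype split.V := inferInstanceAs (Fintype (Fin 2))
instance : Fintype inSplit.V := inferInstanceAs (Fintype (Fin 3))
instance : Fintype outSplit.V := inferInstanceAs (Fintype (Fin 3))

theorem split_total (f : split.V → ℕ) : split.total f = f (0 : Fin 2) + f (1 : Fin 2) := by
  rw [total_eq_sum]
  exact Fin.sum_univ_two f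

theorem inSplit_total (f : inSplit.V → ℕ) :
    inSplit.total f = f (0 : Fin 3) + f (1 : Fin 3) + f (2 : Fin 3) := by
  rw [total_eq_sum]
  exact Fin.sum_univ_three f

theorem outSplit_total (f : outSplit.V → ℕ) :
    outSplit.total f = f (0 : Fin 3) + f (1 : Fin 3) + f (2 : Fin 3) := by
  rw [total_eq_sum]
  exact Fin.sum_univ_three f

theorem split_kdeg_inc (a : Fin 2) : split.kdeg .inc a = ![0, 1] a := by
  have : split.kdeg .inc a = {u : Fin 2 | (u, a) = (0, 1)}.ncard := rfl
  rw [this, Set.ncard_eq_toFinset_card']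
  clear this
  revert a
  decide

theorem split_kdeg_out (a : Fin 2) : split.kdeg .out a = ![1, 0] a := by
  have : split.kdeg .out a = {u : Fin 2 | (a, u) = (0, 1)}.ncard := rfl
  rw [this, Set.ncard_eq_toFinset_card']
  clear this
  revert a
  decide

theorem inSplit_kdeg_inc (a : Fin 3) : inSplit.kdeg .inc a = ![1, 1, 2] a := by
  have : inSplit.kdeg .inc a = {u : Fin 3 | (u, a) ∈
    ([(0, 1), (0, 2), (1, 0), (1, 2)] : List (Fin 3 × Fin 3))}.ncard := rfl
  rw [this, Set.ncard_eq_toFinset_card']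
  clear this
  revert a
  decide

theorem inSplit_kdeg_out (a : Fin 3) : inSplit.kdeg .out a = ![2, 2, 0] a := by
  have : inSplit.kdeg .out a = {u : Fin 3 | (a, u) ∈
    ([(0, 1), (0, 2), (1, 0), (1, 2)] : List (Fin 3 × Fin 3))}.ncard := rfl
  rw [this, Set.ncard_eq_toFinset_card']
  clear this
  revert a
  decide

theorem outSplit_kdeg_inc (a : Fin 3) : outSplit.kdeg .inc a = ![0, 2, 2] a := by
  have : outSplit.kdeg .inc a = {u : Fin 3 | (u, a) ∈
    ([(0, 1), (0, 2), (1, 2), (2, 1)] : List (Fin 3 × Fin 3))}.ncard := rfl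
  rw [this, Set.ncard_eq_toFinset_card']
  clear this
  revert a
  decide

theorem outSplit_kdeg_out (a : Fin 3) : outSplit.kdeg .out a = ![2, 1, 1] a := by
  have : outSplit.kdeg .out a = {u : Fin 3 | (a, u) ∈
    ([(0, 1), (0, 2), (1, 2), (2, 1)] : List (Fin 3 × Fin 3))}.ncard := rfl
  rw [this, Set.ncard_eq_toFinset_card']
  clear this
  revert a
  decide

open Classical in
/-- The sum of a function of the in-degrees and out-degrees, and of whether a vertex belongs to the
marked part. -/
noncomputable def Marked.sum (A : Marked) (F : Bool → ℕ → ℕ → ℕ) : ℕ :=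
  A.graph.total fun x => F (decide (x ∈ A.part)) (A.graph.kdeg .inc x) (A.graph.kdeg .out x)

/-- The function `F` is left arbitrary, so that the termination measures, the size bound and the
count of bad vertices all become instances of one identity. The flag `b` says whether the replaced
vertex was marked. -/
theorem Marked.sum_replace (A : Marked) (v : A.graph.V) (H : MixedGraph)
    (p : Kind × A.graph.V → H.V) (F : Bool → ℕ → ℕ → ℕ) (b : Bool) (hb : b = true ↔ v ∈ A.part) :
    (A.replace v H p).sum F + F b (A.graph.kdeg .inc v) (A.graph.kdeg .out v) =
      A.sum F + H.total fun h => F true (H.kdeg .inc h + attached p v .inc h)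
        (H.kdeg .out h + attached p v .out h) := by
  classical
  have hb' : b = decide (v ∈ A.part) := by
    by_cases h : v ∈ A.part <;> simp_all
  have := total_replace (M := A.graph) (v := v) (H := H) (p := p)
    (f := fun x => F (decide (x ∈ (A.replace v H p).part))
      ((A.graph.replace v H p).kdeg .inc x) ((A.graph.replace v H p).kdeg .out x))
    (g := fun x => F (decide (x ∈ A.part)) (A.graph.kdeg .inc x) (A.graph.kdeg .out x))
    (fun w => by
      rw [kdeg_rinl, kdeg_rinl]
      rfl)
  rw [hb']
  refine this.trans ?_
  refine congrArg (_ + ·) (congrArg _ (funext fun h => ?_))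
  rw [kdeg_rinr, kdeg_rinr]
  have : (rinr h : (A.graph.replace v H p).V) ∈ (A.replace v H p).part := trivial
  rw [decide_eq_true this]

theorem InitialSplit.sum_eq {M : MixedGraph} {v : M.V} {B : Marked} (h : InitialSplit M v B)
    (F : Bool → ℕ → ℕ → ℕ) :
    B.sum F + F false (M.kdeg .inc v) (M.kdeg .out v) =
      Marked.sum ⟨M, ∅⟩ F + (F true (M.kdeg .inc v) 1 + F true 1 (M.kdeg .out v)) := by
  obtain ⟨p, h1, h2, rfl⟩ := h
  rw [Marked.sum_replace ⟨M, ∅⟩ v split p F false (by simp), split_total]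
  rw [split_kdeg_inc, split_kdeg_inc, split_kdeg_out, split_kdeg_out,
    attached_eq_kdeg (H := split) (k := .inc) (h := (0 : Fin 2)) (p := p) (v := v) h1,
    attached_eq_kdeg (H := split) (k := .out) (h := (1 : Fin 2)) (p := p) (v := v) h2,
    attached_eq_zero (H := split) (k := .inc) (h := (1 : Fin 2)) (p := p) (v := v)
      (fun u hu => by rw [h1 u hu]; exact (by decide : (0 : Fin 2) ≠ 1)),
    attached_eq_zero (H := split) (k := .out) (h := (0 : Fin 2)) (p := p) (v := v)
      (fun u hu => by rw [h2 u hu]; exact (by decide : (1 : Fin 2) ≠ 0))]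
  simp

/-- In terms of pairs (in-degree, out-degree), `(n, m)` is replaced by `(1 + a, 2)`, `(1 + b, 2)`
and `(2, m)`. Everything needed later about an in-split, except Hamiltonicity, is contained in this;
out-splits are dual. -/
theorem InSplitStep.sum_eq {d : ℕ} {A B : Marked} (h : InSplitStep d A B) :
    ∃ n m a b, d < n ∧ n = a + b ∧ a ≤ b + 1 ∧ b ≤ a + 1 ∧ ∀ F : Bool → ℕ → ℕ → ℕ,
      B.sum F + F true n m =
        A.sum F + (F true (1 + a) 2 + F true (1 + b) 2 + F true 2 m) := by
  obtain ⟨v, hv, p, hd, h1, h2, h3, h4, rfl⟩ := h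
  refine ⟨A.graph.kdeg .inc v, A.graph.kdeg .out v,
    attached (H := inSplit) p v .inc (0 : Fin 3), attached (H := inSplit) p v .inc (1 : Fin 3), hd,
    (attached_add (H := inSplit) (by decide : (0 : Fin 3) ≠ 1) h1).symm, h2, h3, fun F => ?_⟩
  rw [Marked.sum_replace A v inSplit p F true (by simpa using hv), inSplit_total]
  simp only [inSplit_kdeg_inc, inSplit_kdeg_out]
  rw [attached_eq_zero (H := inSplit) (k := .inc) (h := (2 : Fin 3)) (p := p) (v := v)
      (fun u hu => by rcases h1 u hu with h | h <;> rw [h]; exacts [(by decide : (0 : Fin 3) ≠ 2), (by decide : (1 : Fin 3) ≠ 2)]),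
    attached_eq_kdeg (H := inSplit) (k := .out) (h := (2 : Fin 3)) (p := p) (v := v) h4,
    attached_eq_zero (H := inSplit) (k := .out) (h := (0 : Fin 3)) (p := p) (v := v)
      (fun u hu => by rw [h4 u hu]; exact (by decide : (2 : Fin 3) ≠ 0)),
    attached_eq_zero (H := inSplit) (k := .out) (h := (1 : Fin 3)) (p := p) (v := v)
      (fun u hu => by rw [h4 u hu]; exact (by decide : (2 : Fin 3) ≠ 1))]
  simp

theorem OutSplitStep.sum_eq {d : ℕ} {A B : Marked} (h : OutSplitStep d A B) :
    ∃ n m a b, d < m ∧ m = a + b ∧ a ≤ b + 1 ∧ b ≤ a + 1 ∧ ∀ F : Bool → ℕ → ℕ → ℕ,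
      B.sum F + F true n m =
        A.sum F + (F true n 2 + F true 2 (1 + a) + F true 2 (1 + b)) := by
  obtain ⟨v, hv, p, hd, h4, h1, h2, h3, rfl⟩ := h
  refine ⟨A.graph.kdeg .inc v, A.graph.kdeg .out v,
    attached (H := outSplit) p v .out (1 : Fin 3), attached (H := outSplit) p v .out (2 : Fin 3),
    hd, (attached_add (H := outSplit) (by decide : (1 : Fin 3) ≠ 2) h1).symm, h2, h3, fun F => ?_⟩
  rw [Marked.sum_replace A v outSplit p F true (by simpa using hv), outSplit_total]
  simp only [outSplit_kdeg_inc, outSplit_kdeg_out]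
  rw [attached_eq_zero (H := outSplit) (k := .out) (h := (0 : Fin 3)) (p := p) (v := v)
      (fun u hu => by rcases h1 u hu with h | h <;> rw [h]; exacts [(by decide : (1 : Fin 3) ≠ 0), (by decide : (2 : Fin 3) ≠ 0)]),
    attached_eq_kdeg (H := outSplit) (k := .inc) (h := (0 : Fin 3)) (p := p) (v := v) h4,
    attached_eq_zero (H := outSplit) (k := .inc) (h := (1 : Fin 3)) (p := p) (v := v)
      (fun u hu => by rw [h4 u hu]; exact (by decide : (0 : Fin 3) ≠ 1)),
    attached_eq_zero (H := outSplit) (k := .inc) (h := (2 : Fin 3)) (p := p) (v := v)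
      (fun u hu => by rw [h4 u hu]; exact (by decide : (0 : Fin 3) ≠ 2))]
  simp

theorem inSplitStep_terminates {d : ℕ} (hd : 4 ≤ d) : LoopTerminates (InSplitStep d) := by
  -- The measure is the excess of the in-degrees over 3. As `n ≥ 5`, both shares `a` and `b` are at
  -- least 2, so the new excess is `(a - 2) + (b - 2) = n - 4`, one less than before. A vertex of
  -- in-degree 3 would only reproduce itself, which is why the threshold is 3.
  refine .of_measure (fun A => A.sum fun b n _ => if b then n - 3 else 0) fun A B h => ?_
  obtain ⟨n, m, a, b, h1, h2, h3, h4, h5⟩ := h.sum_eq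
  have := h5 fun b n _ => if b then n - 3 else 0
  simp only [if_true] at this
  omega

theorem outSplitStep_terminates {d : ℕ} (hd : 4 ≤ d) : LoopTerminates (OutSplitStep d) := by
  refine .of_measure (fun A => A.sum fun b _ n => if b then n - 3 else 0) fun A B h => ?_
  obtain ⟨n, m, a, b, h1, h2, h3, h4, h5⟩ := h.sum_eq
  have := h5 fun b _ n => if b then n - 3 else 0
  simp only [if_true] at this
  omega

theorem exists_halving {α : Type*} (S : Set α) :
    ∃ T ⊆ S, T.ncard ≤ (S \ T).ncard + 1 ∧ (S \ T).ncard ≤ T.ncard + 1 := by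
  by_cases hS : S.Finite
  · obtain ⟨T, hT, hc⟩ := Set.exists_subset_card_eq (s := S) (n := S.ncard / 2) (by omega)
    have := Set.ncard_sdiff_add_ncard_of_subset hT hS
    exact ⟨T, hT, by omega, by omega⟩
  · exact ⟨∅, by simp, by simp, by simp [Set.Infinite.ncard hS]⟩

theorem inDegree_le_of_forall_not_inSplitStep {d : ℕ} {A : Marked} (h : ∀ B, ¬ InSplitStep d A B)
    {v : A.graph.V} (hv : v ∈ A.part) : A.graph.kdeg .inc v ≤ d := by
  classical
  by_contra! hd
  obtain ⟨T, hT, h1, h2⟩ := exists_halving {u | A.graph.Arc u v}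
  let p : Kind × A.graph.V → Fin 3 := fun x =>
    match x with
    | (.inc, u) => if u ∈ T then 0 else 1
    | _ => 2
  have h0 : {u | A.graph.Arc u v ∧ p (Kind.inc, u) = 0} = T := by
    ext u
    by_cases hu : u ∈ T
    · simpa [p, hu] using hT hu
    · simp [p, hu]
  have h1' : {u | A.graph.Arc u v ∧ p (Kind.inc, u) = 1} = {u | A.graph.Arc u v} \ T := by
    ext u
    by_cases hu : u ∈ T
    · simp [p, hu]
    · simp [p, hu]
  refine h _ ⟨v, hv, p, hd, fun u _ => ?_, ?_, ?_, fun _ _ => rfl, rfl⟩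
  · by_cases hu : u ∈ T <;> simp [p, hu]
  · rwa [h0, h1']
  · rwa [h0, h1']

theorem outDegree_le_of_forall_not_outSplitStep {d : ℕ} {A : Marked}
    (h : ∀ B, ¬ OutSplitStep d A B) {v : A.graph.V} (hv : v ∈ A.part) :
    A.graph.kdeg .out v ≤ d := by
  classical
  by_contra! hd
  obtain ⟨T, hT, h1, h2⟩ := exists_halving {u | A.graph.Arc v u}
  let p : Kind × A.graph.V → Fin 3 := fun x =>
    match x with
    | (.out, u) => if u ∈ T then 1 else 2
    | _ => 0
  have h0 : {u | A.graph.Arc v u ∧ p (Kind.out, u) = 1} = T := by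
    ext u
    by_cases hu : u ∈ T
    · simpa [p, hu] using hT hu
    · simp [p, hu]
  have h1' : {u | A.graph.Arc v u ∧ p (Kind.out, u) = 2} = {u | A.graph.Arc v u} \ T := by
    ext u
    by_cases hu : u ∈ T
    · simp [p, hu]
    · simp [p, hu]
  refine h _ ⟨v, hv, p, hd, fun _ _ => rfl, fun u _ => ?_, ?_, ?_, rfl⟩
  · by_cases hu : u ∈ T <;> simp [p, hu]
  · rwa [h0, h1']
  · rwa [h0, h1']

/-! ### Termination and size of the Splitting Procedure -/

/-- The number of vertices whose in-degree or out-degree is greater than `d`. -/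
noncomputable def numBad (d : ℕ) (M : MixedGraph) : ℕ :=
  M.total fun v => if d < M.kdeg .inc v ∨ d < M.kdeg .out v then 1 else 0

/-- An upper bound for the number of vertices after all further in-splits and out-splits. -/
noncomputable def splitSize (M : MixedGraph) : ℕ :=
  M.total fun v => 1 + 2 * ((M.kdeg .inc v - 3) + (M.kdeg .out v - 3))

/-- An in-split adds two vertices and lowers the total excess of the degrees over 3 by one; the
factor 2 in `splitSize` makes these cancel. -/
theorem InSplitStep.splitSize_le {d : ℕ} (hd : 4 ≤ d) {A B : Marked} (h : InSplitStep d A B) :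
    splitSize B.graph ≤ splitSize A.graph := by
  obtain ⟨n, m, a, b, h1, h2, h3, h4, h5⟩ := h.sum_eq
  have : splitSize B.graph + _ = splitSize A.graph + _ :=
    h5 fun _ n m => 1 + 2 * ((n - 3) + (m - 3))
  beta_reduce at this
  omega

theorem OutSplitStep.splitSize_le {d : ℕ} (hd : 4 ≤ d) {A B : Marked} (h : OutSplitStep d A B) :
    splitSize B.graph ≤ splitSize A.graph := by
  obtain ⟨n, m, a, b, h1, h2, h3, h4, h5⟩ := h.sum_eq
  have : splitSize B.graph + _ = splitSize A.graph + _ :=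
    h5 fun _ n m => 1 + 2 * ((n - 3) + (m - 3))
  beta_reduce at this
  omega

theorem InitialSplit.splitSize_le {M : MixedGraph} {v : M.V} {B : Marked}
    (h : InitialSplit M v B) : splitSize B.graph ≤ splitSize M + 1 := by
  have : splitSize B.graph + _ = splitSize M + _ :=
    h.sum_eq fun _ n m => 1 + 2 * ((n - 3) + (m - 3))
  beta_reduce at this
  omega

theorem SplittingProcedure.splitSize_le {d : ℕ} (hd : 4 ≤ d) {M M' : MixedGraph} {v : M.V}
    (h : SplittingProcedure d M v M') : splitSize M' ≤ splitSize M + 1 := by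
  obtain ⟨A, B, C, hA, hB, hC, rfl⟩ := h
  refine reflTransGen_invariant (P := fun X : Marked => splitSize X.graph ≤ splitSize M + 1)
    (fun X Y h hX => (h.splitSize_le hd).trans hX) hC.1 ?_
  exact reflTransGen_invariant (P := fun X : Marked => splitSize X.graph ≤ splitSize M + 1)
    (fun X Y h hX => (h.splitSize_le hd).trans hX) hB.1 hA.splitSize_le

/-- The procedure moves one bad vertex into the marked part, leaves the degrees of unmarked vertices
alone, and ends with no bad vertex in the marked part. -/
theorem SplittingProcedure.numBad_lt {d : ℕ} (hd : 4 ≤ d) {M M' : MixedGraph} {v : M.V}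
    (hv : d < M.inDegree v ∨ d < M.outDegree v) (h : SplittingProcedure d M v M') :
    numBad d M' < numBad d M := by
  classical
  obtain ⟨A, B, C, hA, hB, hC, rfl⟩ := h
  -- the bad vertices outside the marked part, and those inside
  let F₀ : Bool → ℕ → ℕ → ℕ := fun b n m => if b then 0 else if d < n ∨ d < m then 1 else 0
  let F₁ : Bool → ℕ → ℕ → ℕ := fun b n _ => if b then (if d < n then 1 else 0) else 0
  have h0 : A.sum F₀ + 1 = numBad d M := by
    have := hA.sum_eq F₀
    have hv' : F₀ false (M.kdeg .inc v) (M.kdeg .out v) = 1 := by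
      simp only [F₀, Bool.false_eq_true, if_false]
      exact if_pos hv
    rw [hv'] at this
    refine this.trans ?_
    simp only [F₀, Marked.sum, numBad]
    simp
  have hB0 : B.sum F₀ = A.sum F₀ := by
    refine reflTransGen_invariant (P := fun X : Marked => X.sum F₀ = A.sum F₀)
      (fun X Y h hX => ?_) hB.1 rfl
    obtain ⟨n, m, a, b, -, -, -, -, h5⟩ := h.sum_eq
    have := h5 F₀
    simp only [F₀, if_true] at this hX ⊢
    omega
  have hB1 : B.sum F₁ = 0 := by
    have : B.sum F₁ ≤ B.graph.total fun _ => 0 := by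
      refine total_mono fun x => ?_
      by_cases hx : x ∈ B.part
      · have := inDegree_le_of_forall_not_inSplitStep hB.2 hx
        simp only [F₁]
        split_ifs <;> omega
      · simp [F₁, hx]
    rw [total_const] at this
    omega
  -- Out-splits do not spoil what the in-splits achieved: the new vertices have in-degree 2 or the
  -- in-degree of the vertex they replace.
  have hC0 : C.sum F₀ = A.sum F₀ ∧ C.sum F₁ = 0 := by
    refine reflTransGen_invariant (P := fun X : Marked => X.sum F₀ = A.sum F₀ ∧ X.sum F₁ = 0)
      (fun X Y h hX => ?_) hC.1 ⟨hB0, hB1⟩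
    obtain ⟨n, m, a, b, -, -, -, -, h5⟩ := h.sum_eq
    have e0 := h5 F₀
    have e1 := h5 F₁
    have : ¬ d < 2 := by omega
    simp only [F₀, F₁, if_true, if_neg this] at e0 e1 hX ⊢
    omega
  have : numBad d C.graph ≤ C.sum F₀ + C.sum F₁ := by
    rw [Marked.sum, Marked.sum, ← total_add]
    refine total_mono fun x => ?_
    by_cases hx : x ∈ C.part
    · have := outDegree_le_of_forall_not_outSplitStep hC.2 hx
      simp only [F₀, F₁, hx, decide_true, if_true]
      split_ifs <;> omega
    · simp only [F₀, F₁, hx, decide_false, Bool.false_eq_true, if_false]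
      omega
  omega

theorem splitStep_terminates {d : ℕ} (hd : 4 ≤ d) : LoopTerminates (SplitStep d) :=
  .of_measure (numBad d) fun _ _ ⟨_, hv, h⟩ => h.numBad_lt hd hv

theorem exists_splittingProcedure {d : ℕ} (hd : 4 ≤ d) (M : MixedGraph) (v : M.V) :
    ∃ M', SplittingProcedure d M v M' := by
  let p : Kind × M.V → Fin 2 := fun x =>
    match x.1 with
    | .inc => 0
    | _ => 1
  obtain ⟨B, hB⟩ := (inSplitStep_terminates hd).exists_runLoop (Marked.replace ⟨M, ∅⟩ v split p)
  obtain ⟨C, hC⟩ := (outSplitStep_terminates hd).exists_runLoop B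
  exact ⟨_, _, B, C, ⟨p, fun _ _ => rfl, fun _ _ => rfl, rfl⟩, hB, hC, rfl⟩

theorem kdeg_le_of_forall_not_splitStep {d : ℕ} (hd : 4 ≤ d) {A : MixedGraph}
    (h : ∀ B, ¬ SplitStep d A B) (v : A.V) : A.kdeg .inc v ≤ d ∧ A.kdeg .out v ≤ d := by
  by_contra hv
  obtain ⟨B, hB⟩ := exists_splittingProcedure hd A v
  refine h B ⟨v, ?_, hB⟩
  change d < A.kdeg .inc v ∨ d < A.kdeg .out v
  omega

/-- The number of vertices after the Splitting Procedure has been performed. -/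
theorem card_le_of_splitSteps {d : ℕ} (hd : 4 ≤ d) {M A : MixedGraph}
    (h : Relation.ReflTransGen (SplitStep d) M A) :
    Nat.card A.V ≤ splitSize M + numBad d M := by
  -- One Splitting Procedure increases `splitSize` by at most 1, through the initial split, and this
  -- is paid for by the loss of a bad vertex.
  have : splitSize A + numBad d A ≤ splitSize M + numBad d M := by
    refine reflTransGen_invariant
      (P := fun X => splitSize X + numBad d X ≤ splitSize M + numBad d M) ?_ h le_rfl
    rintro X Y ⟨v, hv, h⟩ hX
    have := h.numBad_lt hd hv
    have := h.splitSize_le hd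
    omega
  have h1 : A.total (fun _ => 1) ≤ splitSize A := total_mono fun v => by omega
  rw [total_const] at h1
  omega

end HCP

/-! ### Splits preserve Hamiltonicity -/

namespace HCP

open MixedGraph

theorem _root_.MixedGraph.NoUnd.eq_inc {M : MixedGraph} (hM : M.NoUnd) {v : M.V}
    {x : Kind × M.V} (hx : x ∈ M.incident v) (h : x.1 ≠ Kind.out) :
    ∃ u, x = (Kind.inc, u) ∧ M.Arc u v := by
  obtain ⟨k, u⟩ := x
  cases k
  · exact ⟨u, rfl, hx⟩
  · exact absurd rfl h
  · exact absurd hx (hM _ _)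

theorem _root_.MixedGraph.NoUnd.eq_out {M : MixedGraph} (hM : M.NoUnd) {v : M.V}
    {x : Kind × M.V} (hx : x ∈ M.incident v) (h : x.1 ≠ Kind.inc) :
    ∃ u, x = (Kind.out, u) ∧ M.Arc v u := by
  obtain ⟨k, u⟩ := x
  cases k
  · exact absurd rfl h
  · exact ⟨u, rfl, hx⟩
  · exact absurd hx (hM _ _)

/-- Every passage enters at the first vertex, so the weight 1 is put there; the only traversal
needed is the arc itself. -/
theorem InitialSplit.ham_iff {M : MixedGraph} {v : M.V} {B : Marked} (hM : M.NoUnd)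
    (hv : ∃ u, u ≠ v) (h : InitialSplit M v B) : B.graph.Ham ↔ M.Ham := by
  obtain ⟨p, h1, h2, rfl⟩ := h
  constructor
  · refine Ham.of_replace_of_weight (H := split) (p := p)
      (fun x : Fin 2 => ![1, 0] x) (fun x : Fin 2 => ![1, 0] x) ?_ ?_ ?_ ?_ hv
    · exact (by decide : ∑ x : Fin 2, (![1, 0] x : ℤ) = 1)
    · rintro x y (hxy | hxy)
      · obtain ⟨rfl, rfl⟩ := Prod.mk.inj hxy
        rfl
      · exact absurd hxy (split_noUnd _ _)
    · intro x hx hx'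
      obtain ⟨u, rfl, hu⟩ := hM.eq_inc hx hx'
      rw [h1 u hu]
      rfl
    · intro x hx hx'
      obtain ⟨u, rfl, hu⟩ := hM.eq_out hx hx'
      rw [h2 u hu]
  · refine Ham.replace (H := split) (p := p) ?_ (Or.inl fun w => hM _ _)
    intro x hx y hy _ hx' hy'
    obtain ⟨u, rfl, hu⟩ := hM.eq_inc hx hx'
    obtain ⟨w, rfl, hw⟩ := hM.eq_out hy hy'
    rw [h1 u hu, h2 w hw]
    refine ⟨([0, 1] : List (Fin 2)), (by decide : ([0, 1] : List (Fin 2)).Nodup),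
      (by decide : ∀ v : Fin 2, v ∈ [0, 1]), ?_, rfl, rfl⟩
    exact List.isChain_pair.2 (Or.inl rfl)

/-- Every passage leaves from the third vertex, which has no outgoing edge inside the in-split. All
the weight is put on it, so the weight still to come is 1 everywhere. From either entrance the other
one can be visited before the exit. -/
theorem InSplitStep.ham_iff {d : ℕ} {A B : Marked} (hA : A.graph.NoUnd)
    (h : InSplitStep d A B) : B.graph.Ham ↔ A.graph.Ham := by
  obtain ⟨v, hv, p, hd, h1, -, -, h2, rfl⟩ := h
  have hv : ∃ u, u ≠ v := exists_ne_of_degree_pos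
    (((Nat.zero_le d).trans_lt hd).trans_le (A.graph.kdeg_le_degree .inc v))
  constructor
  · refine Ham.of_replace_of_weight (H := inSplit) (p := p)
      (fun x : Fin 3 => ![0, 0, 1] x) (fun _ : Fin 3 => 1) ?_ ?_ ?_ ?_ hv
    · exact (by decide : ∑ x : Fin 3, (![0, 0, 1] x : ℤ) = 1)
    · rintro x y (hxy | hxy)
      · revert x y
        exact (by decide : ∀ x y : Fin 3,
          (x, y) ∈ ([(0, 1), (0, 2), (1, 0), (1, 2)] : List (Fin 3 × Fin 3)) →
            (1 : ℤ) = ![0, 0, 1] x + 1)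
      · exact absurd hxy (inSplit_noUnd _ _)
    · intro x hx hx'
      rfl
    · intro x hx hx'
      obtain ⟨u, rfl, hu⟩ := hA.eq_out hx hx'
      rw [h2 u hu]
      rfl
  · refine Ham.replace (H := inSplit) (p := p) ?_ (Or.inl fun w => hA _ _)
    intro x hx y hy _ hx' hy'
    obtain ⟨u, rfl, hu⟩ := hA.eq_inc hx hx'
    obtain ⟨w, rfl, hw⟩ := hA.eq_out hy hy'
    rw [h2 w hw]
    rcases h1 u hu with h | h <;> rw [h]
    · refine ⟨([0, 1, 2] : List (Fin 3)), (by decide : ([0, 1, 2] : List (Fin 3)).Nodup),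
        (by decide : ∀ v : Fin 3, v ∈ [0, 1, 2]), ?_, rfl, rfl⟩
      refine (by decide : ([0, 1, 2] : List (Fin 3)).IsChain fun x y => (x, y) ∈
        ([(0, 1), (0, 2), (1, 0), (1, 2)] : List (Fin 3 × Fin 3))).imp fun x y h => Or.inl h
    · refine ⟨([1, 0, 2] : List (Fin 3)), (by decide : ([1, 0, 2] : List (Fin 3)).Nodup),
        (by decide : ∀ v : Fin 3, v ∈ [1, 0, 2]), ?_, rfl, rfl⟩
      refine (by decide : ([1, 0, 2] : List (Fin 3)).IsChain fun x y => (x, y) ∈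
        ([(0, 1), (0, 2), (1, 0), (1, 2)] : List (Fin 3 × Fin 3))).imp fun x y h => Or.inl h

/-- Dual to the in-split: every passage enters at the first vertex, which carries all the weight and
cannot be reached from inside. -/
theorem OutSplitStep.ham_iff {d : ℕ} {A B : Marked} (hA : A.graph.NoUnd)
    (h : OutSplitStep d A B) : B.graph.Ham ↔ A.graph.Ham := by
  obtain ⟨v, hv, p, hd, h2, h1, -, -, rfl⟩ := h
  have hv : ∃ u, u ≠ v := exists_ne_of_degree_pos
    (((Nat.zero_le d).trans_lt hd).trans_le (A.graph.kdeg_le_degree .out v))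
  constructor
  · refine Ham.of_replace_of_weight (H := outSplit) (p := p)
      (fun x : Fin 3 => ![1, 0, 0] x) (fun x : Fin 3 => ![1, 0, 0] x) ?_ ?_ ?_ ?_ hv
    · exact (by decide : ∑ x : Fin 3, (![1, 0, 0] x : ℤ) = 1)
    · rintro x y (hxy | hxy)
      · revert x y
        exact (by decide : ∀ x y : Fin 3,
          (x, y) ∈ ([(0, 1), (0, 2), (1, 2), (2, 1)] : List (Fin 3 × Fin 3)) →
            (![1, 0, 0] x : ℤ) = ![1, 0, 0] x + ![1, 0, 0] y)
      · exact absurd hxy (outSplit_noUnd _ _)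
    · intro x hx hx'
      obtain ⟨u, rfl, hu⟩ := hA.eq_inc hx hx'
      rw [h2 u hu]
      rfl
    · intro x hx hx'
      rfl
  · refine Ham.replace (H := outSplit) (p := p) ?_ (Or.inl fun w => hA _ _)
    intro x hx y hy _ hx' hy'
    obtain ⟨u, rfl, hu⟩ := hA.eq_inc hx hx'
    obtain ⟨w, rfl, hw⟩ := hA.eq_out hy hy'
    rw [h2 u hu]
    rcases h1 w hw with h | h <;> rw [h]
    · refine ⟨([0, 2, 1] : List (Fin 3)), (by decide : ([0, 2, 1] : List (Fin 3)).Nodup),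
        (by decide : ∀ v : Fin 3, v ∈ [0, 2, 1]), ?_, rfl, rfl⟩
      refine (by decide : ([0, 2, 1] : List (Fin 3)).IsChain fun x y => (x, y) ∈
        ([(0, 1), (0, 2), (1, 2), (2, 1)] : List (Fin 3 × Fin 3))).imp fun x y h => Or.inl h
    · refine ⟨([0, 1, 2] : List (Fin 3)), (by decide : ([0, 1, 2] : List (Fin 3)).Nodup),
        (by decide : ∀ v : Fin 3, v ∈ [0, 1, 2]), ?_, rfl, rfl⟩
      refine (by decide : ([0, 1, 2] : List (Fin 3)).IsChain fun x y => (x, y) ∈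
        ([(0, 1), (0, 2), (1, 2), (2, 1)] : List (Fin 3 × Fin 3))).imp fun x y h => Or.inl h

/-- The Splitting Procedure preserves Hamiltonicity, and it keeps isolated vertices. -/
theorem SplitStep.invariant {d : ℕ} {M M' : MixedGraph} (hM : M.NoUnd)
    (h : SplitStep d M M') : M'.NoUnd ∧ (M'.Ham ↔ M.Ham) ∧
      ((∃ v, M.degree v ≤ 0) → ∃ v, M'.degree v ≤ 0) := by
  obtain ⟨v, hv, A, B, C, hA, hB, hC, rfl⟩ := h
  let P : Marked → Prop := fun X => X.graph.NoUnd ∧ (X.graph.Ham ↔ M.Ham) ∧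
    ((∃ v, M.degree v ≤ 0) → ∃ v, X.graph.degree v ≤ 0)
  have hvd : 0 < M.degree v := by
    rcases hv with hv | hv
    · exact ((Nat.zero_le d).trans_lt hv).trans_le (M.kdeg_le_degree .inc v)
    · exact ((Nat.zero_le d).trans_lt hv).trans_le (M.kdeg_le_degree .out v)
  have hPA : P A := by
    refine ⟨?_, hA.ham_iff hM (exists_ne_of_degree_pos hvd), ?_⟩
    · obtain ⟨p, -, -, rfl⟩ := hA
      exact hM.replace split_noUnd
    · obtain ⟨p, -, -, rfl⟩ := hA
      exact fun h => exists_degree_le_replace h hvd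
  have hPB : P B := by
    refine reflTransGen_invariant (P := P) ?_ hB.1 hPA
    rintro X Y hXY ⟨h1, h2, h3⟩
    refine ⟨?_, (hXY.ham_iff h1).trans h2, ?_⟩
    · obtain ⟨v, -, p, -, -, -, -, -, rfl⟩ := hXY
      exact h1.replace inSplit_noUnd
    · obtain ⟨v, -, p, hv, -, -, -, -, rfl⟩ := hXY
      exact fun h => exists_degree_le_replace (h3 h)
        (((Nat.zero_le d).trans_lt hv).trans_le (X.graph.kdeg_le_degree .inc v))
  refine reflTransGen_invariant (P := P) ?_ hC.1 hPB
  rintro X Y hXY ⟨h1, h2, h3⟩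
  refine ⟨?_, (hXY.ham_iff h1).trans h2, ?_⟩
  · obtain ⟨v, -, p, -, -, -, -, -, rfl⟩ := hXY
    exact h1.replace outSplit_noUnd
  · obtain ⟨v, -, p, hv, -, -, -, -, rfl⟩ := hXY
    exact fun h => exists_degree_le_replace (h3 h)
      (((Nat.zero_le d).trans_lt hv).trans_le (X.graph.kdeg_le_degree .out v))

theorem splitSteps_invariant {d : ℕ} {M A : MixedGraph} (hM : M.NoUnd)
    (h : Relation.ReflTransGen (SplitStep d) M A) : A.NoUnd ∧ (A.Ham ↔ M.Ham) ∧
      ((∃ v, M.degree v ≤ 0) → ∃ v, A.degree v ≤ 0) := by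
  refine reflTransGen_invariant (P := fun X => X.NoUnd ∧ (X.Ham ↔ M.Ham) ∧
    ((∃ v, M.degree v ≤ 0) → ∃ v, X.degree v ≤ 0)) ?_ h ⟨hM, Iff.rfl, id⟩
  rintro X Y hXY ⟨h1, h2, h3⟩
  obtain ⟨e1, e2, e3⟩ := hXY.invariant h1
  exact ⟨e1, e2.trans h2, fun h => e3 (h3 h)⟩

end HCP

/-! ## Gates -/

/-- `l` is a path from `a` to `b`. -/
def IsPathList {V : Type*} (R : V → V → Prop) (l : List V) (a b : V) : Prop :=
  l.IsChain R ∧ l.head? = some a ∧ l.getLast? = some b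

theorem IsPathList.append {V : Type*} {R : V → V → Prop} {l₁ l₂ : List V} {a b c e : V}
    (h₁ : IsPathList R l₁ a b) (h : R b c) (h₂ : IsPathList R l₂ c e) :
    IsPathList R (l₁ ++ l₂) a e := by
  refine ⟨List.isChain_append.2 ⟨h₁.1, h₂.1, ?_⟩, by simp [h₁.2.1], by simp [h₂.2.2]⟩
  rw [h₁.2.2, h₂.2.1]
  simpa using h

theorem IsPathList.reverse {V : Type*} {R : V → V → Prop} (hR : ∀ a b, R a b → R b a)
    {l : List V} {a b : V} (h : IsPathList R l a b) : IsPathList R l.reverse b a := by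
  refine ⟨?_, by simpa using h.2.2, by simpa using h.2.1⟩
  rw [List.isChain_reverse]
  exact h.1.imp fun a b h => hR _ _ h

/-- A list that contains every vertex and has as many entries as there are vertices has no
repetitions, so distinctness is obtained by counting lengths. -/
theorem IsPathList.hasTraversal {V : Type*} [Fintype V] {R : V → V → Prop} {l : List V} {a b : V}
    (h : IsPathList R l a b) (hmem : ∀ v, v ∈ l) (hlen : l.length = Fintype.card V) :
    HasTraversal R a b := by
  classical
  refine ⟨l, ?_, hmem, h⟩
  have : l.toFinset = Finset.univ := Finset.eq_univ_of_forall fun z => List.mem_toFinset.2 (hmem z)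
  rw [← List.dedup_eq_self]
  refine List.Sublist.eq_of_length (List.dedup_sublist l) ?_
  rw [← List.card_toFinset, this, Finset.card_univ, hlen]

namespace HCP

open MixedGraph

variable {s : ℕ}

instance (s : ℕ) : Fintype (gate s).V := inferInstanceAs (Fintype (Fin 10 ⊕ Fin (2 * s - 7)))

theorem card_gate (s : ℕ) : Fintype.card (gate s).V = 10 + (2 * s - 7) := by
  have : Fintype.card (gate s).V = Fintype.card (Fin 10 ⊕ Fin (2 * s - 7)) := rfl
  rw [this, Fintype.card_sum, Fintype.card_fin, Fintype.card_fin]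

/-- The vertices of the gate with a fixed label. -/
def top (a : Fin 10) : (gate s).V := (Sum.inl a : Fin 10 ⊕ Fin (2 * s - 7))

/-- The vertices of the bottom row of the gate. -/
def bot (j : Fin (2 * s - 7)) : (gate s).V := (Sum.inr j : Fin 10 ⊕ Fin (2 * s - 7))

theorem gate_cases (x : (gate s).V) : (∃ a, x = top a) ∨ ∃ j, x = bot j := by
  rcases x with a | j
  · exact Or.inl ⟨a, rfl⟩
  · exact Or.inr ⟨j, rfl⟩

theorem gate_adj_iff {x y : (gate s).V} :
    (gate s).adj x y ↔ x ≠ y ∧ (gateRel s x y ∨ gateRel s y x) :=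
  ⟨fun h => h.resolve_left id, Or.inr⟩

theorem gate_adj_symm (x y : (gate s).V) (h : (gate s).adj x y) : (gate s).adj y x := by
  rw [gate_adj_iff] at h ⊢
  exact ⟨h.1.symm, h.2.symm⟩

theorem total_gate (f : (gate s).V → ℕ) :
    (gate s).total f = ∑ a : Fin 10, f (top a) + ∑ j : Fin (2 * s - 7), f (bot j) := by
  rw [total_eq_sum]
  exact Fintype.sum_sum_type f

/-! ### The gate is bipartite -/

/-- The colour classes of the gate, in one of which are all vertices with external edges. -/
def gateColor (s : ℕ) (x : (gate s).V) : ℤ :=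
  Sum.elim (fun a : Fin 10 => ![1, 1, 0, 1, 0, 0, 1, 0, 1, 0] a)
    (fun j : Fin (2 * s - 7) => if Even j.val then 1 else 0) x

theorem gateColor_add_of_gateRel (hs : 4 ≤ s) {x y : (gate s).V} (h : gateRel s x y) :
    gateColor s x + gateColor s y = 1 := by
  rcases x with a | j <;> rcases y with b | k
  · have : ∀ a b : Fin 10, (a.val + 1, b.val + 1) ∈
      ([(1, 3), (1, 8), (2, 3), (2, 5), (3, 4), (4, 5), (4, 6), (6, 7), (7, 8), (7, 10), (8, 9),
        (9, 10)] : List (ℕ × ℕ)) → (![1, 1, 0, 1, 0, 0, 1, 0, 1, 0] a : ℤ) +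
          ![1, 1, 0, 1, 0, 0, 1, 0, 1, 0] b = 1 := by decide
    exact this a b h
  · simp only [gateColor, Sum.elim_inl, Sum.elim_inr]
    rcases h with ⟨h1, h2⟩ | ⟨h1, h2⟩ | ⟨h1, h2⟩
    · obtain rfl : a = 4 := Fin.ext (by simpa using h1)
      simp [h2]
    · obtain rfl : a = 9 := Fin.ext (by simpa using h1)
      have : Even k.val := ⟨s - 4, by omega⟩
      simp [this]
    · obtain rfl : a = 0 := Fin.ext (by simpa using h1)
      simp [Nat.not_even_iff_odd.2 h2]
  · exact absurd h id
  · have h : j.val + 1 = k.val := h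
    simp only [gateColor, Sum.elim_inr, ← h, Nat.even_add_one]
    by_cases hj : Even j.val <;> simp [hj]

theorem gateColor_add_of_adj (hs : 4 ≤ s) {x y : (gate s).V} (h : (gate s).adj x y) :
    gateColor s x + gateColor s y = 1 := by
  rcases (gate_adj_iff.1 h).2 with h | h
  · exact gateColor_add_of_gateRel hs h
  · rw [add_comm]
    exact gateColor_add_of_gateRel hs h

/-- Five of the ten labelled vertices have each colour, and the bottom row is an alternating path of
odd length that starts and ends in colour 1. Hence colour 1 is in excess by one. -/
theorem sum_gateColor (hs : 4 ≤ s) : ∑ x, (2 * gateColor s x - 1) = 1 := by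
  have : ∑ x, (2 * gateColor s x - 1) = ∑ x : Fin 10 ⊕ Fin (2 * s - 7), (2 * gateColor s x - 1) :=
    rfl
  rw [this, Fintype.sum_sum_type]
  have h1 : ∑ a : Fin 10, (2 * gateColor s (Sum.inl a : Fin 10 ⊕ Fin (2 * s - 7)) - 1) = 0 :=
    (by decide : ∑ a : Fin 10, (2 * (![1, 1, 0, 1, 0, 0, 1, 0, 1, 0] a : ℤ) - 1) = 0)
  have h2 : ∀ j : Fin (2 * s - 7),
      2 * gateColor s (Sum.inr j : Fin 10 ⊕ Fin (2 * s - 7)) - 1 = (-1) ^ j.val := by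
    intro j
    simp only [gateColor, Sum.elim_inr]
    by_cases hj : Even j.val
    · simp [hj, hj.neg_one_pow]
    · simp [hj, (Nat.not_even_iff_odd.1 hj).neg_one_pow]
  rw [h1, Finset.sum_congr rfl fun j _ => h2 j, Fin.sum_univ_eq_sum_range (fun j => (-1 : ℤ) ^ j),
    neg_one_geom_sum]
  have : ¬ Even (2 * s - 7) := by
    rw [Nat.not_even_iff_odd]
    exact ⟨s - 4, by omega⟩
  simp [this]

theorem gateColor_external {x : (gate s).V} (hx : x ∈ gateExternal s) : gateColor s x = 1 := by
  rcases x with a | j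
  · have : ∀ a : Fin 10, (a.val + 1 = 1 ∨ a.val + 1 = 2 ∨ a.val + 1 = 9) →
      (![1, 1, 0, 1, 0, 0, 1, 0, 1, 0] a : ℤ) = 1 := by decide
    exact this a hx
  · exact if_pos hx

/-! ### Traversals of the gate -/

/-- The vertices of the bottom row, indexed by natural numbers. -/
def nbot (hs : 4 ≤ s) (j : ℕ) : (gate s).V :=
  bot ⟨j % (2 * s - 7), Nat.mod_lt _ (by omega)⟩

theorem nbot_eq (hs : 4 ≤ s) {j : ℕ} (hj : j < 2 * s - 7) : nbot hs j = bot ⟨j, hj⟩ := by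
  simp only [nbot, Nat.mod_eq_of_lt hj]

theorem bot_eq_nbot (hs : 4 ≤ s) (j : Fin (2 * s - 7)) : bot j = nbot hs j := (nbot_eq hs j.2).symm

theorem adj_top_top {a b : Fin 10} (h : a ≠ b ∧ ((a.val + 1, b.val + 1) ∈
    ([(1, 3), (1, 8), (2, 3), (2, 5), (3, 4), (4, 5), (4, 6), (6, 7), (7, 8), (7, 10), (8, 9),
        (9, 10)] : List (ℕ × ℕ)) ∨ (b.val + 1, a.val + 1) ∈
    ([(1, 3), (1, 8), (2, 3), (2, 5), (3, 4), (4, 5), (4, 6), (6, 7), (7, 8), (7, 10), (8, 9),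
        (9, 10)] : List (ℕ × ℕ)))) : (gate s).adj (top a) (top b) :=
  gate_adj_iff.2 ⟨fun hab => h.1 (Sum.inl_injective hab), h.2⟩

theorem adj_top_bot {a : Fin 10} {j : Fin (2 * s - 7)} :
    (gate s).adj (top a) (bot j) ↔
      (a = 4 ∧ j.val = 0) ∨ (a = 9 ∧ j.val + 1 = 2 * s - 7) ∨ (a = 0 ∧ Odd j.val) := by
  have h : (gate s).adj (top a) (bot j) ↔ (a.val + 1 = 5 ∧ j.val = 0) ∨
      (a.val + 1 = 10 ∧ j.val + 1 = 2 * s - 7) ∨ (a.val + 1 = 1 ∧ Odd j.val) := by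
    rw [gate_adj_iff]
    exact ⟨fun h => h.2.resolve_right id, fun h => ⟨Sum.inl_ne_inr, Or.inl h⟩⟩
  rw [h]
  simp only [Fin.ext_iff]
  simp

theorem adj_bot_bot {j k : Fin (2 * s - 7)} :
    (gate s).adj (bot j) (bot k) ↔ j.val + 1 = k.val ∨ k.val + 1 = j.val := by
  rw [gate_adj_iff]
  refine ⟨fun h => h.2, fun h => ⟨fun hjk => ?_, h⟩⟩
  have : j = k := Sum.inr_injective hjk
  omega

theorem adj_four_nbot (hs : 4 ≤ s) : (gate s).adj (top 4) (nbot hs 0) := by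
  rw [nbot_eq hs (by omega), adj_top_bot]
  simp

theorem adj_nine_nbot (hs : 4 ≤ s) : (gate s).adj (top 9) (nbot hs (2 * s - 7 - 1)) := by
  rw [nbot_eq hs (by omega), adj_top_bot]
  right; left
  exact ⟨rfl, by dsimp only; omega⟩

theorem adj_zero_nbot (hs : 4 ≤ s) {j : ℕ} (hj : j < 2 * s - 7) (ho : Odd j) :
    (gate s).adj (top 0) (nbot hs j) := by
  rw [nbot_eq hs hj, adj_top_bot]
  exact Or.inr (Or.inr ⟨rfl, ho⟩)

/-- A part of the bottom row. -/
def rowUp (hs : 4 ≤ s) (a b : ℕ) : List (gate s).V := (List.range' a (b - a)).map (nbot hs)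

/-- A part of the bottom row, in reverse order. -/
def rowDown (hs : 4 ≤ s) (a b : ℕ) : List (gate s).V := (rowUp hs a b).reverse

theorem isPathList_rowUp (hs : 4 ≤ s) {a b : ℕ} (hab : a < b) (hb : b ≤ 2 * s - 7) :
    IsPathList (gate s).adj (rowUp hs a b) (nbot hs a) (nbot hs (b - 1)) := by
  obtain ⟨n, rfl⟩ : ∃ n, b = a + n + 1 := ⟨b - a - 1, by omega⟩
  have h1 : a + n + 1 - a = n + 1 := by omega
  refine ⟨?_, ?_, ?_⟩
  · rw [rowUp, List.isChain_map, h1]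
    have := List.isChain_range' a (n + 1) 1
    refine this.imp_of_mem_imp fun x y hx hy hxy => ?_
    rw [List.mem_range'_1] at hx hy
    rw [nbot_eq hs (by omega), nbot_eq hs (by omega), adj_bot_bot]
    exact Or.inl hxy.symm
  · rw [rowUp, h1]
    refine head?_map_of_eq ?_
    simp [List.range'_succ]
  · rw [rowUp, h1]
    refine getLast?_map_of_eq ?_
    simp [List.range'_concat]

theorem isPathList_rowDown (hs : 4 ≤ s) {a b : ℕ} (hab : a < b) (hb : b ≤ 2 * s - 7) :
    IsPathList (gate s).adj (rowDown hs a b) (nbot hs (b - 1)) (nbot hs a) :=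
  (isPathList_rowUp hs hab hb).reverse gate_adj_symm

theorem isPathList_top {l : List (Fin 10)} {a b : Fin 10} (h : l.IsChain fun a b : Fin 10 =>
    a ≠ b ∧ ((a.val + 1, b.val + 1) ∈
    ([(1, 3), (1, 8), (2, 3), (2, 5), (3, 4), (4, 5), (4, 6), (6, 7), (7, 8), (7, 10), (8, 9),
        (9, 10)] : List (ℕ × ℕ)) ∨ (b.val + 1, a.val + 1) ∈
    ([(1, 3), (1, 8), (2, 3), (2, 5), (3, 4), (4, 5), (4, 6), (6, 7), (7, 8), (7, 10), (8, 9),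
        (9, 10)] : List (ℕ × ℕ)))) (ha : l.head? = some a) (hb : l.getLast? = some b) :
    IsPathList (gate s).adj (l.map top) (top a) (top b) := by
  refine ⟨?_, head?_map_of_eq ha, getLast?_map_of_eq hb⟩
  rw [List.isChain_map]
  exact h.imp fun a b h => adj_top_top h

theorem length_rowUp (hs : 4 ≤ s) (a b : ℕ) : (rowUp hs a b).length = b - a := by
  simp [rowUp]

theorem length_rowDown (hs : 4 ≤ s) (a b : ℕ) : (rowDown hs a b).length = b - a := by
  simp [rowDown, rowUp]

theorem bot_mem_rowUp (hs : 4 ≤ s) {a b : ℕ} {j : Fin (2 * s - 7)} (h : a ≤ j.val ∧ j.val < b) :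
    bot j ∈ rowUp hs a b := by
  rw [bot_eq_nbot hs]
  exact List.mem_map_of_mem (List.mem_range'_1.2 ⟨h.1, by omega⟩)

theorem bot_mem_rowDown (hs : 4 ≤ s) {a b : ℕ} {j : Fin (2 * s - 7)} (h : a ≤ j.val ∧ j.val < b) :
    bot j ∈ rowDown hs a b :=
  List.mem_reverse.2 (bot_mem_rowUp hs h)

theorem gate_hasTraversal {a b : (gate s).V} {l : List (gate s).V}
    (h : IsPathList (gate s).adj l a b) (h1 : ∀ a, top a ∈ l) (h2 : ∀ j, bot j ∈ l)
    (h3 : l.length = 10 + (2 * s - 7)) : HasTraversal (gate s).adj a b := by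
  refine h.hasTraversal (fun v => ?_) (by rw [h3, card_gate])
  rcases gate_cases v with ⟨a, rfl⟩ | ⟨j, rfl⟩
  · exact h1 a
  · exact h2 j

theorem forall_top_mem {l : List (gate s).V} {t : List (Fin 10)} (ht : ∀ a, a ∈ t)
    (hl : ∀ a ∈ t, top a ∈ l) (a : Fin 10) : top a ∈ l := hl a (ht a)

theorem traversal_zero_one (hs : 4 ≤ s) : HasTraversal (gate s).adj (top 0) (top 1) := by
  refine gate_hasTraversal (l := [0, 2, 3, 5, 6, 7, 8, 9].map top ++
    (rowDown hs 0 (2 * s - 7) ++ [4, 1].map top)) ?_ ?_ ?_ ?_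
  · refine (isPathList_top (by decide) rfl rfl).append (adj_nine_nbot hs) ?_
    exact (isPathList_rowDown hs (by omega) le_rfl).append (gate_adj_symm _ _ (adj_four_nbot hs))
      (isPathList_top (by decide) rfl rfl)
  · exact forall_top_mem (t := [0, 2, 3, 5, 6, 7, 8, 9] ++ [4, 1]) (by decide) (by simp)
  · intro j
    have := j.2
    simp only [List.mem_append]
    exact Or.inr (Or.inl (bot_mem_rowDown hs (by omega)))
  · simp only [List.length_append, List.length_map, length_rowDown, List.length_cons,
      List.length_nil]
    omega

theorem traversal_zero_eight (hs : 4 ≤ s) : HasTraversal (gate s).adj (top 0) (top 8) := by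
  refine gate_hasTraversal (l := [0, 7, 6, 5, 3, 2, 1, 4].map top ++
    (rowUp hs 0 (2 * s - 7) ++ [9, 8].map top)) ?_ ?_ ?_ ?_
  · refine (isPathList_top (by decide) rfl rfl).append (adj_four_nbot hs) ?_
    exact (isPathList_rowUp hs (by omega) le_rfl).append (gate_adj_symm _ _ (adj_nine_nbot hs))
      (isPathList_top (by decide) rfl rfl)
  · exact forall_top_mem (t := [0, 7, 6, 5, 3, 2, 1, 4] ++ [9, 8]) (by decide) (by simp)
  · intro j
    have := j.2
    simp only [List.mem_append]
    exact Or.inr (Or.inl (bot_mem_rowUp hs (by omega)))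
  · simp only [List.length_append, List.length_map, length_rowUp, List.length_cons,
      List.length_nil]
    omega

theorem traversal_one_eight (hs : 4 ≤ s) : HasTraversal (gate s).adj (top 1) (top 8) := by
  refine gate_hasTraversal (l := [1, 4].map top ++
    (rowUp hs 0 (2 * s - 7) ++ [9, 6, 5, 3, 2, 0, 7, 8].map top)) ?_ ?_ ?_ ?_
  · refine (isPathList_top (by decide) rfl rfl).append (adj_four_nbot hs) ?_
    exact (isPathList_rowUp hs (by omega) le_rfl).append (gate_adj_symm _ _ (adj_nine_nbot hs))
      (isPathList_top (by decide) rfl rfl)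
  · exact forall_top_mem (t := [1, 4] ++ [9, 6, 5, 3, 2, 0, 7, 8]) (by decide) (by simp)
  · intro j
    have := j.2
    simp only [List.mem_append]
    exact Or.inr (Or.inl (bot_mem_rowUp hs (by omega)))
  · simp only [List.length_append, List.length_map, length_rowUp, List.length_cons,
      List.length_nil]
    omega

/-- The row is swept in two pieces that meet at `i`: from the vertex labelled 1 jump to the position
before `i`, which is odd and hence adjacent to it, sweep left, return through the labelled vertices
to 10, and sweep from the right end down to `i`. For `i = 0` the left piece is empty, and all
labelled vertices are visited first. The next two lemmas vary this pattern. -/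
theorem traversal_zero_row (hs : 4 ≤ s) {i : ℕ} (hi : i < 2 * s - 7) (he : Even i) :
    HasTraversal (gate s).adj (top 0) (nbot hs i) := by
  rcases Nat.eq_zero_or_pos i with rfl | hi0
  · refine gate_hasTraversal (l := [0, 2, 1, 4, 3, 5, 6, 7, 8, 9].map top ++
      rowDown hs 0 (2 * s - 7)) ?_ ?_ ?_ ?_
    · exact (isPathList_top (by decide) rfl rfl).append (adj_nine_nbot hs)
        (isPathList_rowDown hs (by omega) le_rfl)
    · exact forall_top_mem (t := [0, 2, 1, 4, 3, 5, 6, 7, 8, 9]) (by decide) (by simp)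
    · intro j
      have := j.2
      simp only [List.mem_append]
      exact Or.inr (bot_mem_rowDown hs (by omega))
    · simp only [List.length_append, List.length_map, length_rowDown, List.length_cons,
        List.length_nil]
      omega
  · have ho : Odd (i - 1) := Nat.Even.sub_odd hi0 he odd_one
    refine gate_hasTraversal (l := [0].map top ++ (rowDown hs 0 i ++
      ([4, 1, 2, 3, 5, 6, 7, 8, 9].map top ++ rowDown hs i (2 * s - 7)))) ?_ ?_ ?_ ?_
    · refine (isPathList_top (by decide) rfl rfl).append (adj_zero_nbot hs (by omega) ho) ?_
      refine (isPathList_rowDown hs hi0 hi.le).append (gate_adj_symm _ _ (adj_four_nbot hs)) ?_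
      exact (isPathList_top (by decide) rfl rfl).append (adj_nine_nbot hs)
        (isPathList_rowDown hs (by omega) le_rfl)
    · exact forall_top_mem (t := [0] ++ [4, 1, 2, 3, 5, 6, 7, 8, 9]) (by decide) (by simp)
    · intro j
      have := j.2
      simp only [List.mem_append]
      rcases Nat.lt_or_ge j.val i with h | h
      · exact Or.inr (Or.inl (bot_mem_rowDown hs (by omega)))
      · exact Or.inr (Or.inr (Or.inr (bot_mem_rowDown hs (by omega))))
    · simp only [List.length_append, List.length_map, length_rowDown, List.length_cons,
        List.length_nil]
      omega

theorem traversal_one_row (hs : 4 ≤ s) {i : ℕ} (hi : i < 2 * s - 7) (he : Even i) :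
    HasTraversal (gate s).adj (top 1) (nbot hs i) := by
  -- Here the right piece is swept first, starting at the odd position `i + 1`; it is empty when `i`
  -- is the last position.
  rcases Nat.lt_or_ge (i + 1) (2 * s - 7) with hi1 | hi1
  · refine gate_hasTraversal (l := [1, 2, 0].map top ++ (rowUp hs (i + 1) (2 * s - 7) ++
      ([9, 8, 7, 6, 5, 3, 4].map top ++ rowUp hs 0 (i + 1)))) ?_ ?_ ?_ ?_
    · refine (isPathList_top (by decide) rfl rfl).append (adj_zero_nbot hs hi1 he.add_one) ?_
      refine (isPathList_rowUp hs hi1 le_rfl).append (gate_adj_symm _ _ (adj_nine_nbot hs)) ?_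
      exact (isPathList_top (by decide) rfl rfl).append (adj_four_nbot hs)
        (isPathList_rowUp hs (by omega) hi)
    · exact forall_top_mem (t := [1, 2, 0] ++ [9, 8, 7, 6, 5, 3, 4]) (by decide) (by simp)
    · intro j
      have := j.2
      simp only [List.mem_append]
      rcases Nat.lt_or_ge j.val (i + 1) with h | h
      · exact Or.inr (Or.inr (Or.inr (bot_mem_rowUp hs (by omega))))
      · exact Or.inr (Or.inl (bot_mem_rowUp hs (by omega)))
    · simp only [List.length_append, List.length_map, length_rowUp, List.length_cons,
        List.length_nil]
      omega
  · obtain rfl : i = 2 * s - 7 - 1 := by omega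
    refine gate_hasTraversal (l := [1, 2, 0, 7, 8, 9, 6, 5, 3, 4].map top ++
      rowUp hs 0 (2 * s - 7)) ?_ ?_ ?_ ?_
    · exact (isPathList_top (by decide) rfl rfl).append (adj_four_nbot hs)
        (isPathList_rowUp hs (by omega) le_rfl)
    · exact forall_top_mem (t := [1, 2, 0, 7, 8, 9, 6, 5, 3, 4]) (by decide) (by simp)
    · intro j
      have := j.2
      simp only [List.mem_append]
      exact Or.inr (bot_mem_rowUp hs (by omega))
    · simp only [List.length_append, List.length_map, length_rowUp, List.length_cons,
        List.length_nil]
      omega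

theorem traversal_eight_row (hs : 4 ≤ s) {i : ℕ} (hi : i < 2 * s - 7) (he : Even i) :
    HasTraversal (gate s).adj (top 8) (nbot hs i) := by
  rcases Nat.eq_zero_or_pos i with rfl | hi0
  · refine gate_hasTraversal (l := [8, 7, 0, 2, 1, 4, 3, 5, 6, 9].map top ++
      rowDown hs 0 (2 * s - 7)) ?_ ?_ ?_ ?_
    · exact (isPathList_top (by decide) rfl rfl).append (adj_nine_nbot hs)
        (isPathList_rowDown hs (by omega) le_rfl)
    · exact forall_top_mem (t := [8, 7, 0, 2, 1, 4, 3, 5, 6, 9]) (by decide) (by simp)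
    · intro j
      have := j.2
      simp only [List.mem_append]
      exact Or.inr (bot_mem_rowDown hs (by omega))
    · simp only [List.length_append, List.length_map, length_rowDown, List.length_cons,
        List.length_nil]
      omega
  · have ho : Odd (i - 1) := Nat.Even.sub_odd hi0 he odd_one
    refine gate_hasTraversal (l := [8, 7, 0].map top ++ (rowDown hs 0 i ++
      ([4, 1, 2, 3, 5, 6, 9].map top ++ rowDown hs i (2 * s - 7)))) ?_ ?_ ?_ ?_
    · refine (isPathList_top (by decide) rfl rfl).append (adj_zero_nbot hs (by omega) ho) ?_
      refine (isPathList_rowDown hs hi0 hi.le).append (gate_adj_symm _ _ (adj_four_nbot hs)) ?_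
      exact (isPathList_top (by decide) rfl rfl).append (adj_nine_nbot hs)
        (isPathList_rowDown hs (by omega) le_rfl)
    · exact forall_top_mem (t := [8, 7, 0] ++ [4, 1, 2, 3, 5, 6, 9]) (by decide) (by simp)
    · intro j
      have := j.2
      simp only [List.mem_append]
      rcases Nat.lt_or_ge j.val i with h | h
      · exact Or.inr (Or.inl (bot_mem_rowDown hs (by omega)))
      · exact Or.inr (Or.inr (Or.inr (bot_mem_rowDown hs (by omega))))
    · simp only [List.length_append, List.length_map, length_rowDown, List.length_cons,
        List.length_nil]
      omega

/-- Three pieces of the row: go up from `i` to the odd position `k - 1`, through the vertex labelled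
1 down from `i - 1` to 0, and through the other labelled vertices to the right end and down to `k`.
If `i = 0` the middle piece is empty. -/
theorem traversal_row_row (hs : 4 ≤ s) {i k : ℕ} (hik : i < k) (hk : k < 2 * s - 7) (hi : Even i)
    (hke : Even k) : HasTraversal (gate s).adj (nbot hs i) (nbot hs k) := by
  have hko : Odd (k - 1) := Nat.Even.sub_odd (by omega) hke odd_one
  rcases Nat.eq_zero_or_pos i with rfl | hi0
  · refine gate_hasTraversal (l := rowUp hs 0 k ++ ([0, 2, 1, 4, 3, 5, 6, 7, 8, 9].map top ++
      rowDown hs k (2 * s - 7))) ?_ ?_ ?_ ?_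
    · refine (isPathList_rowUp hs hik hk.le).append
        (gate_adj_symm _ _ (adj_zero_nbot hs (by omega) hko)) ?_
      exact (isPathList_top (by decide) rfl rfl).append (adj_nine_nbot hs)
        (isPathList_rowDown hs (by omega) le_rfl)
    · exact forall_top_mem (t := [0, 2, 1, 4, 3, 5, 6, 7, 8, 9]) (by decide) (by simp)
    · intro j
      have := j.2
      simp only [List.mem_append]
      rcases Nat.lt_or_ge j.val k with h | h
      · exact Or.inl (bot_mem_rowUp hs (by omega))
      · exact Or.inr (Or.inr (bot_mem_rowDown hs (by omega)))
    · simp only [List.length_append, List.length_map, length_rowDown, length_rowUp,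
        List.length_cons, List.length_nil]
      omega
  · have ho : Odd (i - 1) := Nat.Even.sub_odd hi0 hi odd_one
    refine gate_hasTraversal (l := rowUp hs i k ++ ([0].map top ++ (rowDown hs 0 i ++
      ([4, 1, 2, 3, 5, 6, 7, 8, 9].map top ++ rowDown hs k (2 * s - 7))))) ?_ ?_ ?_ ?_
    · refine (isPathList_rowUp hs hik hk.le).append
        (gate_adj_symm _ _ (adj_zero_nbot hs (by omega) hko)) ?_
      refine (isPathList_top (by decide) rfl rfl).append (adj_zero_nbot hs (by omega) ho) ?_
      refine (isPathList_rowDown hs hi0 (by omega)).append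
        (gate_adj_symm _ _ (adj_four_nbot hs)) ?_
      exact (isPathList_top (by decide) rfl rfl).append (adj_nine_nbot hs)
        (isPathList_rowDown hs (by omega) le_rfl)
    · exact forall_top_mem (t := [0] ++ [4, 1, 2, 3, 5, 6, 7, 8, 9]) (by decide) (by simp)
    · intro j
      have := j.2
      simp only [List.mem_append]
      rcases Nat.lt_or_ge j.val i with h | h
      · exact Or.inr (Or.inr (Or.inl (bot_mem_rowDown hs (by omega))))
      rcases Nat.lt_or_ge j.val k with h' | h'
      · exact Or.inl (bot_mem_rowUp hs (by omega))
      · exact Or.inr (Or.inr (Or.inr (Or.inr (bot_mem_rowDown hs (by omega)))))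
    · simp only [List.length_append, List.length_map, length_rowDown, length_rowUp,
        List.length_cons, List.length_nil]
      omega

theorem gateExternal_cases (hs : 4 ≤ s) {x : (gate s).V} (hx : x ∈ gateExternal s) :
    x = top 0 ∨ x = top 1 ∨ x = top 8 ∨ ∃ i < 2 * s - 7, Even i ∧ x = nbot hs i := by
  rcases x with a | j
  · rcases hx with h | h | h
    · obtain rfl : a = 0 := Fin.ext (by simpa using h)
      exact Or.inl rfl
    · obtain rfl : a = 1 := Fin.ext (by simpa using h)
      exact Or.inr (Or.inl rfl)
    · obtain rfl : a = 8 := Fin.ext (by simpa using h)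
      exact Or.inr (Or.inr (Or.inl rfl))
  · exact Or.inr (Or.inr (Or.inr ⟨j, j.2, hx, bot_eq_nbot hs j⟩))

/-- Any two of the vertices with external edges are joined by a traversal of the gate. -/
theorem gate_traversal (hs : 4 ≤ s) {x y : (gate s).V} (hx : x ∈ gateExternal s)
    (hy : y ∈ gateExternal s) (hxy : x ≠ y) : HasTraversal (gate s).adj x y := by
  have h01 := traversal_zero_one hs
  have h08 := traversal_zero_eight hs
  have h18 := traversal_one_eight hs
  have h0 := fun i => traversal_zero_row hs (i := i)
  have h1 := fun i => traversal_one_row hs (i := i)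
  have h8 := fun i => traversal_eight_row hs (i := i)
  rcases gateExternal_cases hs hx with rfl | rfl | rfl | ⟨i, hi, he, rfl⟩ <;>
    rcases gateExternal_cases hs hy with rfl | rfl | rfl | ⟨k, hk, he', rfl⟩
  · exact absurd rfl hxy
  · exact h01
  · exact h08
  · exact h0 k hk he'
  · exact h01.symm gate_adj_symm
  · exact absurd rfl hxy
  · exact h18
  · exact h1 k hk he'
  · exact h08.symm gate_adj_symm
  · exact h18.symm gate_adj_symm
  · exact absurd rfl hxy
  · exact h8 k hk he'
  · exact (h0 i hi he).symm gate_adj_symm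
  · exact (h1 i hi he).symm gate_adj_symm
  · exact (h8 i hi he).symm gate_adj_symm
  · rcases lt_trichotomy i k with h | rfl | h
    · exact traversal_row_row hs h hk he he'
    · exact absurd rfl hxy
    · exact (traversal_row_row hs h hi he' he).symm gate_adj_symm

end HCP

/-! ### Degrees in a gate; effect, termination and size of the gate loops -/

namespace MixedGraph

theorem kdeg_lt_card (M : MixedGraph) (k : Kind) (v : M.V) : M.kdeg k v + 1 ≤ Nat.card M.V := by
  have h : {u | (k, u) ∈ M.incident v} ⊆ {v}ᶜ := by
    rintro u hu rfl
    exact not_mem_incident_self hu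
  have h1 := Set.ncard_le_ncard h
  have h2 := Set.ncard_add_ncard_compl {v}
  rw [Set.ncard_singleton] at h2
  rw [kdeg]
  omega

/-- There are no directed edges. -/
def NoArc (M : MixedGraph) : Prop := ∀ x y, ¬ M.Arc x y

theorem NoArc.kdeg_inc {M : MixedGraph} (hM : M.NoArc) (v : M.V) : M.kdeg .inc v = 0 := by
  rw [kdeg, Set.ncard_eq_zero]
  ext u
  exact iff_of_false (hM _ _) (Set.notMem_empty _)

theorem NoArc.kdeg_out {M : MixedGraph} (hM : M.NoArc) (v : M.V) : M.kdeg .out v = 0 := by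
  rw [kdeg, Set.ncard_eq_zero]
  ext u
  exact iff_of_false (hM _ _) (Set.notMem_empty _)

theorem NoArc.degree_eq {M : MixedGraph} (hM : M.NoArc) (v : M.V) :
    M.degree v = (M.edge.neighborSet v).ncard := by
  rw [MixedGraph.degree_eq, hM.kdeg_inc, hM.kdeg_out, zero_add, zero_add]
  rfl

theorem NoArc.replace {M : MixedGraph} {v : M.V} {H : MixedGraph} {p : Kind × M.V → H.V}
    (hM : M.NoArc) (hH : H.NoArc) : (M.replace v H p).NoArc := by
  rintro (a | a) (b | b)
  · exact hM _ _
  · exact fun h => hM _ _ h.1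
  · exact fun h => hM _ _ h.1
  · exact hH _ _

theorem NoArc.adj_symm {M : MixedGraph} (hM : M.NoArc) (x y : M.V) (h : M.adj x y) : M.adj y x :=
  Or.inr (h.resolve_left (hM _ _)).symm

theorem NoArc.degree_le {M : MixedGraph} (hM : M.NoArc) (v : M.V) (l : List M.V)
    (h : ∀ u, M.adj v u → u ∈ l) : M.degree v ≤ l.length := by
  classical
  rw [hM.degree_eq]
  have h1 : M.edge.neighborSet v ⊆ (l.toFinset : Set M.V) := by
    intro u hu
    simpa using h u (Or.inr hu)
  refine (Set.ncard_le_ncard h1).trans ?_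
  rw [Set.ncard_coe_finset]
  exact List.toFinset_card_le l

end MixedGraph

namespace HCP

open MixedGraph

variable {s : ℕ}

theorem gate_noArc : (gate s).NoArc := fun _ _ => id

/-- The vertex labelled 1 has two labelled neighbours and `s - 4` neighbours in the row. Together
with its external edge it has degree at most `s - 1`, and it is the only vertex of the gate that may
need a further gate. -/
theorem degree_gate_zero (hs : 4 ≤ s) : (gate s).degree (top 0) ≤ s - 2 := by
  refine (gate_noArc.degree_le _ ([2, 7].map top ++
    (List.range (s - 4)).map fun i => nbot hs (2 * i + 1)) ?_).trans ?_
  · intro u hu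
    rcases gate_cases u with ⟨a, rfl⟩ | ⟨j, rfl⟩
    · have : ∀ a : Fin 10, (((0 : Fin 10).val + 1, a.val + 1) ∈
        ([(1, 3), (1, 8), (2, 3), (2, 5), (3, 4), (4, 5), (4, 6), (6, 7), (7, 8), (7, 10), (8, 9),
          (9, 10)] : List (ℕ × ℕ)) ∨ (a.val + 1, (0 : Fin 10).val + 1) ∈
        ([(1, 3), (1, 8), (2, 3), (2, 5), (3, 4), (4, 5), (4, 6), (6, 7), (7, 8), (7, 10), (8, 9),
          (9, 10)] : List (ℕ × ℕ))) → a = 2 ∨ a = 7 := by decide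
      rcases this a (gate_adj_iff.1 hu).2 with rfl | rfl <;> simp
    · rw [adj_top_bot] at hu
      obtain ⟨i, hi⟩ : Odd j.val := by
        rcases hu with h | h | h
        · exact absurd h.1 (by decide)
        · exact absurd h.1 (by decide)
        · exact h.2
      refine List.mem_append_right _ (List.mem_map.2 ⟨i, List.mem_range.2 ?_, ?_⟩)
      · have := j.2
        omega
      · rw [bot_eq_nbot hs, hi]
  · simp
    omega

open Classical in
theorem degree_gate_top (hs : 4 ≤ s) {a : Fin 10} (ha : a ≠ 0) :
    (gate s).degree (top a) + (if top a ∈ gateExternal s then 1 else 0) ≤ 3 := by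
  have hext : (top a ∈ gateExternal s) ↔ a = 0 ∨ a = 1 ∨ a = 8 := by
    have : (top a ∈ gateExternal s) ↔ (a.val + 1 = 1 ∨ a.val + 1 = 2 ∨ a.val + 1 = 9) := Iff.rfl
    rw [this]
    simp only [Fin.ext_iff]
    simp
  let t : Fin 10 → List (Fin 10) :=
    ![[2, 7], [2, 4], [0, 1, 3], [2, 4, 5], [1, 3], [3, 6], [5, 7, 9], [0, 6, 8], [7, 9], [6, 8]]
  let r : List (gate s).V :=
    if a = 4 then [nbot hs 0] else if a = 9 then [nbot hs (2 * s - 7 - 1)] else []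
  have h := (gate_noArc (s := s)).degree_le (top a) ((t a).map top ++ r) ?_
  · simp only [hext]
    refine (Nat.add_le_add_right h _).trans ?_
    simp only [List.length_append, List.length_map, r, t]
    fin_cases a <;> simp at ha ⊢
  · intro u hu
    rcases gate_cases u with ⟨b, rfl⟩ | ⟨j, rfl⟩
    · have : ∀ a b : Fin 10, ((a.val + 1, b.val + 1) ∈
        ([(1, 3), (1, 8), (2, 3), (2, 5), (3, 4), (4, 5), (4, 6), (6, 7), (7, 8), (7, 10), (8, 9),
          (9, 10)] : List (ℕ × ℕ)) ∨ (b.val + 1, a.val + 1) ∈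
        ([(1, 3), (1, 8), (2, 3), (2, 5), (3, 4), (4, 5), (4, 6), (6, 7), (7, 8), (7, 10), (8, 9),
          (9, 10)] : List (ℕ × ℕ))) → b ∈ (![[2, 7], [2, 4], [0, 1, 3], [2, 4, 5], [1, 3], [3, 6],
            [5, 7, 9], [0, 6, 8], [7, 9], [6, 8]] : Fin 10 → List (Fin 10)) a := by decide
      exact List.mem_append_left _ (List.mem_map_of_mem (this a b (gate_adj_iff.1 hu).2))
    · refine List.mem_append_right _ ?_
      rcases adj_top_bot.1 hu with ⟨rfl, h⟩ | ⟨rfl, h⟩ | ⟨rfl, -⟩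
      · simp [r, bot_eq_nbot hs, h]
      · have : j.val = 2 * s - 7 - 1 := by omega
        simp [r, bot_eq_nbot hs, this]
      · exact absurd rfl ha

open Classical in
theorem degree_gate_bot (hs : 4 ≤ s) (j : Fin (2 * s - 7)) :
    (gate s).degree (bot j) + (if bot j ∈ gateExternal s then 1 else 0) ≤ 3 := by
  have hext : (bot j ∈ gateExternal s) ↔ Even j.val := Iff.rfl
  have h := (gate_noArc (s := s)).degree_le (bot j) ([if j.val = 0 then top 4 else nbot hs (j.val - 1),
    if j.val + 1 = 2 * s - 7 then top 9 else nbot hs (j.val + 1)] ++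
      if Even j.val then [] else [top 0]) ?_
  · simp only [hext]
    refine (Nat.add_le_add_right h _).trans ?_
    split_ifs <;> simp
  · intro u hu
    rcases gate_cases u with ⟨b, rfl⟩ | ⟨k, rfl⟩
    · rcases adj_top_bot.1 (gate_adj_symm _ _ hu) with ⟨rfl, h⟩ | ⟨rfl, h⟩ | ⟨rfl, h⟩
      · simp [h]
      · simp [h]
      · simp [Nat.not_even_iff_odd.2 h]
    · have := k.2
      rcases adj_bot_bot.1 hu with h | h
      · have h1 : j.val + 1 ≠ 2 * s - 7 := by omega
        rw [if_neg h1, h, ← bot_eq_nbot hs k]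
        simp
      · have h1 : j.val ≠ 0 := by omega
        have h2 : k.val = j.val - 1 := by omega
        rw [if_neg h1, ← h2, ← bot_eq_nbot hs k]
        simp

/-- Separates the vertex labelled 1 from the other `9 + (2 * s - 7)` vertices, whose degrees are at
most 3 once the external edges are attached. -/
theorem total_gate_le (f : (gate s).V → ℕ) {a c : ℕ} (h0 : f (top 0) ≤ a)
    (h : ∀ x, x ≠ top 0 → f x ≤ c) :
    (gate s).total f ≤ a + (9 + (2 * s - 7)) * c := by
  rw [total_gate, Fin.sum_univ_succ]
  have h1 : ∑ i : Fin 9, f (top i.succ) ≤ ∑ _i : Fin 9, c :=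
    Finset.sum_le_sum fun i _ => h _ fun h => Fin.succ_ne_zero i (Sum.inl_injective h)
  have h2 : ∑ j : Fin (2 * s - 7), f (bot j) ≤ ∑ _j : Fin (2 * s - 7), c :=
    Finset.sum_le_sum fun i _ => h _ fun h => (Sum.inl_ne_inr h.symm).elim
  simp only [Finset.sum_const, Finset.card_univ, Fintype.card_fin, smul_eq_mul] at h1 h2
  rw [add_mul]
  omega

section GateDegree

variable {M : MixedGraph} {v : M.V} {p : Kind × M.V → (gate s).V}

theorem degree_rinr_zero_le (hs : 4 ≤ s) (hp : Set.BijOn p (M.incident v) (gateExternal s)) :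
    (M.replace v (gate s) p).degree (rinr (top 0)) ≤ s - 1 := by
  classical
  rw [degree_rinr_of_bijOn hp]
  have := degree_gate_zero hs
  split_ifs <;> omega

theorem degree_rinr_le (hs : 4 ≤ s) (hp : Set.BijOn p (M.incident v) (gateExternal s))
    {x : (gate s).V} (hx : x ≠ top 0) : (M.replace v (gate s) p).degree (rinr x) ≤ 3 := by
  classical
  rw [degree_rinr_of_bijOn hp]
  rcases gate_cases x with ⟨a, rfl⟩ | ⟨j, rfl⟩
  · exact degree_gate_top hs fun h => hx (h ▸ rfl)
  · exact degree_gate_bot hs j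

end GateDegree

/-- The number of vertices into which gates convert a vertex of degree `s`. -/
def gateSize (s : ℕ) : ℕ := 1 + (s - 3) * (s + 6)

theorem gateSize_mono {a b : ℕ} (h : a ≤ b) : gateSize a ≤ gateSize b :=
  Nat.add_le_add_left (Nat.mul_le_mul (by omega) (by omega)) 1

theorem gateSize_of_le {a : ℕ} (h : a ≤ 3) : gateSize a = 1 := by
  simp [gateSize, Nat.sub_eq_zero_of_le h]

/-- This recursion is what defines `gateSize`: an `s`-gate consists of one vertex of degree at most
`s - 1`, still to be replaced, and `9 + (2 * s - 7)` finished vertices that count 1 each. -/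
theorem gateSize_sub_one {s : ℕ} (hs : 4 ≤ s) :
    gateSize (s - 1) + (9 + (2 * s - 7)) = gateSize s := by
  obtain ⟨n, rfl⟩ := Nat.exists_eq_add_of_le hs
  have h2 : 4 + n - 1 = 3 + n := by omega
  have h3 : 4 + n - 3 = n + 1 := by omega
  have h4 : 2 * (4 + n) - 7 = 2 * n + 1 := by omega
  simp only [gateSize, h2, h3, h4]
  have : 3 + n - 3 = n := by omega
  rw [this]
  ring

theorem GateStep.total_gateSize_le {M M' : MixedGraph} (h : GateStep M M') :
    M'.total (fun v => gateSize (M'.degree v)) ≤ M.total fun v => gateSize (M.degree v) := by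
  obtain ⟨v, p, hs, hp, rfl⟩ := h
  have h1 := total_replace (M := M) (v := v) (H := gate (M.degree v)) (p := p)
    (f := fun x => gateSize ((M.replace v (gate (M.degree v)) p).degree x))
    (g := fun x => gateSize (M.degree x)) fun w => by rw [degree_rinl]
  have h2 := total_gate_le (s := M.degree v)
    (fun x => gateSize ((M.replace v (gate (M.degree v)) p).degree (rinr x)))
    (gateSize_mono (degree_rinr_zero_le hs hp))
    (fun x hx => (gateSize_of_le (degree_rinr_le hs hp hx)).le)
  have := gateSize_sub_one hs
  omega

theorem gateStep_terminates : LoopTerminates GateStep := by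
  -- The excess over 3 drops from `s - 3` to at most `s - 4`, all other vertices of the gate having
  -- none.
  refine .of_measure (fun M => M.total fun v => M.degree v - 3) ?_
  rintro M M' ⟨v, p, hs, hp, rfl⟩
  have h1 := total_replace (M := M) (v := v) (H := gate (M.degree v)) (p := p)
    (f := fun x => (M.replace v (gate (M.degree v)) p).degree x - 3)
    (g := fun x => M.degree x - 3) fun w => by rw [degree_rinl]
  have h2 := total_gate_le (s := M.degree v) (a := M.degree v - 1 - 3) (c := 0)
    (fun x => (M.replace v (gate (M.degree v)) p).degree (rinr x) - 3)
    (Nat.sub_le_sub_right (degree_rinr_zero_le hs hp) 3)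
    (fun x hx => by
      have := degree_rinr_le hs hp hx
      omega)
  omega

/-- A passage alternates between the colours and has both ends in the larger class, so it uses one
vertex more of that class. The whole gate has an excess of only one, hence there is only one
passage. -/
theorem GateStep.ham_iff {M M' : MixedGraph} (h : GateStep M M') : M'.Ham ↔ M.Ham := by
  obtain ⟨v, p, hs, hp, rfl⟩ := h
  constructor
  · refine Ham.of_replace_of_weight (fun x => 2 * gateColor _ x - 1) (gateColor _)
      (sum_gateColor hs) ?_ ?_ ?_ (exists_ne_of_degree_pos (by omega))
    · intro x y hxy
      have := gateColor_add_of_adj hs hxy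
      omega
    · intro x hx _
      exact gateColor_external (hp.mapsTo hx)
    · intro x hx _
      rw [gateColor_external (hp.mapsTo hx)]
      rfl
  · refine Ham.replace ?_ (Or.inr ?_)
    · intro x hx y hy hxy _ _
      exact gate_traversal hs (hp.mapsTo hx) (hp.mapsTo hy) fun h => hxy (hp.injOn hx hy h)
    -- Each of the three kinds gives `v` at most as many edges as there are other vertices, so four
    -- incident edges need at least two other vertices.
    · have h1 := M.kdeg_lt_card .inc v
      have h2 := M.kdeg_lt_card .out v
      have h3 := M.kdeg_lt_card .und v
      rw [degree_eq] at hs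
      omega

theorem FourGateStep.gateStep {M M' : MixedGraph} (h : FourGateStep M M') : GateStep M M' := by
  obtain ⟨v, p, hs, hp, rfl⟩ := h
  -- The type of `p` depends on the size of the gate, so the equation for the degree is used by
  -- generalizing 4 to a variable `s`.
  have : ∀ s, s = M.degree v → ∀ p : Kind × M.V → (gate s).V,
      Set.BijOn p (M.incident v) (gateExternal s) → 4 ≤ s →
        GateStep M (M.replace v (gate s) p) := by
    rintro s rfl p hp hs
    exact ⟨v, p, hs, hp, rfl⟩
  exact this 4 hs.symm p hp le_rfl

theorem fourGateStep_terminates : LoopTerminates FourGateStep :=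
  Subrelation.wf (fun {_ _} h => h.gateStep) gateStep_terminates

/-- Three labelled vertices and the `s - 3` even positions of the row. Since the numbers agree, a
gate can be attached whenever the degree is large enough, so the loops stop only where they should.
-/
theorem ncard_gateExternal (hs : 4 ≤ s) : (gateExternal s).ncard = s := by
  classical
  let f : Fin 3 ⊕ Fin (s - 3) → (gate s).V :=
    Sum.elim (fun i => top (![0, 1, 8] i)) (fun i => bot ⟨2 * i.val, by omega⟩)
  have hf : Function.Injective f := by
    rintro (i | i) (j | j) hij
    · have : ∀ i j : Fin 3, (![0, 1, 8] i : Fin 10) = ![0, 1, 8] j → i = j := by decide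
      rw [this i j (Sum.inl_injective hij)]
    · exact (Sum.inl_ne_inr hij).elim
    · exact (Sum.inl_ne_inr hij.symm).elim
    · have := Fin.mk.inj (Sum.inr_injective hij)
      rw [Fin.ext (a := i) (b := j) (by omega)]
  have hr : gateExternal s = Set.range f := by
    ext x
    constructor
    · intro hx
      rcases gateExternal_cases hs hx with rfl | rfl | rfl | ⟨i, hi, ⟨k, hk⟩, rfl⟩
      · exact ⟨Sum.inl 0, rfl⟩
      · exact ⟨Sum.inl 1, rfl⟩
      · exact ⟨Sum.inl 2, rfl⟩
      · refine ⟨Sum.inr ⟨k, by omega⟩, ?_⟩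
        rw [nbot_eq hs hi]
        simp only [f, Sum.elim_inr]
        congr 2
        omega
    · rintro ⟨i | i, rfl⟩
      · have : ∀ i : Fin 3, (![0, 1, 8] i : Fin 10).val + 1 = 1 ∨ (![0, 1, 8] i : Fin 10).val + 1 = 2
          ∨ (![0, 1, 8] i : Fin 10).val + 1 = 9 := by decide
        exact this i
      · exact even_two_mul i.val
  rw [hr, ← Set.image_univ, Set.ncard_image_of_injective _ hf, Set.ncard_univ,
    Nat.card_eq_fintype_card, Fintype.card_sum, Fintype.card_fin, Fintype.card_fin]
  omega

theorem exists_bijOn_of_ncard_eq {α β : Type*} [Finite α] [Finite β] [Nonempty β] {S : Set α}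
    {T : Set β} (h : S.ncard = T.ncard) : ∃ f : α → β, Set.BijOn f S T := by
  refine S.toFinite.exists_bijOn_of_encard_eq ?_
  rw [← S.toFinite.cast_ncard_eq, ← T.toFinite.cast_ncard_eq, h]

theorem degree_le_of_forall_not_gateStep {M : MixedGraph} (h : ∀ M', ¬ GateStep M M') (v : M.V) :
    M.degree v ≤ 3 := by
  by_contra! hv
  have : Nonempty (gate (M.degree v)).V := ⟨top 0⟩
  obtain ⟨p, hp⟩ := exists_bijOn_of_ncard_eq (S := M.incident v)
    (T := gateExternal (M.degree v)) (ncard_gateExternal hv).symm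
  exact h _ ⟨v, p, hv, hp, rfl⟩

theorem degree_ne_of_forall_not_fourGateStep {M : MixedGraph} (h : ∀ M', ¬ FourGateStep M M')
    (v : M.V) : M.degree v ≠ 4 := by
  intro hv
  have : Nonempty (gate 4).V := ⟨top 0⟩
  obtain ⟨p, hp⟩ := exists_bijOn_of_ncard_eq (S := M.incident v)
    (T := gateExternal 4) (hv.trans (ncard_gateExternal le_rfl).symm)
  exact h _ ⟨v, p, hv, hp, rfl⟩

theorem gateSteps_invariant {M B : MixedGraph} (h : Relation.ReflTransGen GateStep M B) :
    (B.Ham ↔ M.Ham) ∧ (∀ c ≤ 3, (∃ v, M.degree v ≤ c) → ∃ v, B.degree v ≤ c) ∧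
      Nat.card B.V ≤ M.total fun v => gateSize (M.degree v) := by
  obtain ⟨h1, h2, h3⟩ := reflTransGen_invariant (P := fun X => (X.Ham ↔ M.Ham) ∧
    (∀ c ≤ 3, (∃ v, M.degree v ≤ c) → ∃ v, X.degree v ≤ c) ∧
      X.total (fun v => gateSize (X.degree v)) ≤ M.total fun v => gateSize (M.degree v))
    (fun X Y hXY ⟨h1, h2, h3⟩ => ⟨hXY.ham_iff.trans h1, fun c hc h => by
      obtain ⟨v, p, hs, hp, rfl⟩ := hXY
      exact exists_degree_le_replace (h2 c hc h) (by omega), hXY.total_gateSize_le.trans h3⟩)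
    h ⟨Iff.rfl, fun _ _ => id, le_rfl⟩
  refine ⟨h1, h2, le_trans ?_ h3⟩
  have : B.total (fun _ => 1) ≤ B.total (fun v => gateSize (B.degree v)) :=
    total_mono fun v => Nat.le_add_right _ _
  rwa [total_const, mul_one] at this

theorem FourGateStep.invariant {M M' : MixedGraph} (h : FourGateStep M M') (hM : M.NoArc)
    (hd : ∀ v, M.degree v ≤ 4) : M'.NoArc ∧ ∀ v, M'.degree v ≤ 4 := by
  obtain ⟨v, p, hs, hp, rfl⟩ := h
  refine ⟨hM.replace gate_noArc, fun x => ?_⟩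
  rcases replace_cases x with ⟨w, rfl⟩ | ⟨x, rfl⟩
  · rw [degree_rinl]
    exact hd w
  · by_cases hx : x = top 0
    · rw [hx]
      exact (degree_rinr_zero_le le_rfl hp).trans (by omega)
    · exact (degree_rinr_le le_rfl hp hx).trans (by omega)

/-- This loop only removes vertices of degree exactly 4, so a sub-cubic result needs the invariant
that no degree exceeds 4. The factor 11 is `gateSize 4`. -/
theorem fourGateSteps_invariant {M D : MixedGraph} (hM : M.NoArc) (hd : ∀ v, M.degree v ≤ 4)
    (h : RunLoop FourGateStep M D) : D.NoArc ∧ (∀ v, D.degree v ≤ 3) ∧ (D.Ham ↔ M.Ham) ∧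
      (∀ c ≤ 3, (∃ v, M.degree v ≤ c) → ∃ v, D.degree v ≤ c) ∧
      Nat.card D.V ≤ 11 * Nat.card M.V := by
  obtain ⟨h1, h2⟩ := reflTransGen_invariant (P := fun X => X.NoArc ∧ ∀ v, X.degree v ≤ 4)
    (fun X Y hXY hX => hXY.invariant hX.1 hX.2) h.1 ⟨hM, hd⟩
  obtain ⟨h3, h4, h5⟩ := gateSteps_invariant (Relation.ReflTransGen.mono (fun _ _ => FourGateStep.gateStep) _ _ h.1)
  refine ⟨h1, fun v => ?_, h3, h4, h5.trans ?_⟩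
  · have := degree_ne_of_forall_not_fourGateStep h.2 v
    have := h2 v
    omega
  · have : M.total (fun v => gateSize (M.degree v)) ≤ M.total fun _ => 11 :=
      total_mono fun v => gateSize_mono (hd v)
    rwa [total_const, mul_comm] at this

end HCP

/-! ## Karp's conversion -/

namespace HCP

open MixedGraph

variable {B : MixedGraph}

theorem karp_noArc (B : MixedGraph) : (karp B).NoArc := fun _ _ => id

/-- The three vertices of the path into which a vertex is converted. -/
def kv (i : B.V) (a : Fin 3) : (karp B).V := ((i, a) : B.V × Fin 3)

theorem kv_inj {i j : B.V} {a b : Fin 3} : kv i a = kv j b ↔ i = j ∧ a = b :=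
  Prod.mk_inj

theorem kv_surj (x : (karp B).V) : ∃ i a, x = kv i a := ⟨x.1, x.2, rfl⟩

theorem karp_adj_iff {i j : B.V} {a b : Fin 3} :
    (karp B).adj (kv i a) (kv j b) ↔
      (i = j ∧ ((a = 1 ∧ b ≠ 1) ∨ (b = 1 ∧ a ≠ 1))) ∨ (B.adj i j ∧ a = 2 ∧ b = 0) ∨
        (B.adj j i ∧ b = 2 ∧ a = 0) := by
  have h : (karp B).adj (kv i a) (kv j b) ↔ kv i a ≠ kv j b ∧
      (((i = j ∧ a = 1 ∧ (b = 0 ∨ b = 2)) ∨ (B.adj i j ∧ a = 2 ∧ b = 0)) ∨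
        ((j = i ∧ b = 1 ∧ (a = 0 ∨ a = 2)) ∨ (B.adj j i ∧ b = 2 ∧ a = 0))) :=
    ⟨fun h => h.resolve_left id, Or.inr⟩
  have hb : ∀ b : Fin 3, b ≠ 1 ↔ b = 0 ∨ b = 2 := by decide
  rw [h, Ne, kv_inj, hb, hb]
  clear h
  constructor
  · rintro ⟨-, (⟨h1, h2⟩ | h) | (⟨h1, h2⟩ | h)⟩
    · exact Or.inl ⟨h1, Or.inl h2⟩
    · exact Or.inr (Or.inl h)
    · exact Or.inl ⟨h1.symm, Or.inr h2⟩
    · exact Or.inr (Or.inr h)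
  · rintro (⟨rfl, ⟨rfl, h⟩ | ⟨rfl, h⟩⟩ | ⟨h, rfl, rfl⟩ | ⟨h, rfl, rfl⟩)
    · exact ⟨by rintro ⟨-, rfl⟩; simp at h, Or.inl (Or.inl ⟨rfl, rfl, h⟩)⟩
    · exact ⟨by rintro ⟨-, rfl⟩; simp at h, Or.inr (Or.inl ⟨rfl, rfl, h⟩)⟩
    · exact ⟨fun h => by simp at h, Or.inl (Or.inr ⟨h, rfl, rfl⟩)⟩
    · exact ⟨fun h => by simp at h, Or.inr (Or.inr ⟨h, rfl, rfl⟩)⟩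

theorem card_karp (B : MixedGraph) : Nat.card (karp B).V = 3 * Nat.card B.V := by
  have : Nat.card (karp B).V = Nat.card (B.V × Fin 3) := rfl
  rw [this, Nat.card_prod, Nat.card_eq_fintype_card (α := Fin 3), Fintype.card_fin, mul_comm]

/-- Only an inequality, since edges of different kinds may join the same two vertices; Karp's
conversion merges them. -/
theorem ncard_adj_left_le (i : B.V) : {j | B.adj j i}.ncard ≤ B.degree i := by
  have : {j | B.adj j i} ⊆ Prod.snd '' B.incident i := by
    intro j hj
    obtain ⟨x, hx, -, rfl⟩ := adj_iff_incident_left.1 hj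
    exact ⟨x, hx, rfl⟩
  exact (Set.ncard_le_ncard this).trans (Set.ncard_image_le (Set.toFinite _))

theorem ncard_adj_right_le (i : B.V) : {j | B.adj i j}.ncard ≤ B.degree i := by
  have : {j | B.adj i j} ⊆ Prod.snd '' B.incident i := by
    intro j hj
    obtain ⟨x, hx, -, rfl⟩ := adj_iff_incident_right.1 hj
    exact ⟨x, hx, rfl⟩
  exact (Set.ncard_le_ncard this).trans (Set.ncard_image_le (Set.toFinite _))

theorem degree_karp_le_of_subset {i : B.V} {a b : Fin 3} {S : Set B.V}
    (hS : S.ncard ≤ B.degree i)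
    (h : (karp B).edge.neighborSet (kv i a) ⊆ {kv i 1} ∪ (fun j => kv j b) '' S) :
    (karp B).degree (kv i a) ≤ 1 + B.degree i := by
  rw [(karp_noArc B).degree_eq]
  refine (Set.ncard_le_ncard h).trans ((Set.ncard_union_le _ _).trans ?_)
  rw [Set.ncard_singleton]
  exact Nat.add_le_add_left ((Set.ncard_image_le (Set.toFinite _)).trans hS) 1

theorem degree_karp_zero_le (i : B.V) : (karp B).degree (kv i 0) ≤ 1 + B.degree i := by
  refine degree_karp_le_of_subset (b := 2) (ncard_adj_left_le i) ?_
  intro x hx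
  obtain ⟨j, a, rfl⟩ := kv_surj x
  rcases karp_adj_iff.1 (Or.inr hx) with ⟨rfl, h | h⟩ | h | ⟨h, rfl, -⟩
  · exact absurd h.1 (by decide)
  · exact Or.inl (kv_inj.2 ⟨rfl, h.1⟩)
  · exact absurd h.2.1 (by decide)
  · exact Or.inr ⟨j, h, rfl⟩

theorem degree_karp_two_le (i : B.V) : (karp B).degree (kv i 2) ≤ 1 + B.degree i := by
  refine degree_karp_le_of_subset (b := 0) (ncard_adj_right_le i) ?_
  intro x hx
  obtain ⟨j, a, rfl⟩ := kv_surj x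
  rcases karp_adj_iff.1 (Or.inr hx) with ⟨rfl, h | h⟩ | ⟨h, -, rfl⟩ | h
  · exact absurd h.1 (by decide)
  · exact Or.inl (kv_inj.2 ⟨rfl, h.1⟩)
  · exact Or.inr ⟨j, h, rfl⟩
  · exact absurd h.2.2 (by decide)

theorem adj_kv_one {i j : B.V} {b : Fin 3} (h : (karp B).adj (kv i 1) (kv j b)) :
    j = i ∧ (b = 0 ∨ b = 2) := by
  rcases karp_adj_iff.1 h with ⟨rfl, h | h⟩ | h | h
  · exact ⟨rfl, (by decide : ∀ b : Fin 3, b ≠ 1 → b = 0 ∨ b = 2) b h.2⟩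
  · exact absurd rfl h.2
  · exact absurd h.2.1 (by decide)
  · exact absurd h.2.2 (by decide)

theorem degree_karp_one_le (i : B.V) : (karp B).degree (kv i 1) ≤ 2 := by
  refine (karp_noArc B).degree_le _ [kv i 0, kv i 2] fun x hx => ?_
  obtain ⟨j, a, rfl⟩ := kv_surj x
  obtain ⟨rfl, rfl | rfl⟩ := adj_kv_one hx <;> simp

theorem degree_karp_le (hB : ∀ i, B.degree i ≤ 3) (x : (karp B).V) : (karp B).degree x ≤ 4 := by
  obtain ⟨i, a, rfl⟩ := kv_surj x
  have := hB i
  have h0 := degree_karp_zero_le i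
  have h1 := degree_karp_one_le i
  have h2 := degree_karp_two_le i
  fin_cases a
  · exact h0.trans (by omega)
  · exact h1.trans (by omega)
  · exact h2.trans (by omega)

/-- The path into which a vertex is converted. -/
def kpath (i : B.V) : List (karp B).V := [kv i 0, kv i 1, kv i 2]

theorem head?_flatMap_kpath {l : List B.V} {i : B.V} (h : l.head? = some i) :
    (l.flatMap kpath).head? = some (kv i 0) := by
  rcases l with _ | ⟨j, l⟩
  · simp at h
  · obtain rfl : j = i := by simpa using h
    rfl

theorem getLast?_flatMap_kpath {l : List B.V} {i : B.V} (h : l.getLast? = some i) :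
    (l.flatMap kpath).getLast? = some (kv i 2) := by
  rcases List.eq_nil_or_concat l with rfl | ⟨l, j, rfl⟩
  · simp at h
  · obtain rfl : j = i := by simpa using h
    simp [kpath]

theorem isChain_flatMap_kpath {l : List B.V} (h : l.IsChain B.adj) :
    (l.flatMap kpath).IsChain (karp B).adj := by
  induction l with
  | nil => simp
  | cons i l ih =>
    have hi : (kpath i).IsChain (karp B).adj := by
      simp only [kpath, List.isChain_cons_cons, List.isChain_singleton, and_true]
      exact ⟨karp_adj_iff.2 (by simp), karp_adj_iff.2 (by simp)⟩
    rw [List.flatMap_cons]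
    rcases l with _ | ⟨j, l⟩
    · simpa using hi
    · rw [List.isChain_cons_cons] at h
      refine List.isChain_append.2 ⟨hi, ih h.2, ?_⟩
      rw [head?_flatMap_kpath rfl]
      simp only [kpath, Option.mem_def, Option.some_inj, forall_eq']
      rintro _ h'
      obtain rfl := Option.some_inj.1 h'
      exact karp_adj_iff.2 (Or.inr (Or.inl ⟨h.1, rfl, rfl⟩))

theorem mem_flatMap_kpath {l : List B.V} {i : B.V} {a : Fin 3} :
    kv i a ∈ l.flatMap kpath ↔ i ∈ l := by
  simp only [List.mem_flatMap, kpath, List.mem_cons, kv_inj, List.not_mem_nil, or_false]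
  constructor
  · rintro ⟨j, hj, ⟨rfl, -⟩ | ⟨rfl, -⟩ | ⟨rfl, -⟩⟩ <;> exact hj
  · intro hi
    refine ⟨i, hi, ?_⟩
    fin_cases a <;> simp

theorem nodup_flatMap_kpath {l : List B.V} : (l.flatMap kpath).Nodup ↔ l.Nodup := by
  induction l with
  | nil => simp
  | cons i l ih =>
    rw [List.flatMap_cons, List.nodup_append, List.nodup_cons, ih]
    have h1 : (kpath i).Nodup := by simp [kpath, kv_inj]
    constructor
    · rintro ⟨-, h, h'⟩
      refine ⟨fun hi => ?_, h⟩
      exact h' (kv i 0) (by simp [kpath]) (kv i 0) (mem_flatMap_kpath.2 hi) rfl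
    · rintro ⟨h, h'⟩
      refine ⟨h1, h', ?_⟩
      rintro x hx y hy rfl
      obtain ⟨j, a, rfl⟩ := kv_surj x
      simp only [kpath, List.mem_cons, kv_inj, List.not_mem_nil, or_false] at hx
      rcases hx with ⟨rfl, -⟩ | ⟨rfl, -⟩ | ⟨rfl, -⟩ <;> exact h (mem_flatMap_kpath.1 hy)

theorem Ham.karp (h : B.Ham) : (karp B).Ham := by
  obtain ⟨l, hne, hl⟩ := h
  obtain ⟨a, ha⟩ : ∃ a, l.head? = some a := ⟨_, List.head?_eq_some_head hne⟩
  obtain ⟨b, hb⟩ : ∃ a, l.getLast? = some a := ⟨_, List.getLast?_eq_some_getLast hne⟩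
  obtain ⟨h1, h2⟩ := (cycleChain_iff_of_head?_of_getLast? ha hb).1 hl.2.2
  refine ⟨l.flatMap kpath, ?_, nodup_flatMap_kpath.2 hl.1, ?_, ?_⟩
  · intro h
    have := head?_flatMap_kpath ha
    simp [h] at this
  · intro x
    obtain ⟨i, a, rfl⟩ := kv_surj x
    exact mem_flatMap_kpath.2 (hl.2.1 i)
  · exact (cycleChain_iff_of_head?_of_getLast? (head?_flatMap_kpath ha)
      (getLast?_flatMap_kpath hb)).2 ⟨isChain_flatMap_kpath h1,
        karp_adj_iff.2 (Or.inr (Or.inl ⟨h2, rfl, rfl⟩))⟩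

/-! ### From a tour of Karp's graph back to the mixed graph -/

section Backward

variable {σ : Equiv.Perm (karp B).V}

/-- In the Hamiltonian cycle given by `σ`, the vertex `i` is traversed forwards. -/
def Forward (σ : Equiv.Perm (karp B).V) (i : B.V) : Prop :=
  σ (kv i 0) = kv i 1 ∧ σ (kv i 1) = kv i 2

/-- The middle vertex of a path has no neighbours but the two ends, and its predecessor and
successor in the tour are different. -/
theorem forward_or_backward (hσ : ∀ x, (karp B).adj x (σ x)) (h2 : ∀ x, σ (σ x) ≠ x) (i : B.V) :
    Forward σ i ∨ (σ (kv i 2) = kv i 1 ∧ σ (kv i 1) = kv i 0) := by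
  obtain ⟨j, a, h⟩ := kv_surj (σ (kv i 1))
  obtain ⟨k, b, h'⟩ := kv_surj (σ.symm (kv i 1))
  have e1 := hσ (kv i 1)
  rw [h] at e1
  obtain ⟨rfl, ha⟩ := adj_kv_one e1
  have e2 := (karp_noArc B).adj_symm _ _ (hσ (σ.symm (kv j 1)))
  rw [Equiv.apply_symm_apply, h'] at e2
  obtain ⟨rfl, hb⟩ := adj_kv_one e2
  have h3 : σ (kv k b) = kv k 1 := by rw [← h', Equiv.apply_symm_apply]
  have h4 := h2 (kv k b)
  rw [h3, h, Ne, kv_inj] at h4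
  rcases ha with rfl | rfl <;> rcases hb with rfl | rfl
  · simp at h4
  · exact Or.inr ⟨h3, h⟩
  · exact Or.inl ⟨h3, h⟩
  · simp at h4

/-- After the last vertex of a forward path the tour cannot turn back, as the middle vertex already
has another predecessor. So it enters the first vertex of some path; that path is not traversed
backwards, since then its first vertex would be reached from its own middle. -/
theorem Forward.exists_next (hσ : ∀ x, (karp B).adj x (σ x)) (h2 : ∀ x, σ (σ x) ≠ x) {i : B.V}
    (hi : Forward σ i) : ∃ j, σ (kv i 2) = kv j 0 ∧ B.adj i j ∧ Forward σ j := by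
  obtain ⟨j, a, h⟩ := kv_surj (σ (kv i 2))
  have e := hσ (kv i 2)
  rw [h] at e
  rcases karp_adj_iff.1 e with ⟨rfl, h' | h'⟩ | ⟨h', -, rfl⟩ | h'
  · exact absurd h'.1 (by decide)
  · rw [h'.1, ← hi.1] at h
    exact absurd (kv_inj.1 (σ.injective h)).2 (by decide)
  · refine ⟨j, h, h', (forward_or_backward hσ h2 j).resolve_right ?_⟩
    rintro ⟨-, h3⟩
    rw [← h3] at h
    exact absurd (kv_inj.1 (σ.injective h)).2 (by decide)
  · exact absurd h'.2.2 (by decide)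

/-- Cuts the tour into whole paths. Three entries are consumed at a time, hence the induction on a
bound for the length. The condition on the last entry, that its successor is a first vertex,
prevents the list from ending inside a path. -/
theorem exists_eq_flatMap_kpath (hσ : ∀ x, (karp B).adj x (σ x)) (h2 : ∀ x, σ (σ x) ≠ x) (n : ℕ) :
    ∀ (L : List (karp B).V) (i : B.V), L.length ≤ n → L.IsChain (fun x y => σ x = y) →
      L.head? = some (kv i 0) → (∀ e, L.getLast? = some e → ∃ k, σ e = kv k 0) → Forward σ i →
        ∃ l : List B.V, L = l.flatMap kpath ∧ l.IsChain B.adj ∧ l.head? = some i := by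
  induction n with
  | zero =>
    intro L i hL _ h
    rw [List.length_eq_zero_iff.1 (Nat.le_zero.1 hL)] at h
    simp at h
  | succ n ih =>
    rintro (_ | ⟨x, L⟩) i hL hc hh hl hi
    · simp at hh
    obtain rfl : x = kv i 0 := by simpa using hh
    rcases L with _ | ⟨x, L⟩
    · obtain ⟨k, hk⟩ := hl (kv i 0) rfl
      rw [hi.1, kv_inj] at hk
      exact absurd hk.2 (by decide)
    rw [List.isChain_cons_cons] at hc
    obtain rfl : x = kv i 1 := hc.1.symm.trans hi.1
    rcases L with _ | ⟨x, L⟩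
    · obtain ⟨k, hk⟩ := hl (kv i 1) rfl
      rw [hi.2, kv_inj] at hk
      exact absurd hk.2 (by decide)
    rw [List.isChain_cons_cons] at hc
    obtain rfl : x = kv i 2 := hc.2.1.symm.trans hi.2
    rcases L with _ | ⟨x, L⟩
    · exact ⟨[i], rfl, List.isChain_singleton _, rfl⟩
    · rw [List.isChain_cons_cons] at hc
      obtain ⟨j, hj, hij, hj'⟩ := hi.exists_next hσ h2
      obtain rfl : x = kv j 0 := hc.2.2.1.symm.trans hj
      obtain ⟨l, h3, h4, h5⟩ := ih (kv j 0 :: L) j (by simp at hL ⊢; omega) hc.2.2.2 rfl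
        (by simpa using hl) hj'
      refine ⟨i :: l, by rw [h3]; rfl, ?_, rfl⟩
      rw [List.isChain_cons, h5]
      simpa using ⟨hij, h4⟩

theorem ham_of_forward (hσ : ∀ x, (karp B).adj x (σ x)) (h2 : ∀ x, σ (σ x) ≠ x)
    (h : HasTour fun x y => σ x = y) {i : B.V} (hi : Forward σ i) : B.Ham := by
  obtain ⟨t, ht⟩ := h.exists_cons (kv i 0)
  obtain ⟨e, he⟩ : ∃ e, (kv i 0 :: t).getLast? = some e :=
    ⟨_, List.getLast?_eq_some_getLast (by simp)⟩
  obtain ⟨h3, h4⟩ := (cycleChain_iff_of_head?_of_getLast? rfl he).1 ht.2.2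
  obtain ⟨l, h5, h6, h7⟩ := exists_eq_flatMap_kpath hσ h2 _ _ i le_rfl h3 rfl (fun e' he' => by
    obtain rfl : e = e' := Option.some_inj.1 (he.symm.trans he')
    exact ⟨i, h4⟩) hi
  have hne : l ≠ [] := by
    rintro rfl
    simp at h7
  obtain ⟨k, hk⟩ : ∃ k, l.getLast? = some k := ⟨_, List.getLast?_eq_some_getLast hne⟩
  refine ⟨l, hne, ?_, ?_, ?_⟩
  · rw [← nodup_flatMap_kpath, ← h5]
    exact ht.1
  · intro j
    rw [← mem_flatMap_kpath (a := 0), ← h5]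
    exact ht.2.1 _
  · refine (cycleChain_iff_of_head?_of_getLast? h7 hk).2 ⟨h6, ?_⟩
    rw [h5, getLast?_flatMap_kpath hk, Option.some_inj] at he
    have := hσ e
    rw [h4, ← he] at this
    rcases karp_adj_iff.1 this with ⟨-, h | h⟩ | h | h
    · exact absurd h.1 (by decide)
    · exact absurd h.1 (by decide)
    · exact h.1
    · exact absurd h.2.1 (by decide)

end Backward

theorem karp_ham_iff (B : MixedGraph) : (karp B).Ham ↔ B.Ham := by
  refine ⟨fun h => ?_, Ham.karp⟩
  obtain ⟨σ, hσ, hT⟩ := HasTour.exists_perm h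
  obtain ⟨x⟩ := h.nonempty
  have : Nonempty B.V := ⟨x.1⟩
  have h3 : 3 ≤ Nat.card (karp B).V := by
    have := Nat.card_pos (α := B.V)
    rw [card_karp]
    omega
  have h2 := perm_apply_apply_ne hT h3
  rcases forward_or_backward hσ h2 x.1 with hf | ⟨hb1, hb2⟩
  · exact ham_of_forward hσ h2 hT hf
  -- The path of `x.1` is traversed backwards, so the reversed tour, with successor map `σ.symm`,
  -- traverses it forwards.
  · refine ham_of_forward (σ := σ.symm) (i := x.1) (fun y => ?_) (fun y hy => ?_) ?_ ⟨?_, ?_⟩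
    · have := (karp_noArc B).adj_symm _ _ (hσ (σ.symm y))
      rwa [Equiv.apply_symm_apply] at this
    · apply h2 y
      rw [← hy]
      simp only [Equiv.apply_symm_apply]
      rw [hy]
    · obtain ⟨l, hl, hl'⟩ := hT
      refine ⟨l.reverse, by simpa using hl, hl'.reverse.mono fun a b hab => ?_⟩
      rw [← hab, Equiv.symm_apply_apply]
    · rw [Equiv.symm_apply_eq, hb2]
    · rw [Equiv.symm_apply_eq, hb1]

end HCP

/-! ## From sub-cubic to cubic graphs -/

namespace HCP

open MixedGraph

theorem diamond_noArc : diamond.NoArc := fun _ _ => id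

theorem diamond_adj_iff (x y : Fin 4) :
    diamond.adj x y ↔ x ≠ y ∧ ¬ (x = 0 ∧ y = 3) ∧ ¬ (x = 3 ∧ y = 0) := by
  have h : diamond.adj x y ↔ s(x, y) ∈ ({s(0, 1), s(0, 2), s(1, 2), s(1, 3), s((2 : Fin 4), 3)} :
      Set (Sym2 (Fin 4))) ∧ x ≠ y := by
    rw [← SimpleGraph.fromEdgeSet_adj]
    exact ⟨fun h => h.resolve_left id, Or.inr⟩
  rw [h]
  clear h
  simp only [Set.mem_insert_iff, Set.mem_singleton_iff]
  revert x y
  decide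

theorem degree_diamond (x : Fin 4) : diamond.degree x = ![2, 3, 3, 2] x := by
  refine (diamond_noArc.degree_eq x).trans ?_
  have h : diamond.edge.neighborSet x =
      {y : Fin 4 | x ≠ y ∧ ¬ (x = 0 ∧ y = 3) ∧ ¬ (x = 3 ∧ y = 0)} := by
    ext y
    refine Iff.trans ?_ (diamond_adj_iff x y)
    exact ⟨Or.inr, fun h => h.resolve_left id⟩
  have h' : (diamond.edge.neighborSet x).ncard =
      {y : Fin 4 | x ≠ y ∧ ¬ (x = 0 ∧ y = 3) ∧ ¬ (x = 3 ∧ y = 0)}.ncard := congrArg _ h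
  rw [h', Set.ncard_eq_toFinset_card']
  clear h h'
  revert x
  decide

theorem traversal_diamond {a b : Fin 4} (ha : a ∈ ({0, 3} : Set (Fin 4)))
    (hb : b ∈ ({0, 3} : Set (Fin 4))) (hab : a ≠ b) : HasTraversal diamond.adj a b := by
  have h : HasTraversal diamond.adj (0 : Fin 4) (3 : Fin 4) := by
    refine ⟨([0, 1, 2, 3] : List (Fin 4)), (by decide : ([0, 1, 2, 3] : List (Fin 4)).Nodup),
      (by decide : ∀ v : Fin 4, v ∈ [0, 1, 2, 3]), ?_, rfl, rfl⟩
    exact (by decide : ([0, 1, 2, 3] : List (Fin 4)).IsChain fun x y =>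
      x ≠ y ∧ ¬ (x = 0 ∧ y = 3) ∧ ¬ (x = 3 ∧ y = 0)).imp fun x y h => (diamond_adj_iff x y).2 h
  rcases ha with rfl | rfl <;> rcases hb with rfl | rfl
  · exact absurd rfl hab
  · exact h
  · exact h.symm diamond_noArc.adj_symm
  · exact absurd rfl hab

/-! ### Subgraphs with only two external edges -/

section Exit

variable {M : MixedGraph} {v : M.V} {H : MixedGraph} {p : Kind × M.V → H.V}

theorem exists_exit (l : List (M.replace v H p).V) (h : H.V) (x : {w : M.V // w ≠ v}) :
    ∃ m₁ z w m₂, rinr h :: (l ++ [rinl x]) = m₁ ++ rinr z :: rinl w :: m₂ := by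
  induction l generalizing h with
  | nil => exact ⟨[], h, x, [], rfl⟩
  | cons a l ih =>
    rcases replace_cases a with ⟨a, rfl⟩ | ⟨a, rfl⟩
    · exact ⟨[], h, a, l ++ [rinl x], rfl⟩
    · obtain ⟨m₁, z, w, m₂, hm⟩ := ih a
      exact ⟨rinr h :: m₁, z, w, m₂, by rw [List.cons_append, List.cons_append, ← hm]⟩

/-- A Hamiltonian cycle visits a subgraph with only two external edges once. -/
theorem Ham.of_replace_of_two [Nonempty H.V] {a b : H.V} (hp : Set.BijOn p (M.incident v) {a, b})
    (hM : ∃ u, u ≠ v) (h : (M.replace v H p).Ham) : M.Ham := by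
  refine Ham.of_replace hM ?_ h
  intro h0 t u ht hu huh
  rw [List.isChain_iff_forall_rel_of_append_cons_cons]
  rintro x' y' l₁ l₂ hl ⟨⟨x, rfl⟩, ⟨y, rfl⟩⟩
  rcases l₁ with _ | ⟨c, l₁⟩
  · exact rinl_ne_rinr _ _ (List.cons.inj hl).1.symm
  obtain ⟨rfl, rfl⟩ : c = rinr h0 ∧ t = l₁ ++ rinl x :: rinr y :: l₂ := by
    obtain ⟨h1, h2⟩ := List.cons.inj hl
    exact ⟨h1.symm, h2⟩
  clear hl
  have hnd := ht.1
  obtain ⟨e₀, he₀, -, he₀u, rfl⟩ := adj_rinl_rinr.1 huh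
  have hch := ht.isChain
  rw [← List.cons_append] at hch
  have hxy : (M.replace v H p).adj (rinl x) (rinr y) := (List.isChain_cons_cons.1
    hch.right_of_append).1
  obtain ⟨e₁, he₁, -, -, rfl⟩ := adj_rinl_rinr.1 hxy
  -- Suppose there are two entries, along `e₀` and `e₁`. They lead to different vertices, and
  -- between them the tour leaves `H` along some `e₂`, at a vertex other than `p e₁`. Only `p e₀`
  -- remains, and `p` is injective, so the tour leaves along the edge `e₀` by which it came.
  have hne : p e₁ ≠ p e₀ := by
    intro h
    rw [h] at hnd
    simp at hnd
  obtain ⟨m₁, z, w, m₂, hm⟩ := exists_exit l₁ (p e₀) x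
  have hsplit : rinr (p e₀) :: (l₁ ++ rinl x :: rinr (p e₁) :: l₂) =
      m₁ ++ rinr z :: rinl w :: (m₂ ++ rinr (p e₁) :: l₂) := by
    have := congrArg (· ++ rinr (p e₁) :: l₂) hm
    simpa using this
  have hzw : (M.replace v H p).adj (rinr z) (rinl w) := by
    rw [List.cons_append, hsplit] at hch
    exact (List.isChain_cons_cons.1 hch.right_of_append).1
  obtain ⟨e₂, he₂, -, he₂w, rfl⟩ := adj_rinr_rinl.1 hzw
  have hne' : p e₂ ≠ p e₁ := by
    intro h
    rw [hsplit, h] at hnd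
    have := (List.nodup_append.1 hnd).2.1
    simp at this
  have h20 : p e₂ = p e₀ := by
    have h0 := hp.mapsTo he₀
    have h1 := hp.mapsTo he₁
    have h2 := hp.mapsTo he₂
    rcases h0 with h0 | h0 <;> rcases h1 with h1 | h1 <;> rcases h2 with h2 | h2 <;>
      first
        | exact h2.trans h0.symm
        | exact absurd (h1.trans h0.symm) hne
        | exact absurd (h2.trans h1.symm) hne'
  obtain rfl := hp.injOn he₂ he₀ h20
  obtain rfl : w = u := Subtype.ext (he₂w.symm.trans he₀u)
  -- The vertex `w` outside is thus the last vertex of the tour, yet it also occurs before the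
  -- second entry.
  rw [hsplit] at hu hnd
  have hlast : rinl w ∈ m₂ ++ rinr (p e₁) :: l₂ := by
    rw [List.getLast?_append, List.getLast?_cons_cons, List.getLast?_cons,
      List.getLast?_eq_some_getLast (l := m₂ ++ rinr (p e₁) :: l₂) (by simp)] at hu
    have : (m₂ ++ rinr (p e₁) :: l₂).getLast (by simp) = rinl w := by simpa using hu
    rw [← this]
    exact List.getLast_mem _
  have := (List.nodup_append.1 hnd).2.1
  exact (List.nodup_cons.1 (List.nodup_cons.1 this).2).1 hlast

end Exit

theorem degree_rinr_diamond {M : MixedGraph} {v : M.V} {p : Kind × M.V → Fin 4}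
    (hp : Set.BijOn p (M.incident v) {0, 3}) (x : diamond.V) :
    (M.replace v diamond p).degree (rinr x) = 3 := by
  rw [degree_rinr_of_bijOn (H := diamond) hp, degree_diamond x]
  split_ifs with hS
  · exact (by decide : ∀ y : Fin 4, (y = 0 ∨ y = 3) → (![2, 3, 3, 2] y : ℕ) + 1 = 3) x hS
  · exact (by decide : ∀ y : Fin 4, ¬ (y = 0 ∨ y = 3) → (![2, 3, 3, 2] y : ℕ) + 0 = 3) x hS

/-- Without arcs, degree 2 means two different neighbours, which supplies the three vertices needed
to splice a diamond into a tour. -/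
theorem DiamondStep.ham_iff {M M' : MixedGraph} (hM : M.NoArc) (h : DiamondStep M M') :
    M'.Ham ↔ M.Ham := by
  obtain ⟨v, p, hv, hp, rfl⟩ := h
  have : Nonempty diamond.V := ⟨(0 : Fin 4)⟩
  constructor
  · exact Ham.of_replace_of_two (H := diamond) hp (exists_ne_of_degree_pos (by omega))
  · refine Ham.replace (H := diamond) ?_ (Or.inr ?_)
    · intro x hx y hy hxy _ _
      exact traversal_diamond (hp.mapsTo hx) (hp.mapsTo hy) fun h => hxy (hp.injOn hx hy h)
    · have h3 := M.kdeg_lt_card .und v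
      rw [degree_eq, hM.kdeg_inc, hM.kdeg_out] at hv
      omega

theorem card_diamond_total (c : ℕ) : diamond.total (fun _ => c) = 4 * c := by
  rw [total_const]
  have : Nat.card diamond.V = Nat.card (Fin 4) := rfl
  rw [this, Nat.card_eq_fintype_card, Fintype.card_fin]

theorem diamondStep_total {M M' : MixedGraph} (h : DiamondStep M M') (F : ℕ → ℕ) :
    M'.total (fun v => F (M'.degree v)) + F 2 = M.total (fun v => F (M.degree v)) + 4 * F 3 := by
  obtain ⟨v, p, hv, hp, rfl⟩ := h
  have := total_replace (M := M) (v := v) (H := diamond) (p := p)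
    (f := fun x => F ((M.replace v diamond p).degree x)) (g := fun x => F (M.degree x))
    fun w => congrArg F (degree_rinl w)
  simp only [degree_rinr_diamond hp, card_diamond_total, hv] at this
  exact this

theorem diamondStep_terminates : LoopTerminates DiamondStep := by
  refine .of_measure (fun M => M.total fun v => if M.degree v = 2 then 1 else 0) fun M M' h => ?_
  have := diamondStep_total h fun n => if n = 2 then 1 else 0
  simp only [if_true] at this
  simp at this
  omega

theorem degree_ne_of_forall_not_diamondStep {M : MixedGraph} (h : ∀ M', ¬ DiamondStep M M')
    (v : M.V) : M.degree v ≠ 2 := by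
  intro hv
  have h2 : (M.incident v).ncard = ({0, 3} : Set (Fin 4)).ncard := by
    rw [Set.ncard_pair (by decide)]
    exact hv
  obtain ⟨p, hp⟩ := exists_bijOn_of_ncard_eq h2
  exact h _ ⟨v, p, hv, hp, rfl⟩

theorem diamondSteps_invariant {D H : MixedGraph} (hD : D.NoArc)
    (hd : ∀ v, D.degree v = 2 ∨ D.degree v = 3) (h : RunLoop DiamondStep D H) :
    H.NoArc ∧ (∀ v, H.degree v = 3) ∧ (H.Ham ↔ D.Ham) ∧ Nat.card H.V ≤ 4 * Nat.card D.V := by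
  -- A vertex of degree 2 counts as the four cubic vertices that will replace it, so the sum does
  -- not change in a step.
  let F : ℕ → ℕ := fun n => if n = 2 then 4 else 1
  obtain ⟨h1, h2, h3, h4⟩ := reflTransGen_invariant (P := fun X => X.NoArc ∧
    (∀ v, X.degree v = 2 ∨ X.degree v = 3) ∧ (X.Ham ↔ D.Ham) ∧
      X.total (fun v => F (X.degree v)) ≤ D.total fun v => F (D.degree v))
    (fun X Y hXY ⟨h1, h2, h3, h4⟩ => by
      have ht := diamondStep_total hXY F
      have hF2 : F 2 = 4 := rfl
      have hF3 : F 3 = 1 := rfl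
      refine ⟨?_, ?_, (hXY.ham_iff h1).trans h3, by omega⟩
      · obtain ⟨v, p, hv, hp, rfl⟩ := hXY
        exact h1.replace diamond_noArc
      · obtain ⟨v, p, hv, hp, rfl⟩ := hXY
        intro x
        rcases replace_cases x with ⟨w, rfl⟩ | ⟨x, rfl⟩
        · have : (X.replace v diamond p).degree (rinl w) = X.degree w := degree_rinl w
          rw [this]
          exact h2 w
        · exact Or.inr (degree_rinr_diamond hp x))
    h.1 ⟨hD, hd, Iff.rfl, le_rfl⟩
  refine ⟨h1, fun v => (h2 v).resolve_left (degree_ne_of_forall_not_diamondStep h.2 v), h3, ?_⟩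
  have e1 : H.total (fun _ => 1) ≤ H.total fun v => F (H.degree v) :=
    total_mono fun v => by simp only [F]; split_ifs <;> omega
  have e2 : D.total (fun v => F (D.degree v)) ≤ D.total fun _ => 4 :=
    total_mono fun v => by simp only [F]; split_ifs <;> omega
  rw [total_const] at e1 e2
  omega

/-! ### Vertices of degree at most one, and the Petersen graph -/

/-- Predecessor and successor of `v` would be the same neighbour, which is impossible in a tour
through three or more vertices. -/
theorem not_ham_of_degree_le_one {M : MixedGraph} (hM : M.NoArc) (h3 : 3 ≤ Nat.card M.V)
    {v : M.V} (hv : M.degree v ≤ 1) : ¬ M.Ham := by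
  intro h
  obtain ⟨σ, hσ, hT⟩ := HasTour.exists_perm h
  rw [hM.degree_eq, Set.ncard_le_one] at hv
  have h1 : M.edge.Adj v (σ v) := (hσ v).resolve_left (hM _ _)
  have h2 : M.edge.Adj v (σ.symm v) := by
    have := hM.adj_symm _ _ (hσ (σ.symm v))
    rw [Equiv.apply_symm_apply] at this
    exact this.resolve_left (hM _ _)
  have := hv _ h1 _ h2
  exact perm_apply_apply_ne hT h3 v (by rw [this, Equiv.apply_symm_apply])

/-- Search for a path with `n` further steps, from `a` to a neighbour of `s`, which avoids `a` and
the vertices in `l`. -/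
def tourSearch {V : Type*} [DecidableEq V] (nb : V → List V) (s : V) : ℕ → V → List V → Bool
  | 0, a, _ => decide (s ∈ nb a)
  | n + 1, a, l => (nb a).any fun b =>
      !decide (b ∈ a :: l) && tourSearch nb s n b (a :: l)

/-- Only completeness of the search is proved: a failed search then excludes a tour, which is all
that the Petersen graph requires. -/
theorem tourSearch_eq_true {V : Type*} [DecidableEq V] {nb : V → List V} {R : V → V → Prop}
    (hR : ∀ x y, R x y → y ∈ nb x) {s : V} (t : List V) : ∀ (a : V) (l : List V),
      (a :: t).IsChain R → (a :: t).Nodup → (∀ x ∈ t, x ∉ l) →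
        (∀ e, (a :: t).getLast? = some e → R e s) → tourSearch nb s t.length a l = true := by
  induction t with
  | nil =>
    intro a l _ _ _ h
    exact decide_eq_true (hR _ _ (h a rfl))
  | cons b t ih =>
    intro a l hc hn hl h
    rw [List.isChain_cons_cons] at hc
    have hn' := List.nodup_cons.1 hn
    rw [List.length_cons, tourSearch, List.any_eq_true]
    refine ⟨b, hR _ _ hc.1, ?_⟩
    have hb : b ∉ a :: l := by
      rw [List.mem_cons, not_or]
      exact ⟨fun hba => hn'.1 (by simp [hba]), hl b (by simp)⟩
    rw [decide_eq_false hb, ih b (a :: l) hc.2 hn'.2 ?_ (by simpa using h)]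
    · rfl
    · intro x hx
      rw [List.mem_cons, not_or]
      exact ⟨fun hxa => hn'.1 (by simp [← hxa, hx]), hl x (by simp [hx])⟩

theorem HasTour.tourSearch_eq_true {V : Type*} [Fintype V] [DecidableEq V] {nb : V → List V}
    {R : V → V → Prop} (hR : ∀ x y, R x y → y ∈ nb x) (h : HasTour R) (s : V) :
    tourSearch nb s (Fintype.card V - 1) s [] = true := by
  obtain ⟨t, ht⟩ := h.exists_cons s
  have hlen := ht.length_eq
  rw [Nat.card_eq_fintype_card, List.length_cons] at hlen
  rw [← hlen, Nat.add_sub_cancel]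
  refine HCP.tourSearch_eq_true hR t s [] ht.isChain ht.1 (by simp) fun e he => ?_
  exact ((cycleChain_iff_of_head?_of_getLast? rfl he).1 ht.2.2).2

/-- The neighbours of a vertex of the Petersen graph. -/
def petersenNeighbors : Fin 5 × Bool → List (Fin 5 × Bool)
  | (i, false) => [(i + 1, false), (i + 4, false), (i, true)]
  | (i, true) => [(i, false), (i + 2, true), (i + 3, true)]

theorem petersen_noArc : petersen.NoArc := fun _ _ => id

theorem petersen_adj_iff (x y : Fin 5 × Bool) : petersen.adj x y ↔ y ∈ petersenNeighbors x := by
  have h : petersen.adj x y ↔ x ≠ y ∧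
      (((x.2 = false ∧ y.2 = false ∧ y.1 = x.1 + 1) ∨ (x.2 = false ∧ y.2 = true ∧ y.1 = x.1) ∨
        (x.2 = true ∧ y.2 = true ∧ y.1 = x.1 + 2)) ∨
      ((y.2 = false ∧ x.2 = false ∧ x.1 = y.1 + 1) ∨ (y.2 = false ∧ x.2 = true ∧ x.1 = y.1) ∨
        (y.2 = true ∧ x.2 = true ∧ x.1 = y.1 + 2))) :=
    ⟨fun h => h.resolve_left id, Or.inr⟩
  rw [h]
  clear h
  revert x y
  decide

theorem petersen_not_ham : ¬ petersen.Ham := by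
  intro h
  have h' : HasTour fun x y : Fin 5 × Bool => petersen.adj x y := h
  have := HasTour.tourSearch_eq_true (fun x y hxy => (petersen_adj_iff x y).1 hxy) h' (0, false)
  -- Ten vertices, so nine steps after the starting vertex; the search of this depth is evaluated by
  -- the kernel.
  have h9 : Fintype.card (Fin 5 × Bool) - 1 = 9 := by simp
  rw [h9] at this
  revert this
  decide +kernel

theorem degree_petersen (x : Fin 5 × Bool) : petersen.degree x = 3 := by
  refine (petersen_noArc.degree_eq x).trans ?_
  have h : petersen.edge.neighborSet x = {y : Fin 5 × Bool | y ∈ petersenNeighbors x} := by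
    ext y
    refine Iff.trans ?_ (petersen_adj_iff x y)
    exact ⟨Or.inr, fun h => h.resolve_left id⟩
  have h' : (petersen.edge.neighborSet x).ncard =
      {y : Fin 5 × Bool | y ∈ petersenNeighbors x}.ncard := congrArg _ h
  rw [h', Set.ncard_eq_toFinset_card']
  clear h h'
  revert x
  decide

theorem card_petersen : Nat.card petersen.V = 10 := by
  have : Nat.card petersen.V = Nat.card (Fin 5 × Bool) := rfl
  rw [this, Nat.card_eq_fintype_card]
  rfl

/-- The assumption `h3` excludes a single edge, which has a tour although its vertices have degree
1. The factor 10 covers the Petersen graph, whose size is at most 10 even in absolute terms;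
diamonds need only 4. -/
theorem subcubicToCubic_invariant {D H : MixedGraph} (hD : D.NoArc) (hd : ∀ v, D.degree v ≤ 3)
    (h3 : Nat.card D.V = 0 ∨ 3 ≤ Nat.card D.V) (h : SubcubicToCubic D H) :
    H.NoArc ∧ (∀ v, H.degree v = 3) ∧ (H.Ham ↔ D.Ham) ∧ Nat.card H.V ≤ 10 * Nat.card D.V ∧
      ((∃ v, D.degree v ≤ 1) → Nat.card H.V ≤ 10) := by
  rcases h with ⟨⟨v, hv⟩, rfl⟩ | ⟨hv, h⟩
  · have : Nonempty D.V := ⟨v⟩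
    have hpos := Nat.card_pos (α := D.V)
    refine ⟨petersen_noArc, degree_petersen, iff_of_false petersen_not_ham
      (not_ham_of_degree_le_one hD (by omega) hv), ?_, fun _ => card_petersen.le⟩
    rw [card_petersen]
    omega
  · obtain ⟨h1, h2, h3, h4⟩ := diamondSteps_invariant hD (fun v => by
      have := hd v
      by_contra hc
      exact hv ⟨v, by omega⟩) h
    exact ⟨h1, h2, h3, by omega, fun h => absurd h hv⟩

end HCP

/-! ## The conversion -/

namespace HCP

open MixedGraph

theorem _root_.MixedGraph.NoArc.hasHamiltonianCycle_iff {H : MixedGraph} (hH : H.NoArc)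
    (h3 : ∀ v, H.degree v = 3) : HasHamiltonianCycle H ↔ H.Ham := by
  classical
  -- A cubic graph is empty or has at least four vertices, so Mathlib's notion agrees with the
  -- existence of a tour.
  have hcard : Nat.card H.V ≠ 1 ∧ Nat.card H.V ≠ 2 := by
    rcases isEmpty_or_nonempty H.V with h | ⟨⟨v⟩⟩
    · simp
    · have h1 := H.kdeg_lt_card .und v
      have h2 := h3 v
      rw [degree_eq, hH.kdeg_inc, hH.kdeg_out] at h2
      omega
  let _ : DecidableEq H.V := Classical.decEq H.V
  let _ : Fintype H.V := Fintype.ofFinite H.V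
  rw [Nat.card_eq_fintype_card] at hcard
  refine (isHamiltonian_iff_hasTour H.edge hcard.1 hcard.2).trans ?_
  have : H.edge.Adj = H.adj := by
    ext x y
    exact ⟨Or.inr, fun h => h.resolve_left (hH x y)⟩
  rw [this]
  rfl

theorem _root_.MixedGraph.NoArc.ncard_edgeSet_le {H : MixedGraph} (hH : H.NoArc)
    (h3 : ∀ v, H.degree v = 3) : H.edge.edgeSet.ncard ≤ 2 * Nat.card H.V := by
  classical
  have := Fintype.ofFinite H.V
  have h := H.edge.sum_degrees_eq_twice_card_edges
  have hd : ∀ v, H.edge.degree v = 3 := by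
    intro v
    rw [← h3 v, hH.degree_eq, ← SimpleGraph.card_neighborSet_eq_degree, Set.ncard_eq_toFinset_card',
      Set.toFinset_card]
  simp only [hd, Finset.sum_const, Finset.card_univ, smul_eq_mul] at h
  rw [Nat.card_eq_fintype_card, Set.ncard_eq_toFinset_card']
  have : H.edge.edgeSet.toFinset.card = H.edge.edgeFinset.card := rfl
  omega

/-! ### Counting in the given instance -/

theorem numArcs_eq_sum {V : Type} [Fintype V] (G : Digraph V) : numArcs G = ∑ u, {v | G.Adj u v}.ncard := by
  classical
  have h : ∀ u, {v | G.Adj u v}.ncard = ∑ v, if G.Adj u v then 1 else 0 := by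
    intro u
    rw [Set.ncard_eq_toFinset_card', Set.toFinset_ofPred, Finset.card_filter]
  simp only [h]
  rw [numArcs, Set.ncard_eq_toFinset_card', Set.toFinset_ofPred, Finset.card_filter,
    Fintype.sum_prod_type]

section Counting

variable {V : Type} [Finite V] (G : Digraph V) (hG : ∀ v, ¬ G.Adj v v)

theorem ofDigraph_noUnd : (ofDigraph G hG).NoUnd := fun _ _ => id

theorem ofDigraph_ham_iff : (ofDigraph G hG).Ham ↔ HasDirectedHamiltonianCycle G := by
  rw [hasDirectedHamiltonianCycle_iff]
  have : (ofDigraph G hG).adj = G.Adj := by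
    ext x y
    exact ⟨fun h => h.resolve_right id, Or.inl⟩
  rw [Ham, this]
  rfl

theorem total_kdeg_out : (ofDigraph G hG).total ((ofDigraph G hG).kdeg .out) = numArcs G := by
  have := Fintype.ofFinite V
  rw [numArcs_eq_sum]
  exact finsum_eq_sum_of_fintype (α := V) _

theorem total_kdeg_inc : (ofDigraph G hG).total ((ofDigraph G hG).kdeg .inc) = numArcs G := by
  classical
  have := Fintype.ofFinite V
  have h : ∀ u, {v | G.Adj v u}.ncard = ∑ v, if G.Adj v u then 1 else 0 := by
    intro u
    rw [Set.ncard_eq_toFinset_card', Set.toFinset_ofPred, Finset.card_filter]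
  have h' : ∀ u, {v | G.Adj u v}.ncard = ∑ v, if G.Adj u v then 1 else 0 := by
    intro u
    rw [Set.ncard_eq_toFinset_card', Set.toFinset_ofPred, Finset.card_filter]
  have h1 : (ofDigraph G hG).total ((ofDigraph G hG).kdeg .inc) = ∑ u, {v | G.Adj v u}.ncard :=
    finsum_eq_sum_of_fintype (α := V) _
  rw [h1, numArcs_eq_sum]
  simp only [h, h']
  exact Finset.sum_comm

theorem sumMaxDegree_eq_total : sumMaxDegree G =
    (ofDigraph G hG).total fun v =>
      max ((ofDigraph G hG).kdeg .inc v) ((ofDigraph G hG).kdeg .out v) := rfl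

theorem numArcs_le_sumMaxDegree (hG : ∀ v, ¬ G.Adj v v) : numArcs G ≤ sumMaxDegree G := by
  rw [← total_kdeg_inc G hG, sumMaxDegree_eq_total G hG]
  exact total_mono fun v => le_max_left _ _

/-- A vertex that is not isolated contributes at least 1 to `k`; isolated vertices contribute
nothing and must be treated separately. -/
theorem card_le_sumMaxDegree (h : ∀ v, 0 < (ofDigraph G hG).degree v) :
    Nat.card V ≤ sumMaxDegree G := by
  rw [sumMaxDegree_eq_total G hG]
  have h1 : (ofDigraph G hG).total (fun _ => 1) ≤ (ofDigraph G hG).total fun v =>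
      max ((ofDigraph G hG).kdeg .inc v) ((ofDigraph G hG).kdeg .out v) := by
    refine total_mono fun v => ?_
    have := h v
    rw [degree_eq, (ofDigraph_noUnd G hG).kdeg_und] at this
    omega
  rw [total_const, mul_one] at h1
  exact h1

theorem splitSize_add_numBad_le (d : ℕ) :
    splitSize (ofDigraph G hG) + numBad d (ofDigraph G hG) ≤ 4 * (Nat.card V + numArcs G) := by
  have hc : (ofDigraph G hG).total (fun _ => 1) = Nat.card V := by
    rw [total_const, mul_one]
    rfl
  have h1 : splitSize (ofDigraph G hG) ≤ Nat.card V + 2 * (numArcs G + numArcs G) := by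
    have : (ofDigraph G hG).total (fun v => 1 + 2 * ((ofDigraph G hG).kdeg .inc v +
        (ofDigraph G hG).kdeg .out v)) = Nat.card V + 2 * (numArcs G + numArcs G) := by
      rw [total_add, hc, total_mul, total_add, total_kdeg_inc, total_kdeg_out]
    rw [← this]
    exact total_mono fun v => by omega
  have h2 : numBad d (ofDigraph G hG) ≤ Nat.card V := by
    rw [← hc]
    exact total_mono fun v => by split_ifs <;> omega
  omega

end Counting

theorem exists_conversion {d : ℕ} (hd : 4 ≤ d) (M : MixedGraph) : ∃ H, Conversion d M H := by
  obtain ⟨A, hA⟩ := (splitStep_terminates hd).exists_runLoop M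
  obtain ⟨B, hB⟩ := gateStep_terminates.exists_runLoop A
  obtain ⟨D, hD⟩ := fourGateStep_terminates.exists_runLoop (karp B)
  by_cases h : ∃ v, D.degree v ≤ 1
  · exact ⟨petersen, A, B, D, hA, hB, hD, Or.inl ⟨h, rfl⟩⟩
  · obtain ⟨H, hH⟩ := diamondStep_terminates.exists_runLoop D
    exact ⟨H, A, B, D, hA, hB, hD, Or.inr ⟨h, hH⟩⟩

theorem FourGateStep.three_le_card {M M' : MixedGraph} (h : FourGateStep M M') :
    3 ≤ Nat.card M'.V := by
  obtain ⟨v, p, -, -, rfl⟩ := h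
  have h1 := Nat.card_le_card_of_injective _ (rinr_injective (v := v) (H := gate 4) (p := p))
  rw [Nat.card_eq_fintype_card, card_gate] at h1
  omega

/-- Properties of the outcomes of the conversion, with a bound in terms of the number of vertices
of the graph and their degrees. -/
theorem Conversion.invariant {d : ℕ} (hd : 4 ≤ d) {M H : MixedGraph} (hM : M.NoUnd)
    (h : Conversion d M H) :
    H.NoArc ∧ (∀ v, H.degree v = 3) ∧ (H.Ham ↔ M.Ham) ∧
      Nat.card H.V ≤ 330 * (gateSize (2 * d) * (splitSize M + numBad d M)) ∧
      ((∃ v, M.degree v ≤ 0) → Nat.card H.V ≤ 10) := by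
  obtain ⟨A, B, D, hA, hB, hD, hH⟩ := h
  obtain ⟨a1, a2, a3⟩ := splitSteps_invariant hM hA.1
  have a4 := card_le_of_splitSteps hd hA.1
  have a5 : ∀ v, A.degree v ≤ 2 * d := by
    intro v
    have := kdeg_le_of_forall_not_splitStep hd hA.2 v
    rw [degree_eq, a1.kdeg_und]
    omega
  obtain ⟨b1, b2, b3⟩ := gateSteps_invariant hB.1
  have b4 := degree_le_of_forall_not_gateStep hB.2
  have b5 : Nat.card B.V ≤ gateSize (2 * d) * (splitSize M + numBad d M) := by
    have : A.total (fun v => gateSize (A.degree v)) ≤ A.total fun _ => gateSize (2 * d) :=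
      total_mono fun v => gateSize_mono (a5 v)
    rw [total_const, mul_comm] at this
    exact b3.trans (this.trans (Nat.mul_le_mul_left _ a4))
  obtain ⟨d1, d2, d3, d4, d5⟩ := fourGateSteps_invariant (karp_noArc B) (degree_karp_le b4) hD
  rw [card_karp] at d5
  -- The number of vertices is a multiple of 3 after Karp's conversion, and every 4-gate brings in
  -- more than three.
  have d6 : Nat.card D.V = 0 ∨ 3 ≤ Nat.card D.V :=
    reflTransGen_invariant (P := fun X : MixedGraph => Nat.card X.V = 0 ∨ 3 ≤ Nat.card X.V)
      (fun X Y h _ => Or.inr h.three_le_card) hD.1 (by rw [card_karp]; omega)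
  obtain ⟨h1, h2, h3, h4, h5⟩ := subcubicToCubic_invariant d1 d2 d6 hH
  -- 330 is 3 from Karp's conversion, times 11 from the 4-gates, times 10 from the last stage.
  refine ⟨h1, h2, h3.trans (d3.trans ((karp_ham_iff B).trans (b1.trans a2))), by omega,
    fun h => h5 (d4 1 (by omega) ?_)⟩
  obtain ⟨v, hv⟩ := b2 0 (by omega) (a3 h)
  -- An isolated vertex becomes a path whose first vertex has only the middle one as a neighbour.
  exact ⟨kv v 0, (degree_karp_zero_le v).trans (by omega)⟩

end HCP

theorem mainTheorem1 (d : ℕ) (hd : 4 ≤ d) :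
    -- none of the loops of the procedure can run forever
    (LoopTerminates (HCP.InSplitStep d) ∧ LoopTerminates (HCP.OutSplitStep d) ∧
      LoopTerminates (HCP.SplitStep d) ∧ LoopTerminates HCP.GateStep ∧
      LoopTerminates HCP.FourGateStep ∧ LoopTerminates HCP.DiamondStep) ∧
    ∃ C : ℕ, ∀ (V : Type) [Finite V] (G : Digraph V) (hG : ∀ v, ¬ G.Adj v v),
      -- the procedure has an outcome
      (∃ H, HCP.Conversion d (MixedGraph.ofDigraph G hG) H) ∧
      -- every outcome is an equivalent undirected cubic instance of linear size
      ∀ H, HCP.Conversion d (MixedGraph.ofDigraph G hG) H →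
        HCP.IsUndirectedCubic H ∧
        (HCP.HasHamiltonianCycle H ↔ HasDirectedHamiltonianCycle G) ∧
        (0 < sumMaxDegree G →
          Nat.card H.V ≤ C * sumMaxDegree G ∧ H.edge.edgeSet.ncard ≤ C * sumMaxDegree G) ∧
        Nat.card H.V + H.edge.edgeSet.ncard ≤ C * (Nat.card V + numArcs G) := by
  -- The first summand of the constant comes from the edge bound in terms of `k`: 1320 is 330 times
  -- the 4 of `splitSize_add_numBad_le`, a further 2 comes from `N + e ≤ 2 * k`, and another 2 from
  -- bounding edges by vertices. The summand 20 covers the Petersen graph, for which at most 10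
  -- vertices and 20 edges are used.
  refine ⟨⟨HCP.inSplitStep_terminates hd, HCP.outSplitStep_terminates hd,
    HCP.splitStep_terminates hd, HCP.gateStep_terminates, HCP.fourGateStep_terminates,
    HCP.diamondStep_terminates⟩, 5280 * HCP.gateSize (2 * d) + 20, ?_⟩
  intro V _ G hG
  refine ⟨HCP.exists_conversion hd _, fun H hH => ?_⟩
  obtain ⟨h1, h2, h3, h4, h5⟩ := hH.invariant hd (HCP.ofDigraph_noUnd G hG)
  have hE := h1.ncard_edgeSet_le h2
  have hcard : Nat.card H.V ≤
      1320 * (HCP.gateSize (2 * d) * (Nat.card V + numArcs G)) := by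
    have := Nat.mul_le_mul_left (HCP.gateSize (2 * d)) (HCP.splitSize_add_numBad_le G hG d)
    rw [Nat.mul_left_comm] at this
    omega
  refine ⟨⟨h1, fun v => (h1.degree_eq v).symm.trans (h2 v)⟩,
    (h1.hasHamiltonianCycle_iff h2).trans (h3.trans (HCP.ofDigraph_ham_iff G hG)), fun hk => ?_, ?_⟩
  · rw [add_mul, mul_assoc]
    -- With an isolated vertex `k` does not control the number of vertices, but the outcome has at
    -- most 10 vertices and `k ≥ 1` suffices.
    by_cases hiso : ∃ v, (MixedGraph.ofDigraph G hG).degree v ≤ 0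
    · have := h5 hiso
      omega
    · push Not at hiso
      have e1 := HCP.card_le_sumMaxDegree G hG hiso
      have e2 := HCP.numArcs_le_sumMaxDegree G hG
      have e3 : HCP.gateSize (2 * d) * (Nat.card V + numArcs G) ≤
          HCP.gateSize (2 * d) * (2 * sumMaxDegree G) := Nat.mul_le_mul_left _ (by omega)
      rw [Nat.mul_left_comm] at e3
      omega
  · rw [add_mul, mul_assoc]
    omega
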